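/- **Conventions.** A topological operad $\mathscr C=\{\mathscr C(n)\}_{n\ge 0}$ (with $\mathscr C(0)$ a point) has continuous compositions $\gamma:\mathscr C(k)\times\mathscr C(m_1)\times\cdots\times\mathscr C(m_k)\to\mathscr C(m)$, $m=m_1+\cdots+m_k$, and a unit $1\in\mathscr C(1)$, and satisfies the usual associativity and unit axioms; an operad (in sets) is a discrete one. Products of permutations are written from the left to the right ($\sigma\sigma'$ is $\sigma$ followed by $\sigma'$), and so are products of loops. $\mathscr S=\{S_n\}$ is the operad of symmetric groups: $\gamma(\sigma;\tau_1,\dots,\tau_k)$ applies $\tau_i$ inside the $i$-th block and moves the $i$-th block to the place $\sigma(i)$. A *group operad* is an operad $\mathscr G=\{G_n\}$ of groups with a morphism of operads $\pi:\mathscr G\to\mathscr S$ consisting of homomorphisms, such that the unit is the identity of $G_1$ and $\gamma(aa';b_1b_1',\dots,b_kb_k')=\gamma(a;b_1,\dots,b_k)\,\gamma(a';b'_{a^{-1}(1)},\dots,b'_{a^{-1}(k)})$, where $a$ acts on indices through $\pi$. It is *non-crossed* if every $\pi:G_n\to S_n$ is trivial, and *crossed* otherwise. A morphism of group operads is a sequence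 of homomorphisms commuting with $\gamma$ and $\pi$. A *sub group operad* is a sequence of subgroups closed under $\gamma$; it is normal if every one of these subgroups is. A (topological) *$\mathscr G$-operad* is a (topological) operad $\mathscr C$ with left actions of $G_n$ on $\mathscr C(n)$ (by continuous maps) such that $\gamma(\sigma a;\tau_1b_1,\dots,\tau_kb_k)=\gamma(\sigma;\tau_1,\dots,\tau_k)\,\gamma(a;b_{\sigma^{-1}(1)},\dots,b_{\sigma^{-1}(k)})$. Let $\mathscr G$ be a group operad, $\mathscr H$ a non-crossed normal sub group operad, and $\mathscr C$ a topological $\mathscr G$-operad. Then $\mathscr G/\mathscr H=\{G_n/H_n\}$ is a group operad and the orbit spaces $\mathscr C/\mathscr H=\{\mathscr C(n)/H_n\}$ form a topological $\mathscr G/\mathscr H$-operad. Assume that * every $\mathscr C(n)/H_n$ is path-connected; * the action of $G_n/H_n$ on $\mathscr C(n)/H_n$ is a covering action for each $n$: every point has a neighbourhood $U$ with $gU\cap U=\emptyset$ for all $g\ne 1$; * $\mathscr C/\mathscr H$ has a good basepoint: there is a morphism $\eta:(\mathscr C_1)_0\to\mathscr C/\mathscr H$ of nonsymmetric topological operads,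 where $(\mathscr C_1)_0(n)$ is the path component of $c_n=([0,\frac1n],\dots,[\frac{n-1}n,1])$ in the space $\mathscr C_1(n)$ of the little intervals operad. Put $e_n=\eta(c_n)$. The images under $\eta$ of the straight-line paths in $(\mathscr C_1)_0(n)$ are called linear paths. Let $\mathscr C/\mathscr G=\{\mathscr C(n)/G_n\}$, with basepoints the images of the $e_n$. An element of $\pi_1(\mathscr C(n)/G_n)$ is represented by a path in $\mathscr C(n)/H_n$ from $e_n$ to $\sigma e_n$ with $\sigma\in G_n/H_n$. **Theorem.** 1. The groups $\pi_1(\mathscr C/\mathscr H)=\{\pi_1(\mathscr C(n)/H_n,e_n)\}$ form a non-crossed group operad, with $\gamma([f];[g_1],\dots,[g_k])=[\delta\cdot\gamma(f;g_1,\dots,g_k)\cdot\delta^{-1}]$, $\delta$ the linear path from $e_m$ to $\gamma(e_k;e_{m_1},\dots,e_{m_k})$. 2. The groups $\pi_1(\mathscr C/\mathscr G)=\{\pi_1(\mathscr C(n)/G_n)\}$ form a group operad. For paths $f$ from $e_k$ to $\sigma e_k$ and $g_i$ from $e_{m_i}$ to $\tau_ie_{m_i}$ in $\mathscr C/\mathscr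 H$ ($\sigma\in G_k/H_k$, $\tau_i\in G_{m_i}/H_{m_i}$), $\gamma([f];[g_1],\dots,[g_k])$ is represented by the path $\delta_1\cdot\gamma(f;g_1,\dots,g_k)\cdot\gamma(\sigma;\tau_1,\dots,\tau_k)\delta_2^{-1}$ from $e_m$ to $\gamma(\sigma;\tau_1,\dots,\tau_k)e_m$, where $\delta_1$ and $\delta_2$ are the linear paths from $e_m$ to $\gamma(e_k;e_{m_1},\dots,e_{m_k})$ and to $\gamma(e_k;e_{m_{\sigma^{-1}(1)}},\dots,e_{m_{\sigma^{-1}(k)}})$. The canonical homeomorphisms $(\mathscr C(n)/H_n)/(G_n/H_n)\cong\mathscr C(n)/G_n$ identify it, as a group operad, with $\pi_1((\mathscr C/\mathscr H)/(\mathscr G/\mathscr H))$. 3. There is a short exact sequence of group operads $$1\to\pi_1(\mathscr C/\mathscr H)\to\pi_1(\mathscr C/\mathscr G)\to\mathscr G/\mathscr H\to1,$$ in which the first map is induced by the projections $\mathscr C(n)/H_n\to\mathscr C(n)/G_n$ and the second map sends the class of a path from $e_n$ to $\sigma e_n$ to $\sigma$. 4. For $l>1$, and also for $l=1$ if $\mathscr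 G$ is non-crossed, $\pi_l(\mathscr C/\mathscr G)=\{\pi_l(\mathscr C(n)/G_n)\}$ is a $\pi_1(\mathscr C/\mathscr G)$-operad, where $\pi_1(\mathscr C(n)/G_n)$ acts on $\pi_l(\mathscr C(n)/G_n)$ in the usual way (by conjugation if $l=1$). Its composition is the one of part 2 if $l=1$; for $l>1$ it is given by $\gamma([f];[g_1],\dots,[g_k])=\delta_*[\gamma(f;g_1,\dots,g_k)]$ for $f$, $g_i$ representing elements of $\pi_l(\mathscr C(k)/H_k,e_k)$, $\pi_l(\mathscr C(m_i)/H_{m_i},e_{m_i})$, where $\pi_l(\mathscr C(n)/H_n,e_n)\cong\pi_l(\mathscr C(n)/G_n)$ by projection and $\delta_*$ is the change of basepoint along the linear path $\delta$ of part 1. -/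

import Mathlib

universe u v w

/-! ## Blocks -/

/-- The lexicographic identification of `k` consecutive blocks of sizes `m 0, …, m (k-1)` with
`{0, …, n-1}`, where `n = m 0 + ⋯ + m (k-1)`. -/
def blockIndex {k n : ℕ} (m : Fin k → ℕ) (h : ∑ i, m i = n) : (Σ i, Fin (m i)) ≃ Fin n :=
  finSigmaFinEquiv.trans (finCongr h)

theorem blockIndex_val {k n : ℕ} (m : Fin k → ℕ) (h : ∑ i, m i = n) (i : Fin k) (j : Fin (m i)) :
    (blockIndex m h ⟨i, j⟩ : ℕ) = ∑ i' ∈ Finset.univ.filter (· < i), m i' + j := by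
  simp only [blockIndex, Equiv.trans_apply, finCongr_apply, Fin.val_cast, finSigmaFinEquiv_apply]
  congr 1
  refine Finset.sum_bij (fun x _ => Fin.castLE i.2.le x) ?_ ?_ ?_ ?_
  · intro x _
    exact Finset.mem_filter.2 ⟨Finset.mem_univ _, x.2⟩
  · intro x _ y _ hxy
    simpa using hxy
  · intro b hb
    have hb' : b < i := by simpa using hb
    exact ⟨⟨b, hb'⟩, by simp, by ext; simp⟩
  · intro x _
    rfl

theorem blockIndex_lt {k n : ℕ} (m : Fin k → ℕ) (h : ∑ i, m i = n) (i i' : Fin k) (j : Fin (m i))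
    (j' : Fin (m i')) (hlt : i < i' ∨ (i = i' ∧ (j : ℕ) < j')) :
    blockIndex m h ⟨i, j⟩ < blockIndex m h ⟨i', j'⟩ := by
  rw [Fin.lt_def, blockIndex_val, blockIndex_val]
  rcases hlt with hlt | ⟨rfl, hlt⟩
  · have hsub : insert i (Finset.univ.filter (· < i)) ⊆ Finset.univ.filter (· < i') := by
      intro x hx
      simp only [Finset.mem_insert, Finset.mem_filter, Finset.mem_univ, true_and] at hx ⊢
      rcases hx with rfl | hx
      · exact hlt
      · exact hx.trans hlt
    have h1 := Finset.sum_le_sum_of_subset (f := m) hsub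
    rw [Finset.sum_insert (by simp)] at h1
    have := j.2
    omega
  · omega

theorem blockIndex_assoc {k M N : ℕ} (m : Fin k → ℕ) (hm : ∑ i, m i = M) (p : Fin M → ℕ)
    (hp : ∑ x, p x = N) (q : Fin k → ℕ) (hq : ∀ i, ∑ j, p (blockIndex m hm ⟨i, j⟩) = q i)
    (hN : ∑ i, q i = N) (i : Fin k) (j : Fin (m i)) (l : Fin (p (blockIndex m hm ⟨i, j⟩))) :
    blockIndex p hp ⟨blockIndex m hm ⟨i, j⟩, l⟩ =
      blockIndex q hN ⟨i, blockIndex (fun j => p (blockIndex m hm ⟨i, j⟩)) (hq i) ⟨j, l⟩⟩ := by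
  let E₁ : (Σ i, Σ j, Fin (p (blockIndex m hm ⟨i, j⟩))) ≃ Fin N :=
    (Equiv.sigmaAssoc (fun i j => Fin (p (blockIndex m hm ⟨i, j⟩)))).symm.trans
      ((Equiv.sigmaCongrLeft (β := fun x => Fin (p x)) (blockIndex m hm)).trans (blockIndex p hp))
  let E₂ : (Σ i, Σ j, Fin (p (blockIndex m hm ⟨i, j⟩))) ≃ Fin N :=
    (Equiv.sigmaCongrRight fun i =>
      blockIndex (fun j => p (blockIndex m hm ⟨i, j⟩)) (hq i)).trans (blockIndex q hN)
  have h₁ : ∀ i j l, E₁ ⟨i, j, l⟩ = blockIndex p hp ⟨blockIndex m hm ⟨i, j⟩, l⟩ :=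
    fun i j l => rfl
  have h₂ : ∀ i j l, E₂ ⟨i, j, l⟩ = blockIndex q hN
      ⟨i, blockIndex (fun j => p (blockIndex m hm ⟨i, j⟩)) (hq i) ⟨j, l⟩⟩ := fun i j l => rfl
  let R : (Σ i, Σ j, Fin (p (blockIndex m hm ⟨i, j⟩))) →
      (Σ i, Σ j, Fin (p (blockIndex m hm ⟨i, j⟩))) → Prop := fun x y =>
    x.1 < y.1 ∨ (x.1 = y.1 ∧ ((x.2.1 : ℕ) < y.2.1 ∨
      ((x.2.1 : ℕ) = y.2.1 ∧ (x.2.2 : ℕ) < y.2.2)))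
  have htri : ∀ x y, x ≠ y → R x y ∨ R y x := by
    rintro ⟨i, j, l⟩ ⟨i', j', l'⟩ hne
    simp only [R]
    rcases lt_trichotomy i i' with h | rfl | h
    · exact Or.inl (Or.inl h)
    · rcases lt_trichotomy j j' with h | rfl | h
      · exact Or.inl (Or.inr ⟨rfl, Or.inl h⟩)
      · rcases lt_trichotomy l l' with h | rfl | h
        · exact Or.inl (Or.inr ⟨rfl, Or.inr ⟨rfl, h⟩⟩)
        · exact absurd rfl hne
        · exact Or.inr (Or.inr ⟨rfl, Or.inr ⟨rfl, h⟩⟩)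
      · exact Or.inr (Or.inr ⟨rfl, Or.inl h⟩)
    · exact Or.inr (Or.inl h)
  have m₁ : ∀ x y, R x y → E₁ x < E₁ y := by
    rintro ⟨i, j, l⟩ ⟨i', j', l'⟩ h
    rw [h₁, h₁]
    apply blockIndex_lt
    rcases h with h | ⟨h, h'⟩
    · exact Or.inl (blockIndex_lt _ _ _ _ _ _ (Or.inl h))
    · dsimp only at h h'
      subst h
      rcases h' with h' | ⟨h', h''⟩
      · exact Or.inl (blockIndex_lt _ _ _ _ _ _ (Or.inr ⟨rfl, h'⟩))
      · obtain rfl : j = j' := Fin.ext h'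
        exact Or.inr ⟨rfl, h''⟩
  have m₂ : ∀ x y, R x y → E₂ x < E₂ y := by
    rintro ⟨i, j, l⟩ ⟨i', j', l'⟩ h
    rw [h₂, h₂]
    apply blockIndex_lt
    rcases h with h | ⟨h, h'⟩
    · exact Or.inl h
    · dsimp only at h h'
      subst h
      refine Or.inr ⟨rfl, ?_⟩
      rw [← Fin.lt_def]
      apply blockIndex_lt
      rcases h' with h' | ⟨h', h''⟩
      · exact Or.inl h'
      · obtain rfl : j = j' := Fin.ext h'
        exact Or.inr ⟨rfl, h''⟩
  have hmono : StrictMono (fun x => E₂ (E₁.symm x)) := by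
    intro x y hxy
    rcases htri (E₁.symm x) (E₁.symm y) (fun h => hxy.ne (E₁.symm.injective h)) with h | h
    · exact m₂ _ _ h
    · have := m₁ _ _ h
      simp only [Equiv.apply_symm_apply] at this
      exact absurd this hxy.asymm
  have hsurj : Function.Surjective (fun x => E₂ (E₁.symm x)) :=
    E₂.surjective.comp E₁.symm.surjective
  have key : OrderIso.refl (Fin N) = hmono.orderIsoOfSurjective _ hsurj := Subsingleton.elim _ _
  have := congrArg (fun e : Fin N ≃o Fin N => e (E₁ ⟨i, j, l⟩)) key
  simp only [OrderIso.refl_apply, StrictMono.coe_orderIsoOfSurjective,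
    Equiv.symm_apply_apply] at this
  exact this

theorem blockIndex_congr {k n : ℕ} {m m' : Fin k → ℕ} (hmm : m = m') (h : ∑ i, m i = n)
    (h' : ∑ i, m' i = n) {i i' : Fin k} (hi : i = i') (j : Fin (m i)) (j' : Fin (m' i'))
    (hj : (j : ℕ) = j') : blockIndex m h ⟨i, j⟩ = blockIndex m' h' ⟨i', j'⟩ := by
  subst hmm hi
  rw [Fin.ext hj]

/-! ## Operads -/

/-- The data and the axioms of a (nonsymmetric) operad in sets on a sequence `C 0, C 1, …` with
`C 0` a point. The arity `n = m 0 + ⋯ + m (k-1)` of the value of `γ` is a separate argument,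
together with a proof of this equality, so that no transports are needed. -/
structure OperadStr (C : ℕ → Type u) where
  zero_point : Nonempty (Unique (C 0))
  one : C 1
  γ : ∀ {k n : ℕ} (m : Fin k → ℕ), ∑ i, m i = n → C k → (∀ i, C (m i)) → C n
  one_γ : ∀ {n : ℕ} (h : ∑ _i : Fin 1, n = n) (a : C n), γ (fun _ : Fin 1 => n) h one (fun _ => a) = a
  γ_one : ∀ {n : ℕ} (h : ∑ _i : Fin n, 1 = n) (a : C n), γ (fun _ : Fin n => 1) h a (fun _ => one) = a
  assoc : ∀ {k M N : ℕ} (m : Fin k → ℕ) (hm : ∑ i, m i = M) (p : Fin M → ℕ) (hp : ∑ x, p x = N)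
    (q : Fin k → ℕ) (hq : ∀ i, ∑ j, p (blockIndex m hm ⟨i, j⟩) = q i) (hN : ∑ i, q i = N)
    (a : C k) (b : ∀ i, C (m i)) (c : ∀ x, C (p x)),
    γ p hp (γ m hm a b) c =
      γ q hN a (fun i => γ (fun j => p (blockIndex m hm ⟨i, j⟩)) (hq i) (b i)
        (fun j => c (blockIndex m hm ⟨i, j⟩)))

/-- The permutation of `{0, …, n-1}` which applies `τ i` within the `i`-th block, and then moves
the `i`-th block to the place with number `σ i`. -/
def blockPerm {k n : ℕ} (m : Fin k → ℕ) (h : ∑ i, m i = n) (σ : Equiv.Perm (Fin k))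
    (τ : ∀ i, Equiv.Perm (Fin (m i))) : Equiv.Perm (Fin n) :=
  (blockIndex m h).symm.trans ((Equiv.sigmaCongrRight τ).trans ((Equiv.sigmaCongrLeft' σ).trans
    (blockIndex (fun i => m (σ.symm i)) ((Equiv.sum_comp σ.symm m).trans h))))

theorem blockPerm_apply {k n : ℕ} (m : Fin k → ℕ) (h : ∑ i, m i = n) (σ : Equiv.Perm (Fin k))
    (τ : ∀ i, Equiv.Perm (Fin (m i))) (h' : ∑ i, m (σ.symm i) = n) (i : Fin k)
    (j : Fin (m (σ.symm i))) :
    blockPerm m h σ τ (blockIndex m h ⟨σ.symm i, j⟩) =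
      blockIndex (fun i => m (σ.symm i)) h' ⟨i, τ (σ.symm i) j⟩ := by
  simp only [blockPerm, Equiv.trans_apply, Equiv.symm_apply_apply]
  congr 1
  rw [Equiv.sigmaCongrLeft', Equiv.symm_apply_eq]
  rfl

theorem blockPerm_symm_apply {k n : ℕ} (m : Fin k → ℕ) (h : ∑ i, m i = n) (σ : Equiv.Perm (Fin k))
    (τ : ∀ i, Equiv.Perm (Fin (m i))) (h' : ∑ i, m (σ.symm i) = n) (i : Fin k)
    (j : Fin (m (σ.symm i))) :
    (blockPerm m h σ τ).symm (blockIndex (fun i => m (σ.symm i)) h' ⟨i, j⟩) =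
      blockIndex m h ⟨σ.symm i, (τ (σ.symm i)).symm j⟩ := by
  rw [Equiv.symm_apply_eq, blockPerm_apply m h σ τ h', Equiv.apply_symm_apply]

theorem blockPerm_assoc {k M N : ℕ} (m : Fin k → ℕ) (hm : ∑ i, m i = M) (p : Fin M → ℕ)
    (hp : ∑ x, p x = N) (q : Fin k → ℕ) (hq : ∀ i, ∑ j, p (blockIndex m hm ⟨i, j⟩) = q i)
    (hN : ∑ i, q i = N) (σ : Equiv.Perm (Fin k)) (τ : ∀ i, Equiv.Perm (Fin (m i)))
    (υ : ∀ x, Equiv.Perm (Fin (p x))) :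
    blockPerm p hp (blockPerm m hm σ τ) υ =
      blockPerm q hN σ (fun i => blockPerm (fun j => p (blockIndex m hm ⟨i, j⟩)) (hq i) (τ i)
        (fun j => υ (blockIndex m hm ⟨i, j⟩))) := by
  have hm' : ∑ i, m (σ.symm i) = M := (Equiv.sum_comp σ.symm m).trans hm
  have hN' : ∑ i, q (σ.symm i) = N := (Equiv.sum_comp σ.symm q).trans hN
  have hp' : ∑ x, p ((blockPerm m hm σ τ).symm x) = N :=
    (Equiv.sum_comp (blockPerm m hm σ τ).symm p).trans hp
  have hρ := fun i j => blockPerm_symm_apply m hm σ τ hm' i j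
  have hq' : ∀ i, ∑ j, p ((blockPerm m hm σ τ).symm
      (blockIndex (fun i => m (σ.symm i)) hm' ⟨i, j⟩)) = q (σ.symm i) := by
    intro i
    simp only [hρ]
    rw [Equiv.sum_comp (τ (σ.symm i)).symm (fun j => p (blockIndex m hm ⟨σ.symm i, j⟩)), hq]
  ext x
  congr 1
  obtain ⟨⟨y, l⟩, rfl⟩ := (blockIndex p hp).surjective x
  obtain ⟨y, rfl⟩ := (blockPerm m hm σ τ).symm.surjective y
  rw [blockPerm_apply p hp _ υ hp']
  obtain ⟨⟨i, j⟩, rfl⟩ := (blockIndex (fun i => m (σ.symm i)) hm').surjective y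
  rw [blockIndex_assoc (fun i => m (σ.symm i)) hm' (fun x => p ((blockPerm m hm σ τ).symm x)) hp'
    (fun i => q (σ.symm i)) hq' hN' i j]
  suffices key : ∀ (z : Fin M) (hz : (blockPerm m hm σ τ).symm
      (blockIndex (fun i => m (σ.symm i)) hm' ⟨i, j⟩) = z) (l : Fin (p z)),
      blockIndex (fun i => q (σ.symm i)) hN' ⟨i, blockIndex _ (hq' i)
        ⟨j, Fin.cast (congrArg p hz.symm) (υ z l)⟩⟩ = blockPerm q hN σ
          (fun i => blockPerm (fun j => p (blockIndex m hm ⟨i, j⟩)) (hq i) (τ i)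
            (fun j => υ (blockIndex m hm ⟨i, j⟩))) (blockIndex p hp ⟨z, l⟩) from key _ rfl l
  intro z hz l
  obtain rfl := (hρ i j).symm.trans hz
  rw [blockIndex_assoc m hm p hp q hq hN, blockPerm_apply q hN σ _ hN']
  have hqq : ∑ j, p (blockIndex m hm ⟨σ.symm i, (τ (σ.symm i)).symm j⟩) = q (σ.symm i) :=
    (Equiv.sum_comp (τ (σ.symm i)).symm (fun j => p (blockIndex m hm ⟨σ.symm i, j⟩))).trans (hq _)
  rw [blockPerm_apply (fun j => p (blockIndex m hm ⟨σ.symm i, j⟩)) (hq _) (τ (σ.symm i))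
    (fun j => υ (blockIndex m hm ⟨σ.symm i, j⟩)) hqq j l]
  apply blockIndex_congr rfl _ _ rfl
  congr 1
  refine blockIndex_congr ?_ _ _ rfl _ _ rfl
  funext j
  exact congrArg p (hρ i j)

theorem blockIndex_one_val {n : ℕ} (h : ∑ _i : Fin 1, n = n) (i : Fin 1) (j : Fin n) :
    (blockIndex (fun _ : Fin 1 => n) h ⟨i, j⟩ : ℕ) = j := by
  rw [blockIndex_val]
  simp [Subsingleton.elim i 0]

theorem blockIndex_ones {n : ℕ} (h : ∑ _i : Fin n, 1 = n) (i : Fin n) (j : Fin 1) :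
    blockIndex (fun _ : Fin n => 1) h ⟨i, j⟩ = i := by
  ext
  rw [blockIndex_val]
  have hc : Finset.univ.filter (· < i) = Finset.Iio i := by
    ext
    simp
  simp [hc]

theorem blockPerm_one_left {n : ℕ} (h : ∑ _i : Fin 1, n = n) (a : Equiv.Perm (Fin n)) :
    blockPerm (fun _ : Fin 1 => n) h 1 (fun _ => a) = a := by
  have hid : ∀ i (x : Fin n), blockIndex (fun _ : Fin 1 => n) h ⟨i, x⟩ = x :=
    fun i x => Fin.ext (blockIndex_one_val h i x)
  refine Equiv.ext fun x => ?_
  have := blockPerm_apply (fun _ : Fin 1 => n) h 1 (fun _ => a) h 0 x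
  rwa [hid, hid] at this

theorem blockPerm_one_right {n : ℕ} (h : ∑ _i : Fin n, 1 = n) (a : Equiv.Perm (Fin n)) :
    blockPerm (fun _ : Fin n => 1) h a (fun _ => 1) = a := by
  refine Equiv.ext fun x => ?_
  obtain ⟨y, rfl⟩ := a.symm.surjective x
  have := blockPerm_apply (fun _ : Fin n => 1) h a (fun _ => 1) h y 0
  rwa [blockIndex_ones, blockIndex_ones, ← Equiv.apply_symm_apply a y,
    Equiv.symm_apply_apply] at this

/-- The operad underlying the operad of symmetric groups. The multiplication of `S n` is written
from the left to the right (`σ σ'` is `σ`, followed by `σ'`): it is the opposite of the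
multiplication of `Equiv.Perm (Fin n)`. -/
def symmOperad : OperadStr (fun n => (Equiv.Perm (Fin n))ᵐᵒᵖ) where
  zero_point := ⟨⟨⟨1⟩, fun _ => MulOpposite.unop_injective (Subsingleton.elim _ _)⟩⟩
  one := 1
  γ m h σ τ := MulOpposite.op (blockPerm m h σ.unop (fun i => (τ i).unop))
  one_γ h a := congrArg MulOpposite.op (blockPerm_one_left h a.unop)
  γ_one h a := congrArg MulOpposite.op (blockPerm_one_right h a.unop)
  assoc m hm p hp q hq hN a b c :=
    congrArg MulOpposite.op (blockPerm_assoc m hm p hp q hq hN a.unop (fun i => (b i).unop)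
      (fun x => (c x).unop))

/-- A group operad on a sequence of groups: an operad, with a morphism of operads `π` to the operad
of symmetric groups which consists of homomorphisms, such that the unit of the operad is the
identity of `G 1` and `γ` is a crossed homomorphism. -/
structure GroupOperad (G : ℕ → Type v) [∀ n, Group (G n)] extends OperadStr G where
  π : ∀ n, G n →* (Equiv.Perm (Fin n))ᵐᵒᵖ
  π_γ : ∀ {k n : ℕ} (m : Fin k → ℕ) (h : ∑ i, m i = n) (a : G k) (b : ∀ i, G (m i)),
    π n (γ m h a b) = symmOperad.γ m h (π k a) (fun i => π (m i) (b i))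
  one_eq : one = 1
  crossed : ∀ {k n : ℕ} (m : Fin k → ℕ) (h : ∑ i, m i = n) (a a' : G k) (b b' : ∀ i, G (m i))
    (h' : ∑ i, m ((π k a).unop.symm i) = n),
    γ m h (a * a') (fun i => b i * b' i) =
      γ m h a b * γ (fun i => m ((π k a).unop.symm i)) h' a' (fun i => b' ((π k a).unop.symm i))

namespace GroupOperad

variable {G : ℕ → Type v} [∀ n, Group (G n)]

/-- The permutation which underlies an element of a group operad. -/
def perm (P : GroupOperad G) {n : ℕ} (a : G n) : Equiv.Perm (Fin n) :=
  (P.π n a).unop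

theorem sum_perm (P : GroupOperad G) {k n : ℕ} {m : Fin k → ℕ} (h : ∑ i, m i = n) (a : G k) :
    ∑ i, m ((P.perm a).symm i) = n :=
  (Equiv.sum_comp (P.perm a).symm m).trans h

/-- A group operad is non-crossed if all `π` are trivial. -/
def NonCrossed (P : GroupOperad G) : Prop :=
  ∀ (n : ℕ) (a : G n), P.π n a = 1

end GroupOperad

/-- A morphism of group operads. -/
structure GroupOperadHom {G : ℕ → Type v} [∀ n, Group (G n)] (P : GroupOperad G)
    {G' : ℕ → Type w} [∀ n, Group (G' n)] (P' : GroupOperad G') where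
  toHom : ∀ n, G n →* G' n
  π_comp : ∀ (n : ℕ) (a : G n), P'.π n (toHom n a) = P.π n a
  map_γ : ∀ {k n : ℕ} (m : Fin k → ℕ) (h : ∑ i, m i = n) (a : G k) (b : ∀ i, G (m i)),
    toHom n (P.γ m h a b) = P'.γ m h (toHom k a) (fun i => toHom (m i) (b i))

/-- The equivariance property of a sequence of left actions of the groups of a group operad on the
sets of an operad; `P.perm σ` is the permutation underlying `σ`. -/
def IsOperadAction {G : ℕ → Type v} [∀ n, Group (G n)] (P : GroupOperad G) {C : ℕ → Type u}
    (O : OperadStr C) [act : ∀ n, MulAction (G n) (C n)] : Prop :=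
  ∀ {k n : ℕ} (m : Fin k → ℕ) (h : ∑ i, m i = n) (σ : G k) (τ : ∀ i, G (m i)) (a : C k)
    (b : ∀ i, C (m i)),
    O.γ m h (σ • a) (fun i => τ i • b i) =
      P.γ m h σ τ • O.γ (fun i => m ((P.perm σ).symm i)) (P.sum_perm h σ) a
        (fun i => b ((P.perm σ).symm i))

/-- A sub group operad: a sequence of subgroups which is closed under `γ`. -/
structure SubGroupOperad {G : ℕ → Type v} [∀ n, Group (G n)] (P : GroupOperad G) where
  carrier : ∀ n, Subgroup (G n)
  γ_mem : ∀ {k n : ℕ} (m : Fin k → ℕ) (h : ∑ i, m i = n) (a : G k) (b : ∀ i, G (m i)),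
    a ∈ carrier k → (∀ i, b i ∈ carrier (m i)) → P.γ m h a b ∈ carrier n

/-- A sub group operad is non-crossed if the restrictions of all `π` to it are trivial. -/
def SubGroupOperad.NonCrossed {G : ℕ → Type v} [∀ n, Group (G n)] {P : GroupOperad G}
    (H : SubGroupOperad P) : Prop :=
  ∀ (n : ℕ) (a : G n), a ∈ H.carrier n → P.π n a = 1

/-! ## The quotient of a group operad by a non-crossed normal sub group operad -/

section QuotientGroupOperad

variable {G : ℕ → Type v} [∀ n, Group (G n)] {P : GroupOperad G} (H : SubGroupOperad P)

/-- The composition of `G / H`, induced by the one of `G`. -/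
noncomputable def SubGroupOperad.quotientγ {k n : ℕ} (m : Fin k → ℕ) (h : ∑ i, m i = n)
    (a : G k ⧸ H.carrier k) (b : ∀ i, G (m i) ⧸ H.carrier (m i)) : G n ⧸ H.carrier n :=
  QuotientGroup.mk (P.γ m h a.out (fun i => (b i).out))

theorem SubGroupOperad.quotientγ_mk {k n : ℕ} (m : Fin k → ℕ) (h : ∑ i, m i = n)
    (a : G k) (b : ∀ i, G (m i)) :
    H.quotientγ m h (QuotientGroup.mk a) (fun i => QuotientGroup.mk (b i)) =
      QuotientGroup.mk (P.γ m h a b) := by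
  obtain ⟨x, hx⟩ := QuotientGroup.mk_out_eq_mul (H.carrier k) a
  choose y hy using fun i => QuotientGroup.mk_out_eq_mul (H.carrier (m i)) (b i)
  rw [SubGroupOperad.quotientγ, hx]
  simp only [hy]
  rw [P.crossed m h a x b (fun i => y i) (P.sum_perm h a)]
  exact QuotientGroup.mk_mul_of_mem _ (H.γ_mem _ _ _ _ x.2 (fun i => (y _).2))

theorem SubGroupOperad.exists_rep {k : ℕ} (m : Fin k → ℕ) (b : ∀ i, G (m i) ⧸ H.carrier (m i)) :
    ∃ b' : ∀ i, G (m i), b = fun i => QuotientGroup.mk (b' i) :=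
  ⟨fun i => (b i).out, funext fun i => (QuotientGroup.out_eq' (b i)).symm⟩

/-- The quotient group operad `G / H`. -/
noncomputable def SubGroupOperad.quotient [∀ n, (H.carrier n).Normal] (hH : H.NonCrossed) :
    GroupOperad (fun n => G n ⧸ H.carrier n) where
  zero_point := by
    obtain ⟨hu⟩ := P.zero_point
    exact ⟨⟨⟨1⟩, fun x => by
      obtain ⟨x, rfl⟩ := QuotientGroup.mk_surjective x
      rw [Subsingleton.elim x 1]; rfl⟩⟩
  one := 1
  γ := H.quotientγ
  one_γ h a := by
    obtain ⟨a, rfl⟩ := QuotientGroup.mk_surjective a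
    rw [← QuotientGroup.mk_one, H.quotientγ_mk, ← P.one_eq, P.one_γ]
  γ_one h a := by
    obtain ⟨a, rfl⟩ := QuotientGroup.mk_surjective a
    rw [← QuotientGroup.mk_one]
    exact (H.quotientγ_mk _ h a (fun _ => 1)).trans (by rw [← P.one_eq, P.γ_one])
  assoc m hm p hp q hq hN a b c := by
    obtain ⟨a, rfl⟩ := QuotientGroup.mk_surjective a
    obtain ⟨b, rfl⟩ := H.exists_rep _ b
    obtain ⟨c, rfl⟩ := H.exists_rep _ c
    simp only [H.quotientγ_mk]
    rw [P.assoc m hm p hp q hq hN]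
  π n := QuotientGroup.lift (H.carrier n) (P.π n) (hH n)
  π_γ m h a b := by
    obtain ⟨a, rfl⟩ := QuotientGroup.mk_surjective a
    obtain ⟨b, rfl⟩ := H.exists_rep _ b
    rw [H.quotientγ_mk]
    exact P.π_γ m h a b
  one_eq := rfl
  crossed m h a a' b b' h' := by
    obtain ⟨a, rfl⟩ := QuotientGroup.mk_surjective a
    obtain ⟨a', rfl⟩ := QuotientGroup.mk_surjective a'
    obtain ⟨b, rfl⟩ := H.exists_rep _ b
    obtain ⟨b', rfl⟩ := H.exists_rep _ b'
    have e₁ := H.quotientγ_mk m h (a * a') (fun i => b i * b' i)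
    have e₂ := H.quotientγ_mk m h a b
    have e₃ := H.quotientγ_mk _ (P.sum_perm h a) a' (fun i => b' ((P.perm a).symm i))
    have e₄ := congrArg (QuotientGroup.mk (s := H.carrier _))
      (P.crossed m h a a' b b' (P.sum_perm h a))
    refine e₁.trans (e₄.trans ?_)
    rw [QuotientGroup.mk_mul]
    exact congrArg₂ (· * ·) e₂.symm e₃.symm

end QuotientGroupOperad

/-! ## Topological operads and their quotients -/

/-- A topological operad on a sequence of spaces: an operad with continuous `γ`. -/
structure TopOperadStr (C : ℕ → Type u) [∀ n, TopologicalSpace (C n)] extends OperadStr C where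
  continuous_γ : ∀ {k n : ℕ} (m : Fin k → ℕ) (h : ∑ i, m i = n),
    Continuous fun x : C k × (∀ i, C (m i)) => γ m h x.1 x.2

/-- A morphism of nonsymmetric topological operads. -/
structure TopOperadHom {C : ℕ → Type u} [∀ n, TopologicalSpace (C n)] (O : TopOperadStr C)
    {C' : ℕ → Type w} [∀ n, TopologicalSpace (C' n)] (O' : TopOperadStr C') where
  toMap : ∀ n, C(C n, C' n)
  map_one : toMap 1 O.one = O'.one
  map_γ : ∀ {k n : ℕ} (m : Fin k → ℕ) (h : ∑ i, m i = n) (a : C k) (b : ∀ i, C (m i)),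
    toMap n (O.γ m h a b) = O'.γ m h (toMap k a) (fun i => toMap (m i) (b i))

/-- A covering action: every point has a neighbourhood which is disjoint from all its
translates by elements other than the identity. -/
def IsCoveringAction (G : Type v) [Group G] (X : Type u) [TopologicalSpace X] [MulAction G X] :
    Prop :=
  ∀ x : X, ∃ U ∈ nhds x, ∀ g : G, ((fun y => g • y) '' U ∩ U).Nonempty → g = 1

/-- The orbit space of a left action, with the quotient topology. -/
abbrev OrbitSpace (G : Type v) [Group G] (X : Type u) [MulAction G X] : Type u :=
  MulAction.orbitRel.Quotient G X

section OrbitSpace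

variable {G : Type v} [Group G] {X : Type u} [MulAction G X]

/-- The orbit of a point, as a point of the orbit space. -/
def OrbitSpace.mk (G : Type v) [Group G] {X : Type u} [MulAction G X] (x : X) : OrbitSpace G X :=
  Quotient.mk (MulAction.orbitRel G X) x

theorem OrbitSpace.mk_surjective : Function.Surjective (OrbitSpace.mk G (X := X)) :=
  Quotient.mk_surjective

theorem OrbitSpace.mk_eq_mk {x y : X} :
    OrbitSpace.mk G x = OrbitSpace.mk G y ↔ ∃ g : G, g • y = x :=
  Quotient.eq.trans MulAction.orbitRel_apply

theorem OrbitSpace.continuous_mk [TopologicalSpace X] : Continuous (OrbitSpace.mk G (X := X)) :=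
  continuous_quot_mk

theorem OrbitSpace.isOpenQuotientMap_mk [TopologicalSpace X] [ContinuousConstSMul G X] :
    IsOpenQuotientMap (OrbitSpace.mk G (X := X)) :=
  MulAction.isOpenQuotientMap_quotientMk

/-- The action of `G / N` on `N \ X` for a normal subgroup `N`: `g N` maps the orbit of `x` to
the orbit of `g x`. -/
instance OrbitSpace.quotientAction (N : Subgroup G) [hN : N.Normal] :
    MulAction (G ⧸ N) (OrbitSpace N X) where
  smul := Quotient.map₂ (fun g x => g • x) (by
    intro a b hab x y hxy
    obtain ⟨⟨n, hn⟩, rfl⟩ := hxy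
    have h1 : a⁻¹ * b ∈ N := QuotientGroup.leftRel_apply.1 hab
    refine ⟨⟨a * n * b⁻¹, ?_⟩, ?_⟩
    · have h2 := hN.conj_mem _ (N.mul_mem hn (N.inv_mem h1)) a
      have h3 : a * (n * (a⁻¹ * b)⁻¹) * a⁻¹ = a * n * b⁻¹ := by group
      rwa [h3] at h2
    · change (a * n * b⁻¹) • b • y = a • n • y
      simp [smul_smul])
  one_smul x := by
    obtain ⟨x, rfl⟩ := OrbitSpace.mk_surjective x
    exact congrArg (OrbitSpace.mk N) (one_smul G x)
  mul_smul a b x := by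
    obtain ⟨a, rfl⟩ := QuotientGroup.mk_surjective a
    obtain ⟨b, rfl⟩ := QuotientGroup.mk_surjective b
    obtain ⟨x, rfl⟩ := OrbitSpace.mk_surjective x
    exact congrArg (OrbitSpace.mk N) (mul_smul a b x)

theorem OrbitSpace.mk_smul_mk (N : Subgroup G) [N.Normal] (g : G) (x : X) :
    (QuotientGroup.mk g : G ⧸ N) • OrbitSpace.mk N x = OrbitSpace.mk N (g • x) :=
  rfl

instance OrbitSpace.continuousConstSMul (N : Subgroup G) [N.Normal] [TopologicalSpace X]
    [ContinuousConstSMul G X] : ContinuousConstSMul (G ⧸ N) (OrbitSpace N X) where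
  continuous_const_smul a := by
    obtain ⟨a, rfl⟩ := QuotientGroup.mk_surjective a
    exact Continuous.quotient_lift (OrbitSpace.continuous_mk.comp (continuous_const_smul a)) _

/-- The projection from `N \ X` to `G \ X` for a subgroup `N` of `G`. -/
def OrbitSpace.proj (N : Subgroup G) [TopologicalSpace X] : C(OrbitSpace N X, OrbitSpace G X) where
  toFun := Quotient.map id (by
    rintro x y ⟨n, rfl⟩
    exact ⟨n, rfl⟩)
  continuous_toFun := Continuous.quotient_lift OrbitSpace.continuous_mk _

theorem OrbitSpace.proj_smul (N : Subgroup G) [N.Normal] [TopologicalSpace X] (g : G ⧸ N)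
    (x : OrbitSpace N X) : OrbitSpace.proj N (g • x) = OrbitSpace.proj N x := by
  obtain ⟨g, rfl⟩ := QuotientGroup.mk_surjective g
  obtain ⟨x, rfl⟩ := OrbitSpace.mk_surjective x
  exact OrbitSpace.mk_eq_mk.2 ⟨g, rfl⟩

/-- The canonical map from the iterated orbit space `(G / N) \ (N \ X)` to `G \ X`. -/
def OrbitSpace.iterated (N : Subgroup G) [N.Normal] [TopologicalSpace X] :
    C(OrbitSpace (G ⧸ N) (OrbitSpace N X), OrbitSpace G X) where
  toFun := Quotient.lift (OrbitSpace.proj N) (by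
    rintro x y ⟨g, rfl⟩
    exact OrbitSpace.proj_smul N g y)
  continuous_toFun := Continuous.quotient_lift (OrbitSpace.proj N).continuous _

theorem OrbitSpace.exists_rep {ι : Type*} {K : ι → Type v} [∀ i, Group (K i)] {Y : ι → Type u}
    [∀ i, MulAction (K i) (Y i)] (b : ∀ i, OrbitSpace (K i) (Y i)) :
    ∃ b' : ∀ i, Y i, b = fun i => OrbitSpace.mk _ (b' i) :=
  ⟨fun i => (b i).out, funext fun i => (Quotient.out_eq (b i)).symm⟩

end OrbitSpace

section QuotientOperad

variable {G : ℕ → Type v} [∀ n, Group (G n)] {P : GroupOperad G} (H : SubGroupOperad P)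
  {C : ℕ → Type u} [∀ n, TopologicalSpace (C n)] (O : TopOperadStr C)
  [∀ n, MulAction (G n) (C n)]

/-- The composition of `C / H`, induced by the one of `C`. -/
noncomputable def TopOperadStr.orbitγ {k n : ℕ} (m : Fin k → ℕ) (h : ∑ i, m i = n)
    (a : OrbitSpace (H.carrier k) (C k)) (b : ∀ i, OrbitSpace (H.carrier (m i)) (C (m i))) :
    OrbitSpace (H.carrier n) (C n) :=
  OrbitSpace.mk _ (O.γ m h a.out (fun i => (b i).out))

variable {O}

theorem IsOperadAction.γ_smul (hact : IsOperadAction P O.toOperadStr) {k n : ℕ} (m : Fin k → ℕ)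
    (h : ∑ i, m i = n) (σ : G k) (hσ : P.π k σ = 1) (τ : ∀ i, G (m i)) (a : C k)
    (b : ∀ i, C (m i)) :
    O.γ m h (σ • a) (fun i => τ i • b i) = P.γ m h σ τ • O.γ m h a b := by
  rw [hact m h σ τ a b]
  have hp : P.perm σ = 1 := congrArg MulOpposite.unop hσ
  congr 1
  have key : ∀ (s : Equiv.Perm (Fin k)) (hs : ∑ i, m (s.symm i) = n), s = 1 →
      O.γ (fun i => m (s.symm i)) hs a (fun i => b (s.symm i)) = O.γ m h a b := by
    rintro s hs rfl
    rfl
  exact key _ _ hp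

theorem TopOperadStr.orbitγ_mk (hH : H.NonCrossed) (hact : IsOperadAction P O.toOperadStr)
    {k n : ℕ} (m : Fin k → ℕ) (h : ∑ i, m i = n) (a : C k) (b : ∀ i, C (m i)) :
    O.orbitγ H m h (OrbitSpace.mk _ a) (fun i => OrbitSpace.mk _ (b i)) =
      OrbitSpace.mk _ (O.γ m h a b) := by
  obtain ⟨x, hx⟩ := OrbitSpace.mk_eq_mk.1
    (Quotient.out_eq (OrbitSpace.mk (H.carrier k) a) : OrbitSpace.mk _ _ = _)
  choose y hy using fun i => OrbitSpace.mk_eq_mk.1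
    (Quotient.out_eq (OrbitSpace.mk (H.carrier (m i)) (b i)) : OrbitSpace.mk _ _ = _)
  rw [TopOperadStr.orbitγ, ← hx]
  simp only [← hy]
  refine OrbitSpace.mk_eq_mk.2 ⟨⟨P.γ m h x (fun i => y i), H.γ_mem _ _ _ _ x.2 fun i => (y i).2⟩, ?_⟩
  exact (hact.γ_smul m h x (hH _ _ x.2) (fun i => y i) a b).symm

variable [∀ n, ContinuousConstSMul (G n) (C n)]

/-- The quotient operad `C / H` of a topological `G`-operad by a non-crossed sub group operad. -/
noncomputable def SubGroupOperad.quotientOperad (hH : H.NonCrossed)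
    (hact : IsOperadAction P O.toOperadStr) :
    TopOperadStr (fun n => OrbitSpace (H.carrier n) (C n)) where
  zero_point := by
    obtain ⟨hu⟩ := O.zero_point
    exact ⟨⟨⟨OrbitSpace.mk _ hu.default⟩, fun x => by
      obtain ⟨x, rfl⟩ := OrbitSpace.mk_surjective x
      exact congrArg (OrbitSpace.mk _) (Subsingleton.elim x hu.default)⟩⟩
  one := OrbitSpace.mk _ O.one
  γ := O.orbitγ H
  one_γ h a := by
    obtain ⟨a, rfl⟩ := OrbitSpace.mk_surjective a
    rw [TopOperadStr.orbitγ_mk H hH hact, O.one_γ]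
  γ_one h a := by
    obtain ⟨a, rfl⟩ := OrbitSpace.mk_surjective a
    exact (TopOperadStr.orbitγ_mk H hH hact _ h a (fun _ => O.one)).trans (by rw [O.γ_one])
  assoc m hm p hp q hq hN a b c := by
    obtain ⟨a, rfl⟩ := OrbitSpace.mk_surjective a
    obtain ⟨b, rfl⟩ := OrbitSpace.exists_rep b
    obtain ⟨c, rfl⟩ := OrbitSpace.exists_rep c
    simp only [TopOperadStr.orbitγ_mk H hH hact]
    rw [O.assoc m hm p hp q hq hN]
  continuous_γ {k n} m h := by
    have hc : ∀ n, ContinuousConstSMul (H.carrier n) (C n) :=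
      fun n => ⟨fun g => continuous_const_smul (g : G n)⟩
    have hq : IsOpenQuotientMap (Prod.map (OrbitSpace.mk (H.carrier k) (X := C k))
        (Pi.map fun i => OrbitSpace.mk (H.carrier (m i)) (X := C (m i)))) :=
      OrbitSpace.isOpenQuotientMap_mk.prodMap
        (IsOpenQuotientMap.piMap fun i => OrbitSpace.isOpenQuotientMap_mk)
    rw [hq.isQuotientMap.continuous_iff]
    refine (OrbitSpace.continuous_mk.comp (O.continuous_γ m h)).congr fun x => ?_
    exact (TopOperadStr.orbitγ_mk H hH hact m h x.1 x.2).symm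

end QuotientOperad

/-! ## The operad of little intervals -/

/-- A point of the `k`-th space of the operad of little intervals (little 1-cubes): `k` closed
subintervals `[c.1.1 i, c.1.2 i]` of `[0, 1]` with disjoint interiors, topologized by their
endpoints. The `i`-th little interval is regarded as the increasing affine map from `[0, 1]`
onto `[c.1.1 i, c.1.2 i]`. -/
def LittleIntervals (k : ℕ) : Type :=
  {c : (Fin k → ℝ) × (Fin k → ℝ) // (∀ i, 0 ≤ c.1 i ∧ c.1 i < c.2 i ∧ c.2 i ≤ 1) ∧
    ∀ i j, i ≠ j → Disjoint (Set.Ioo (c.1 i) (c.2 i)) (Set.Ioo (c.1 j) (c.2 j))}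

namespace LittleIntervals

instance (k : ℕ) : TopologicalSpace (LittleIntervals k) :=
  inferInstanceAs (TopologicalSpace {_c : (Fin k → ℝ) × (Fin k → ℝ) // _})

/-- The left endpoints. -/
def lo {k : ℕ} (c : LittleIntervals k) (i : Fin k) : ℝ := c.1.1 i

/-- The right endpoints. -/
def hi {k : ℕ} (c : LittleIntervals k) (i : Fin k) : ℝ := c.1.2 i

theorem continuous_lo {k : ℕ} (i : Fin k) : Continuous fun c : LittleIntervals k => c.lo i :=
  (continuous_apply i).comp (continuous_fst.comp continuous_subtype_val)

theorem continuous_hi {k : ℕ} (i : Fin k) : Continuous fun c : LittleIntervals k => c.hi i :=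
  (continuous_apply i).comp (continuous_snd.comp continuous_subtype_val)

theorem zero_le_lo {k : ℕ} (c : LittleIntervals k) (i : Fin k) : 0 ≤ c.lo i := (c.2.1 i).1

theorem lo_lt_hi {k : ℕ} (c : LittleIntervals k) (i : Fin k) : c.lo i < c.hi i := (c.2.1 i).2.1

theorem hi_le_one {k : ℕ} (c : LittleIntervals k) (i : Fin k) : c.hi i ≤ 1 := (c.2.1 i).2.2

theorem ext_lo_hi {k : ℕ} {c d : LittleIntervals k} (h : ∀ i, c.lo i = d.lo i)
    (h' : ∀ i, c.hi i = d.hi i) : c = d :=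
  Subtype.ext (Prod.ext (funext h) (funext h'))

theorem hi_le_or {k : ℕ} (c : LittleIntervals k) {i j : Fin k} (hij : i ≠ j) :
    c.hi i ≤ c.lo j ∨ c.hi j ≤ c.lo i := by
  have h := Set.Ioo_disjoint_Ioo.1 (c.2.2 i j hij)
  have h1 := c.lo_lt_hi i
  have h2 := c.lo_lt_hi j
  simp only [lo, hi] at *
  rcases min_le_iff.1 h with h | h <;> rcases le_max_iff.1 h with h | h
  · linarith
  · exact Or.inl h
  · exact Or.inr h
  · linarith

/-- The intervals are numbered from the left to the right. -/
def Ordered {k : ℕ} (c : LittleIntervals k) : Prop :=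
  ∀ i j, i < j → c.hi i ≤ c.lo j

/-- The configuration with given endpoints, numbered from the left to the right. -/
def ofOrdered {k : ℕ} (a b : Fin k → ℝ) (h : ∀ i, 0 ≤ a i ∧ a i < b i ∧ b i ≤ 1)
    (hab : ∀ i j, i < j → b i ≤ a j) : LittleIntervals k :=
  ⟨(a, b), h, fun i j hij => Set.Ioo_disjoint_Ioo.2 (by
    rcases lt_or_gt_of_ne hij with hlt | hlt
    · exact (min_le_left _ _).trans ((hab i j hlt).trans (le_max_right _ _))
    · exact (min_le_right _ _).trans ((hab j i hlt).trans (le_max_left _ _)))⟩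

/-- The standard configuration `([0, 1/k], [1/k, 2/k], …, [(k-1)/k, 1])`. -/
noncomputable def std (k : ℕ) : LittleIntervals k :=
  ofOrdered (fun i => (i : ℝ) / k) (fun i => ((i : ℝ) + 1) / k)
    (fun i => by
      have hk : (0 : ℝ) < k := by exact_mod_cast i.pos
      have hi : (i : ℝ) + 1 ≤ k := by exact_mod_cast i.2
      refine ⟨by positivity, by gcongr; linarith, ?_⟩
      rw [div_le_one hk]
      exact hi)
    (fun i j hij => by
      have hk : (0 : ℝ) < k := by exact_mod_cast i.pos
      have hi : (i : ℝ) + 1 ≤ j := by exact_mod_cast hij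
      gcongr)

theorem std_ordered (k : ℕ) : (std k).Ordered := by
  intro i j hij
  have hi : (i : ℝ) + 1 ≤ j := by exact_mod_cast hij
  change ((i : ℝ) + 1) / k ≤ (j : ℝ) / k
  gcongr

/-- The configuration `(1 - t) c + t c'`. -/
noncomputable def combination {k : ℕ} (c c' : LittleIntervals k) (hc : c.Ordered)
    (hc' : c'.Ordered) (t : unitInterval) : LittleIntervals k :=
  ofOrdered (fun i => (1 - (t : ℝ)) * c.lo i + t * c'.lo i)
    (fun i => (1 - (t : ℝ)) * c.hi i + t * c'.hi i)
    (fun i => by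
      have h0 := t.2.1
      have h1 := t.2.2
      have a := c.zero_le_lo i
      have a' := c'.zero_le_lo i
      have b := c.lo_lt_hi i
      have b' := c'.lo_lt_hi i
      have d := c.hi_le_one i
      have d' := c'.hi_le_one i
      refine ⟨by nlinarith, ?_, by nlinarith⟩
      rcases eq_or_lt_of_le h0 with h | h
      · rw [← h]
        simpa using b
      · nlinarith)
    (fun i j hij => by
      have h0 := t.2.1
      have h1 := t.2.2
      have a := hc i j hij
      have a' := hc' i j hij
      nlinarith)

/-- The linear path from `c` to `c'`. -/
noncomputable def linear {k : ℕ} (c c' : LittleIntervals k) (hc : c.Ordered) (hc' : c'.Ordered) :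
    Path c c' where
  toFun t := combination c c' hc hc' t
  continuous_toFun := by
    refine Continuous.subtype_mk (Continuous.prodMk ?_ ?_) _ <;>
      exact continuous_pi fun i => by fun_prop
  source' := ext_lo_hi (fun i => by simp [combination, ofOrdered, lo])
    (fun i => by simp [combination, ofOrdered, hi])
  target' := ext_lo_hi (fun i => by simp [combination, ofOrdered, lo])
    (fun i => by simp [combination, ofOrdered, hi])

theorem mem_pathComponent_iff {k : ℕ} (c : LittleIntervals k) :
    c ∈ pathComponent (std k) ↔ c.Ordered := by
  constructor
  · rintro ⟨f⟩ i j hij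
    by_contra hlt
    have hne : ∀ t, (f t).lo i ≠ (f t).lo j := by
      intro t ht
      have h1 := (f t).lo_lt_hi i
      have h2 := (f t).lo_lt_hi j
      rcases (f t).hi_le_or hij.ne with h | h <;> linarith
    have hcont : Continuous fun t => (f t).lo j - (f t).lo i :=
      ((continuous_lo j).comp f.continuous).sub ((continuous_lo i).comp f.continuous)
    have h0 : 0 < (f 0).lo j - (f 0).lo i := by
      have h1 := (std k).lo_lt_hi i
      have h2 := std_ordered k i j hij
      rw [f.source]
      linarith
    have h1 : (f 1).lo j - (f 1).lo i < 0 := by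
      rw [f.target]
      have h2 := (c.hi_le_or hij.ne).resolve_left hlt
      have h3 := c.lo_lt_hi j
      linarith
    obtain ⟨t, ht⟩ := intermediate_value_univ 1 0 hcont ⟨h1.le, h0.le⟩
    exact hne t (by simp only at ht; linarith)
  · intro hc
    exact ⟨linear _ _ (std_ordered k) hc⟩

/-- The composition of little intervals. -/
noncomputable def comp {k n : ℕ} (m : Fin k → ℕ) (h : ∑ i, m i = n) (c : LittleIntervals k)
    (d : ∀ i, LittleIntervals (m i)) : LittleIntervals n :=
  ⟨(fun x => c.lo ((blockIndex m h).symm x).1 +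
      (c.hi ((blockIndex m h).symm x).1 - c.lo ((blockIndex m h).symm x).1) *
        (d ((blockIndex m h).symm x).1).lo ((blockIndex m h).symm x).2,
    fun x => c.lo ((blockIndex m h).symm x).1 +
      (c.hi ((blockIndex m h).symm x).1 - c.lo ((blockIndex m h).symm x).1) *
        (d ((blockIndex m h).symm x).1).hi ((blockIndex m h).symm x).2), by
  constructor
  · intro x
    dsimp only
    generalize (blockIndex m h).symm x = y
    obtain ⟨i, j⟩ := y
    have a := c.zero_le_lo i
    have b := c.lo_lt_hi i
    have e := c.hi_le_one i
    have a' := (d i).zero_le_lo j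
    have b' := (d i).lo_lt_hi j
    have e' := (d i).hi_le_one j
    dsimp only
    refine ⟨by nlinarith, by nlinarith, by nlinarith⟩
  · intro x y hxy
    have hxy' : (blockIndex m h).symm x ≠ (blockIndex m h).symm y :=
      fun h' => hxy ((blockIndex m h).symm.injective h')
    revert hxy'
    dsimp only
    generalize (blockIndex m h).symm x = x'
    generalize (blockIndex m h).symm y = y'
    obtain ⟨i, j⟩ := x'
    obtain ⟨i', j'⟩ := y'
    intro hne
    dsimp only
    have b := c.lo_lt_hi i
    by_cases hi : i = i'
    · subst hi
      have hj : j ≠ j' := fun hj => hne (by rw [hj])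
      rw [Set.Ioo_disjoint_Ioo]
      rcases (d i).hi_le_or hj with hd | hd
      · exact (min_le_left _ _).trans (le_trans (by gcongr) (le_max_right _ _))
      · exact (min_le_right _ _).trans (le_trans (by gcongr) (le_max_left _ _))
    · have b' := c.lo_lt_hi i'
      have s : ∀ (u : Fin k) (v : Fin (m u)),
          Set.Ioo (c.lo u + (c.hi u - c.lo u) * (d u).lo v)
            (c.lo u + (c.hi u - c.lo u) * (d u).hi v) ⊆ Set.Ioo (c.lo u) (c.hi u) := by
        intro u v
        have a := (d u).zero_le_lo v
        have e := (d u).hi_le_one v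
        have f := c.lo_lt_hi u
        exact Set.Ioo_subset_Ioo (by nlinarith) (by nlinarith)
      exact (c.2.2 i i' hi).mono (s i j) (s i' j')⟩

theorem comp_lo {k n : ℕ} (m : Fin k → ℕ) (h : ∑ i, m i = n) (c : LittleIntervals k)
    (d : ∀ i, LittleIntervals (m i)) (i : Fin k) (j : Fin (m i)) :
    (comp m h c d).lo (blockIndex m h ⟨i, j⟩) = c.lo i + (c.hi i - c.lo i) * (d i).lo j := by
  simp only [comp, lo]
  rw [Equiv.symm_apply_apply]

theorem comp_hi {k n : ℕ} (m : Fin k → ℕ) (h : ∑ i, m i = n) (c : LittleIntervals k)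
    (d : ∀ i, LittleIntervals (m i)) (i : Fin k) (j : Fin (m i)) :
    (comp m h c d).hi (blockIndex m h ⟨i, j⟩) = c.lo i + (c.hi i - c.lo i) * (d i).hi j := by
  simp only [comp, hi]
  rw [Equiv.symm_apply_apply]

theorem comp_ordered {k n : ℕ} (m : Fin k → ℕ) (h : ∑ i, m i = n) {c : LittleIntervals k}
    {d : ∀ i, LittleIntervals (m i)} (hc : c.Ordered) (hd : ∀ i, (d i).Ordered) :
    (comp m h c d).Ordered := by
  intro x y hxy
  obtain ⟨⟨i, j⟩, rfl⟩ := (blockIndex m h).surjective x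
  obtain ⟨⟨i', j'⟩, rfl⟩ := (blockIndex m h).surjective y
  rw [comp_lo, comp_hi]
  have b := c.lo_lt_hi i
  have b' := c.lo_lt_hi i'
  have e := (d i).hi_le_one j
  have a := (d i').zero_le_lo j'
  rcases lt_trichotomy i i' with hi | rfl | hi
  · have := hc i i' hi
    nlinarith
  · have hj : j < j' := by
      by_contra hj
      rcases eq_or_lt_of_le (not_lt.1 hj) with hj | hj
      · subst hj
        exact lt_irrefl _ hxy
      · exact hxy.asymm (blockIndex_lt _ _ _ _ _ _ (Or.inr ⟨rfl, hj⟩))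
    have := hd i j j' hj
    gcongr
  · exact absurd (blockIndex_lt m h _ _ j' j (Or.inl hi)) hxy.asymm

theorem continuous_comp {k n : ℕ} (m : Fin k → ℕ) (h : ∑ i, m i = n) :
    Continuous fun x : LittleIntervals k × (∀ i, LittleIntervals (m i)) => comp m h x.1 x.2 := by
  have hl : ∀ i : Fin k, Continuous fun x : LittleIntervals k × (∀ i, LittleIntervals (m i)) =>
      x.1.lo i := fun i => (continuous_lo i).comp continuous_fst
  have hh : ∀ i : Fin k, Continuous fun x : LittleIntervals k × (∀ i, LittleIntervals (m i)) =>
      x.1.hi i := fun i => (continuous_hi i).comp continuous_fst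
  have hl' : ∀ (i : Fin k) (j : Fin (m i)),
      Continuous fun x : LittleIntervals k × (∀ i, LittleIntervals (m i)) => (x.2 i).lo j :=
    fun i j => (continuous_lo j).comp ((continuous_apply i).comp continuous_snd)
  have hh' : ∀ (i : Fin k) (j : Fin (m i)),
      Continuous fun x : LittleIntervals k × (∀ i, LittleIntervals (m i)) => (x.2 i).hi j :=
    fun i j => (continuous_hi j).comp ((continuous_apply i).comp continuous_snd)
  refine Continuous.subtype_mk (Continuous.prodMk ?_ ?_) _
  · exact continuous_pi fun x => (hl _).add (((hh _).sub (hl _)).mul (hl' _ _))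
  · exact continuous_pi fun x => (hl _).add (((hh _).sub (hl _)).mul (hh' _ _))

end LittleIntervals

/-- The path component of the standard configuration in the space of `k` little intervals. -/
def IntervalComponent (k : ℕ) : Type :=
  {c : LittleIntervals k // c ∈ pathComponent (LittleIntervals.std k)}

namespace IntervalComponent

open LittleIntervals

instance (k : ℕ) : TopologicalSpace (IntervalComponent k) :=
  inferInstanceAs (TopologicalSpace {_c : LittleIntervals k // _})

theorem ordered {k : ℕ} (c : IntervalComponent k) : c.1.Ordered :=
  (mem_pathComponent_iff c.1).1 c.2

/-- The standard configuration. -/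
noncomputable def std (k : ℕ) : IntervalComponent k :=
  ⟨LittleIntervals.std k, mem_pathComponent_self _⟩

/-- The linear path `t ↦ (1 - t) c + t c'`. -/
noncomputable def linear {k : ℕ} (c c' : IntervalComponent k) : Path c c' where
  toFun t := ⟨combination c.1 c'.1 c.ordered c'.ordered t,
    (mem_pathComponent_iff _).2 (fun i j hij => by
      have h0 := t.2.1
      have h1 := t.2.2
      have a := c.ordered i j hij
      have a' := c'.ordered i j hij
      change (1 - (t : ℝ)) * c.1.hi i + t * c'.1.hi i ≤ (1 - (t : ℝ)) * c.1.lo j + t * c'.1.lo j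
      nlinarith)⟩
  continuous_toFun :=
    Continuous.subtype_mk (LittleIntervals.linear c.1 c'.1 c.ordered c'.ordered).continuous _
  source' := Subtype.ext (LittleIntervals.linear c.1 c'.1 c.ordered c'.ordered).source
  target' := Subtype.ext (LittleIntervals.linear c.1 c'.1 c.ordered c'.ordered).target

/-- The nonsymmetric operad formed by the path components of the standard configurations in the
operad of little intervals. -/
noncomputable def operad : TopOperadStr IntervalComponent where
  zero_point := ⟨⟨⟨std 0⟩, fun _ => Subtype.ext (ext_lo_hi (fun i => i.elim0) fun i => i.elim0)⟩⟩
  one := std 1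
  γ m h c d := ⟨comp m h c.1 (fun i => (d i).1),
    (mem_pathComponent_iff _).2 (comp_ordered m h c.ordered fun i => (d i).ordered)⟩
  one_γ {n} h a := by
    have hid : ∀ x : Fin n, x = blockIndex (fun _ : Fin 1 => n) h ⟨0, x⟩ :=
      fun x => Fin.ext (blockIndex_one_val h 0 x).symm
    have h0 : (std 1).1.lo 0 = 0 := by simp [std, LittleIntervals.std, ofOrdered, lo]
    have h1 : (std 1).1.hi 0 = 1 := by simp [std, LittleIntervals.std, ofOrdered, hi]
    refine Subtype.ext (ext_lo_hi (fun x => ?_) fun x => ?_)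
    · conv_lhs => rw [hid x]
      exact (comp_lo _ _ _ _ _ _).trans (by rw [h0, h1]; ring)
    · conv_lhs => rw [hid x]
      exact (comp_hi _ _ _ _ _ _).trans (by rw [h0, h1]; ring)
  γ_one {n} h a := by
    have h0 : (std 1).1.lo 0 = 0 := by simp [std, LittleIntervals.std, ofOrdered, lo]
    have h1 : (std 1).1.hi 0 = 1 := by simp [std, LittleIntervals.std, ofOrdered, hi]
    refine Subtype.ext (ext_lo_hi (fun x => ?_) fun x => ?_)
    · conv_lhs => rw [← blockIndex_ones h x 0]
      exact (comp_lo _ _ _ _ _ _).trans (by rw [h0]; ring)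
    · conv_lhs => rw [← blockIndex_ones h x 0]
      exact (comp_hi _ _ _ _ _ _).trans (by rw [h1]; ring)
  assoc m hm p hp q hq hN a b c := by
    refine Subtype.ext (ext_lo_hi (fun x => ?_) fun x => ?_)
    · obtain ⟨⟨y, l⟩, rfl⟩ := (blockIndex p hp).surjective x
      obtain ⟨⟨i, j⟩, rfl⟩ := (blockIndex m hm).surjective y
      refine (comp_lo _ _ _ _ _ _).trans ?_
      rw [comp_lo, comp_hi, blockIndex_assoc m hm p hp q hq hN]
      refine Eq.trans ?_ (comp_lo _ _ _ _ _ _).symm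
      rw [comp_lo]
      ring
    · obtain ⟨⟨y, l⟩, rfl⟩ := (blockIndex p hp).surjective x
      obtain ⟨⟨i, j⟩, rfl⟩ := (blockIndex m hm).surjective y
      refine (comp_hi _ _ _ _ _ _).trans ?_
      rw [comp_lo, comp_hi, blockIndex_assoc m hm p hp q hq hN]
      refine Eq.trans ?_ (comp_hi _ _ _ _ _ _).symm
      rw [comp_hi]
      ring
  continuous_γ {k n} m h := by
    have h₁ : Continuous fun x : IntervalComponent k × (∀ i, IntervalComponent (m i)) => x.1.1 :=
      continuous_subtype_val.comp continuous_fst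
    have h₂ : ∀ i, Continuous fun x : IntervalComponent k × (∀ i, IntervalComponent (m i)) =>
        (x.2 i).1 :=
      fun i => continuous_subtype_val.comp ((continuous_apply i).comp continuous_snd)
    exact Continuous.subtype_mk ((continuous_comp m h).comp (h₁.prodMk (continuous_pi h₂))) _

end IntervalComponent

section QuotientAction

variable {G : ℕ → Type v} [∀ n, Group (G n)] {P : GroupOperad G} (H : SubGroupOperad P)
  [∀ n, (H.carrier n).Normal] {C : ℕ → Type u} [∀ n, TopologicalSpace (C n)] {O : TopOperadStr C}
  [∀ n, MulAction (G n) (C n)] [∀ n, ContinuousConstSMul (G n) (C n)]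

/-- `C / H` is a topological `G / H`-operad. -/
theorem SubGroupOperad.isOperadAction_quotient (hH : H.NonCrossed)
    (hact : IsOperadAction P O.toOperadStr) :
    IsOperadAction (H.quotient hH) (H.quotientOperad hH hact).toOperadStr := by
  intro k n m h σ τ a b
  obtain ⟨σ, rfl⟩ := QuotientGroup.mk_surjective σ
  obtain ⟨τ, rfl⟩ := H.exists_rep _ τ
  obtain ⟨a, rfl⟩ := OrbitSpace.mk_surjective a
  obtain ⟨b, rfl⟩ := OrbitSpace.exists_rep b
  have e₁ := TopOperadStr.orbitγ_mk H hH hact m h (σ • a) (fun i => τ i • b i)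
  have e₂ := TopOperadStr.orbitγ_mk H hH hact _ (P.sum_perm h σ) a
    (fun i => b ((P.perm σ).symm i))
  have e₃ := H.quotientγ_mk m h σ τ
  refine e₁.trans ((congrArg (OrbitSpace.mk _) (hact m h σ τ a b)).trans ?_)
  exact (congrArg₂ (fun (x : G n ⧸ H.carrier n) (y : OrbitSpace (H.carrier n) (C n)) => x • y)
    e₃ e₂).symm

end QuotientAction

/-! ## Fundamental groups and higher homotopy groups -/

/-- The fundamental group, with the product of loops written in the order in which the loops are
passed through (this is the opposite of the convention of `FundamentalGroup`). -/
abbrev LoopGroup (X : Type u) [TopologicalSpace X] (x : X) : Type u :=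
  (FundamentalGroup X x)ᵐᵒᵖ

/-- The class of a loop. -/
def LoopGroup.mk {X : Type u} [TopologicalSpace X] {x : X} (f : Path x x) : LoopGroup X x :=
  MulOpposite.op (FundamentalGroup.fromPath (Path.Homotopic.Quotient.mk f))

theorem LoopGroup.mk_mul_mk {X : Type u} [TopologicalSpace X] {x : X} (f g : Path x x) :
    LoopGroup.mk f * LoopGroup.mk g = LoopGroup.mk (f.trans g) :=
  rfl

/-- The class of an `l`-dimensional loop, i.e. of a map from the cube `I^l` which sends the boundary
to the basepoint. -/
def cubeClass {X : Type u} [TopologicalSpace X] {x : X} {l : ℕ} (f : GenLoop (Fin l) X x) :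
    HomotopyGroup.Pi l X x :=
  Quotient.mk _ f

/-- The image of an `l`-dimensional loop under a continuous map. -/
def cubeMap {X : Type u} [TopologicalSpace X] {Y : Type v} [TopologicalSpace Y] (φ : C(X, Y))
    {x : X} {l : ℕ} (f : GenLoop (Fin l) X x) : GenLoop (Fin l) Y (φ x) :=
  ⟨φ.comp f.1, fun t ht => congrArg φ (f.2 t ht)⟩

/-- The distance of a point of the cube from its centre in the maximum norm, with values in
`[0, 1]`; the value is `1` exactly on the boundary. -/
noncomputable def cubeRadius {l : ℕ} (t : Fin l → unitInterval) : ℝ :=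
  ‖fun i => 2 * (t i : ℝ) - 1‖

theorem continuous_cubeRadius (l : ℕ) : Continuous (cubeRadius (l := l)) := by
  unfold cubeRadius
  fun_prop

/-- Change of the basepoint of an `l`-dimensional loop `f` along a path `a`: on the concentric
subcube of half the size it is `f`, rescaled, and on the rest of the cube it is `a` on each radial
segment, beginning at the boundary of the cube. -/
noncomputable def cubeAlong {X : Type u} [TopologicalSpace X] {x y : X} {l : ℕ} (a : Path x y)
    (f : GenLoop (Fin l) X y) : GenLoop (Fin l) X x :=
  ⟨⟨fun t => if cubeRadius t ≤ 1 / 2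
      then f (fun i => Set.projIcc 0 1 zero_le_one (2 * (t i : ℝ) - 1 / 2))
      else a.extend (2 - 2 * cubeRadius t), by
    refine Continuous.if_le ?_ ?_ (continuous_cubeRadius l) continuous_const ?_
    · exact f.1.continuous.comp (continuous_pi fun i => continuous_projIcc.comp (by fun_prop))
    · exact a.continuous_extend.comp
        (continuous_const.sub (continuous_const.mul (continuous_cubeRadius l)))
    · intro t ht
      have h1 : a.extend (2 - 2 * cubeRadius t) = y := by
        rw [ht]
        norm_num
      rw [h1]
      apply f.2
      have hne : Nonempty (Fin l) := by
        by_contra hemp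
        rw [not_nonempty_iff] at hemp
        have : cubeRadius t = 0 := by
          unfold cubeRadius
          rw [Subsingleton.elim (fun i => 2 * (t i : ℝ) - 1) 0, norm_zero]
        rw [this] at ht
        norm_num at ht
      obtain ⟨i, -, hi⟩ := Finset.exists_mem_eq_sup' Finset.univ_nonempty
        (fun i => ‖2 * (t i : ℝ) - 1‖)
      have hr : |2 * (t i : ℝ) - 1| = 1 / 2 := by
        rw [← ht, ← Real.norm_eq_abs, ← hi]
        apply le_antisymm
        · exact Finset.sup'_le _ _ fun j _ => norm_le_pi_norm (fun i => 2 * (t i : ℝ) - 1) j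
        · exact (pi_norm_le_iff_of_nonempty _).2 fun j =>
            Finset.le_sup' (fun i => ‖2 * (t i : ℝ) - 1‖) (Finset.mem_univ j)
      refine ⟨i, ?_⟩
      rcases (abs_eq (by norm_num)).1 hr with h | h
      · right
        exact Set.projIcc_of_right_le _ (by linarith)
      · left
        exact Set.projIcc_of_le_left _ (by linarith)⟩, by
    rintro t ⟨i, hi⟩
    have h1 : 1 ≤ cubeRadius t := by
      refine le_trans ?_ (norm_le_pi_norm (fun i => 2 * (t i : ℝ) - 1) i)
      rcases hi with hi | hi <;> simp only [hi] <;> norm_num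
    change (if _ then _ else _) = _
    rw [if_neg (by linarith)]
    exact a.extend_of_le_zero (by linarith)⟩

/-! ## The homotopy groups of topological operads with a good basepoint -/

namespace TopOperadStr

variable {D : ℕ → Type u} [∀ n, TopologicalSpace (D n)] (O : TopOperadStr D)

/-- The pointwise composition `γ (f; g 0, …, g (k-1))` of paths. -/
def pathγ {k n : ℕ} (m : Fin k → ℕ) (h : ∑ i, m i = n) {x y : D k} {x' y' : ∀ i, D (m i)}
    (f : Path x y) (g : ∀ i, Path (x' i) (y' i)) : Path (O.γ m h x x') (O.γ m h y y') where
  toFun t := O.γ m h (f t) (fun i => g i t)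
  continuous_toFun := (O.continuous_γ m h).comp
    (f.continuous.prodMk (continuous_pi fun i => (g i).continuous))
  source' := by simp
  target' := by simp

/-- The pointwise composition `γ (f; g 0, …, g (k-1))` of `l`-dimensional loops. -/
def cubeγ {k n : ℕ} (m : Fin k → ℕ) (h : ∑ i, m i = n) {l : ℕ} {x : D k} {x' : ∀ i, D (m i)}
    (f : GenLoop (Fin l) (D k) x) (g : ∀ i, GenLoop (Fin l) (D (m i)) (x' i)) :
    GenLoop (Fin l) (D n) (O.γ m h x x') :=
  ⟨⟨fun t => O.γ m h (f t) (fun i => g i t), (O.continuous_γ m h).comp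
    (f.1.continuous.prodMk (continuous_pi fun i => (g i).1.continuous))⟩, fun t ht => by
      change O.γ m h (f.1 t) (fun i => (g i).1 t) = _
      rw [f.2 t ht]
      congr 1
      exact funext fun i => (g i).2 t ht⟩

end TopOperadStr

/-- A good basepoint of a topological operad is given by a morphism of nonsymmetric topological
operads from the standard components of the operad of little intervals. -/
abbrev GoodBasepoint {D : ℕ → Type u} [∀ n, TopologicalSpace (D n)] (O : TopOperadStr D) :
    Type u :=
  TopOperadHom IntervalComponent.operad O

namespace GoodBasepoint

variable {D : ℕ → Type u} [∀ n, TopologicalSpace (D n)] {O : TopOperadStr D} (η : GoodBasepoint O)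

/-- The basepoint `e n` of `D n`. -/
noncomputable def pt (n : ℕ) : D n :=
  η.toMap n (IntervalComponent.std n)

/-- The linear path from `e n` to `γ (e k; e (m 0), …, e (m (k-1)))`. -/
noncomputable def linear {k n : ℕ} (m : Fin k → ℕ) (h : ∑ i, m i = n) :
    Path (η.pt n) (O.γ m h (η.pt k) (fun i => η.pt (m i))) :=
  ((IntervalComponent.linear (IntervalComponent.std n)
    (IntervalComponent.operad.γ m h (IntervalComponent.std k)
      (fun i => IntervalComponent.std (m i)))).map (η.toMap n).continuous).cast rfl
    (η.map_γ m h _ _).symm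

/-- The composition of a group operad on the fundamental groups `π₁ (D n, e n)` is the pointwise
composition of loops, moved back to the basepoint along the linear path. -/
def IsLoopOperad (A : GroupOperad (fun n => LoopGroup (D n) (η.pt n))) : Prop :=
  ∀ {k n : ℕ} (m : Fin k → ℕ) (h : ∑ i, m i = n) (f : Path (η.pt k) (η.pt k))
    (g : ∀ i, Path (η.pt (m i)) (η.pt (m i))),
    A.γ m h (LoopGroup.mk f) (fun i => LoopGroup.mk (g i)) =
      LoopGroup.mk (((η.linear m h).trans (O.pathγ m h f g)).trans (η.linear m h).symm)

section Quotient

variable {K : ℕ → Type v} [∀ n, Group (K n)] {P : GroupOperad K} [∀ n, MulAction (K n) (D n)]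
  [∀ n, ContinuousConstSMul (K n) (D n)] (hact : IsOperadAction P O.toOperadStr)
  {Q : ℕ → Type u} [∀ n, TopologicalSpace (Q n)] (p : ∀ n, C(D n, Q n))
  (hp : ∀ (n : ℕ) (σ : K n) (x : D n), p n (σ • x) = p n x)

/-- The class in `π₁ (Q n)` of the image of a path from `e n` to `σ e n` in `D n`, where
`p n : D n → Q n` is invariant under the action. -/
noncomputable def liftClass {n : ℕ} (σ : K n) (f : Path (η.pt n) (σ • η.pt n)) :
    LoopGroup (Q n) (p n (η.pt n)) :=
  LoopGroup.mk ((f.map (p n).continuous).cast rfl (hp n σ (η.pt n)).symm)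

/-- For a path `f` from `e k` to `σ e k` and paths `g i` from `e (m i)` to `τ i e (m i)`, the path
`e n → γ (e k; e (m 0), …) → γ (σ e k; τ 0 e (m 0), …)
  = γ (σ; τ 0, …) γ (e k; e (m (σ⁻¹ 0)), …) → γ (σ; τ 0, …) e n`,
where the path in the middle is the pointwise composition and the other ones are linear. -/
noncomputable def liftγ {k n : ℕ} (m : Fin k → ℕ) (h : ∑ i, m i = n) (σ : K k)
    (τ : ∀ i, K (m i)) (f : Path (η.pt k) (σ • η.pt k))
    (g : ∀ i, Path (η.pt (m i)) (τ i • η.pt (m i))) :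
    Path (η.pt n) (P.γ m h σ τ • η.pt n) :=
  ((η.linear m h).trans ((O.pathγ m h f g).cast rfl
    (hact m h σ τ (η.pt k) (fun i => η.pt (m i))).symm)).trans
      ((η.linear (fun i => m ((P.perm σ).symm i)) (P.sum_perm h σ)).symm.map
        (continuous_const_smul (P.γ m h σ τ)))

/-- The composition of a group operad on the fundamental groups `π₁ (Q n)` of the quotients is
given by the composition of the lifts of loops to paths in `D n`. -/
def IsQuotientLoopOperad (B : GroupOperad (fun n => LoopGroup (Q n) (p n (η.pt n)))) : Prop :=
  ∀ {k n : ℕ} (m : Fin k → ℕ) (h : ∑ i, m i = n) (σ : K k) (τ : ∀ i, K (m i))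
    (f : Path (η.pt k) (σ • η.pt k)) (g : ∀ i, Path (η.pt (m i)) (τ i • η.pt (m i))),
    B.γ m h (η.liftClass p hp σ f) (fun i => η.liftClass p hp (τ i) (g i)) =
      η.liftClass p hp (P.γ m h σ τ) (η.liftγ hact m h σ τ f g)

/-- The composition of an operad on the homotopy groups `π_l (Q n)` is given by the pointwise
composition of lifts to `D n`, moved back to the basepoint along the linear path, and its
unit is the class of the constant map. -/
def IsHigherOperad (l : ℕ)
    (Ol : OperadStr (fun n => HomotopyGroup.Pi l (Q n) (p n (η.pt n)))) : Prop :=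
  Ol.one = cubeClass GenLoop.const ∧
  ∀ {k n : ℕ} (m : Fin k → ℕ) (h : ∑ i, m i = n) (f : GenLoop (Fin l) (D k) (η.pt k))
    (g : ∀ i, GenLoop (Fin l) (D (m i)) (η.pt (m i))),
    Ol.γ m h (cubeClass (cubeMap (p k) f)) (fun i => cubeClass (cubeMap (p (m i)) (g i))) =
      cubeClass (cubeMap (p n) (cubeAlong (η.linear m h) (O.cubeγ m h f g)))

end Quotient

end GoodBasepoint

/-!
Write `D = C / H`, with the basepoints `e n`, and let `p` be the projections of `D` to its quotients
by `G / H`. The homotopy classes of paths in `D` which begin at `e`, all points of the universal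
covering of `D`, form an operad: compose two paths with the composition of `D` and put the linear
path in front. The covering `p` identifies these classes with the classes of paths in the quotient,
on which the fundamental group acts freely. The composition of loops is defined so that this action
is equivariant, and since the action is free, all the axioms of a group operad follow from the ones
of the operad of path classes. For the same reason, homomorphisms which are compatible with a
morphism between operads of path classes form a morphism of group operads.

The exact sequence is the one of a covering: the end point of the lift of a path is equivariant for
the homomorphism which sends a loop to its deck transformation. In the higher homotopy groups, a
class is represented by a map of a cube to `D`, joined to the basepoint by a path class; such pairs
again form an operad with an action, of which the homotopy groups are a quotient.
-/

/-! ## Homotopy classes of paths -/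

/-- Homotopy relative to the end points of two paths whose end points need not agree
definitionally. -/
def HHomotopic {X : Type u} [TopologicalSpace X] {x y x' y' : X} (f : Path x y)
    (g : Path x' y') : Prop :=
  f.toContinuousMap.HomotopicRel g.toContinuousMap {0, 1}

namespace HHomotopic

variable {X : Type u} [TopologicalSpace X] {Y : Type v} [TopologicalSpace Y]
  {x y z x' y' z' x'' y'' : X}

theorem of_eq {f : Path x y} {g : Path x' y'} (h : ∀ t, f t = g t) : HHomotopic f g := by
  rw [HHomotopic, (ContinuousMap.ext h : f.toContinuousMap = g.toContinuousMap)]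
  exact .refl _

theorem refl (f : Path x y) : HHomotopic f f :=
  ContinuousMap.HomotopicRel.refl _

theorem symm {f : Path x y} {g : Path x' y'} (h : HHomotopic f g) : HHomotopic g f :=
  ContinuousMap.HomotopicRel.symm h

theorem trans {f : Path x y} {g : Path x' y'} {k : Path x'' y''} (h : HHomotopic f g)
    (h' : HHomotopic g k) : HHomotopic f k :=
  ContinuousMap.HomotopicRel.trans h h'

theorem source_eq {f : Path x y} {g : Path x' y'} (h : HHomotopic f g) : x = x' :=
  f.source.symm.trans ((h.fst_eq_snd (x := 0) (by simp)).trans g.source)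

theorem target_eq {f : Path x y} {g : Path x' y'} (h : HHomotopic f g) : y = y' :=
  f.target.symm.trans ((h.fst_eq_snd (x := 1) (by simp)).trans g.target)

theorem map {f : Path x y} {g : Path x' y'} (h : HHomotopic f g) {φ : X → Y}
    (hφ : Continuous φ) : HHomotopic (f.map hφ) (g.map hφ) :=
  h.comp_continuousMap ⟨φ, hφ⟩

theorem hcomp {f : Path x y} {g : Path y z} {f' : Path x' y'} {g' : Path y' z'}
    (hf : HHomotopic f f') (hg : HHomotopic g g') : HHomotopic (f.trans g) (f'.trans g') := by
  obtain rfl := hf.source_eq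
  obtain rfl := hf.target_eq
  obtain rfl := hg.target_eq
  exact Path.Homotopic.hcomp hf hg

theorem assoc {w : X} (f : Path x y) (g : Path y z) (k : Path z w) :
    HHomotopic ((f.trans g).trans k) (f.trans (g.trans k)) :=
  ⟨Path.Homotopy.transAssoc f g k⟩

theorem refl_trans (f : Path x y) : HHomotopic ((Path.refl x).trans f) f :=
  ⟨Path.Homotopy.reflTrans f⟩

theorem trans_refl (f : Path x y) : HHomotopic (f.trans (Path.refl y)) f :=
  ⟨Path.Homotopy.transRefl f⟩

theorem trans_symm_self (f : Path x y) : HHomotopic (f.trans f.symm) (Path.refl x) :=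
  ContinuousMap.HomotopicRel.symm ⟨Path.Homotopy.reflTransSymm f⟩

theorem symm_trans_self (f : Path x y) : HHomotopic (f.symm.trans f) (Path.refl y) :=
  ContinuousMap.HomotopicRel.symm ⟨Path.Homotopy.reflSymmTrans f⟩

theorem trans_symm_trans (f : Path x y) (g : Path z y) (k : Path y z') :
    HHomotopic ((f.trans g.symm).trans (g.trans k)) (f.trans k) :=
  (assoc f _ _).trans <| hcomp (refl f) <| (assoc _ g k).symm.trans <|
    (hcomp (symm_trans_self g) (refl k)).trans (refl_trans k)

theorem trans_right_cancel {f f' : Path x y} {g : Path y z}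
    (h : HHomotopic (f.trans g) (f'.trans g)) : HHomotopic f f' := by
  have cancel (f : Path x y) : HHomotopic ((f.trans g).trans g.symm) f :=
    (assoc f _ _).trans ((hcomp (refl f) (trans_symm_self g)).trans (trans_refl f))
  exact (cancel f).symm.trans ((hcomp h (refl _)).trans (cancel f'))

end HHomotopic

namespace LoopGroup

variable {X : Type u} [TopologicalSpace X] {x : X}

theorem mk_surjective : Function.Surjective (mk : Path x x → LoopGroup X x) := by
  rintro ⟨a⟩
  obtain ⟨f, rfl⟩ := Path.Homotopic.Quotient.mk_surjective (FundamentalGroup.toPath a)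
  exact ⟨f, rfl⟩

theorem exists_mk_family {ι : Type*} {Y : ι → Type u} [∀ i, TopologicalSpace (Y i)] {y : ∀ i, Y i}
    (a : ∀ i, LoopGroup (Y i) (y i)) : ∃ f : ∀ i, Path (y i) (y i), a = fun i => mk (f i) :=
  ⟨fun i => (mk_surjective (a i)).choose, funext fun i => (mk_surjective (a i)).choose_spec.symm⟩

theorem mk_eq_mk {f g : Path x x} : mk f = mk g ↔ HHomotopic f g :=
  ⟨fun h => Path.Homotopic.Quotient.exact (MulOpposite.op_injective h),
    fun h => congrArg MulOpposite.op (Quotient.sound h)⟩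

end LoopGroup

/-- The setoid of homotopy of paths which begin at `x` and end anywhere. -/
def PathClass.setoid {X : Type u} [TopologicalSpace X] (x : X) : Setoid (Σ y, Path x y) where
  r f g := HHomotopic f.2 g.2
  iseqv := ⟨fun f => .refl f.2, .symm, .trans⟩

/-- Homotopy classes, relative to the end points, of paths which begin at `x`. They are the points
of the universal covering of a path-connected and locally well-behaved space. -/
def PathClass {X : Type u} [TopologicalSpace X] (x : X) : Type u :=
  Quotient (PathClass.setoid x)

namespace PathClass

variable {X : Type u} [TopologicalSpace X] {Y : Type v} [TopologicalSpace Y] {x y z : X}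

/-- The class of a path. -/
def mk (f : Path x y) : PathClass x :=
  Quotient.mk (setoid x) ⟨y, f⟩

theorem mk_eq_mk {f : Path x y} {g : Path x z} : mk f = mk g ↔ HHomotopic f g :=
  Quotient.eq (r := setoid x)

theorem mk_surjective (u : PathClass x) : ∃ (y : X) (f : Path x y), mk f = u :=
  let ⟨⟨y, f⟩, h⟩ := Quotient.exists_rep u
  ⟨y, f, h⟩

instance : Nonempty (PathClass x) :=
  ⟨mk (Path.refl x)⟩

/-- The end point of a class of paths. -/
def endpoint : PathClass x → X :=
  Quotient.lift (fun f => f.1) fun _ _ h => HHomotopic.target_eq h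

theorem endpoint_mk (f : Path x y) : endpoint (mk f) = y :=
  rfl

/-- A path which represents a class. -/
noncomputable def rep (u : PathClass x) : Path x u.endpoint :=
  (Quotient.out u).2.cast rfl (congrArg endpoint (Quotient.out_eq u)).symm

theorem mk_rep (u : PathClass x) : mk u.rep = u :=
  have hcast : HHomotopic u.rep (Quotient.out u).2 := .of_eq fun _ => rfl
  (mk_eq_mk.2 hcast).trans (Quotient.out_eq u)

/-- The image of a class of paths under a continuous map. -/
def map (φ : C(X, Y)) : PathClass x → PathClass (φ x) :=
  Quotient.map (fun f => ⟨φ f.1, f.2.map φ.continuous⟩) fun _ _ h => h.map φ.continuous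

theorem map_mk (φ : C(X, Y)) (f : Path x y) : map φ (mk f) = mk (f.map φ.continuous) :=
  rfl

/-- The loops at `x` act on the paths which begin at `x` by precomposition: these are the deck
transformations of the universal covering. -/
noncomputable instance : MulAction (LoopGroup X x) (PathClass x) where
  smul a := Quotient.map (fun f => ⟨f.1, (LoopGroup.mk_surjective a).choose.trans f.2⟩)
    fun _ _ h => .hcomp (.refl _) h
  one_smul u := by
    obtain ⟨y, f, rfl⟩ := u.mk_surjective
    have h := (LoopGroup.mk_surjective (1 : LoopGroup X x)).choose_spec
    exact mk_eq_mk.2 ((HHomotopic.hcomp (LoopGroup.mk_eq_mk.1 h) (.refl f)).trans (.refl_trans f))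
  mul_smul a b u := by
    obtain ⟨y, f, rfl⟩ := u.mk_surjective
    have ha := (LoopGroup.mk_surjective a).choose_spec
    have hb := (LoopGroup.mk_surjective b).choose_spec
    have hab := (LoopGroup.mk_surjective (a * b)).choose_spec.trans
      (congrArg₂ (· * ·) ha hb).symm
    exact mk_eq_mk.2 ((HHomotopic.hcomp (LoopGroup.mk_eq_mk.1 hab) (.refl f)).trans
      (.assoc _ _ f))

theorem mk_smul_mk (f : Path x x) (g : Path x y) : LoopGroup.mk f • mk g = mk (f.trans g) :=
  mk_eq_mk.2 (.hcomp (LoopGroup.mk_eq_mk.1 (LoopGroup.mk_surjective _).choose_spec) (.refl g))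

instance : IsCancelSMul (LoopGroup X x) (PathClass x) where
  right_cancel' a b u h := by
    obtain ⟨f, rfl⟩ := LoopGroup.mk_surjective a
    obtain ⟨g, rfl⟩ := LoopGroup.mk_surjective b
    obtain ⟨y, k, rfl⟩ := u.mk_surjective
    rw [mk_smul_mk, mk_smul_mk, mk_eq_mk] at h
    exact LoopGroup.mk_eq_mk.2 h.trans_right_cancel

theorem endpoint_smul (a : LoopGroup X x) (u : PathClass x) :
    endpoint (a • u) = endpoint u := by
  obtain ⟨f, rfl⟩ := LoopGroup.mk_surjective a
  obtain ⟨y, k, rfl⟩ := u.mk_surjective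
  rw [mk_smul_mk, endpoint_mk, endpoint_mk]

end PathClass

/-! ## Operads and free actions -/

theorem blockPerm_one {k n : ℕ} (m : Fin k → ℕ) (h : ∑ i, m i = n) :
    blockPerm m h 1 (fun _ => 1) = 1 :=
  Equiv.ext <| (blockIndex m h).surjective.forall.2 fun ⟨i, j⟩ =>
    blockPerm_apply m h 1 (fun _ => 1) h i j

namespace OperadStr

variable {C : ℕ → Type u} (O : OperadStr C)

theorem γ_perm_congr {k n : ℕ} (m : Fin k → ℕ) {s s' : Equiv.Perm (Fin k)} (hs : s = s')
    (h : ∑ i, m (s.symm i) = n) (h' : ∑ i, m (s'.symm i) = n) (a : C k) (b : ∀ i, C (m i)) :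
    O.γ (fun i => m (s.symm i)) h a (fun i => b (s.symm i)) =
      O.γ (fun i => m (s'.symm i)) h' a (fun i => b (s'.symm i)) := by
  subst hs
  rfl

theorem γ_section_congr (e : ∀ n, C n) {k n : ℕ} {m m' : Fin k → ℕ} (hm : ∀ i, m i = m' i)
    (h : ∑ i, m i = n) (h' : ∑ i, m' i = n) (a : C k) :
    O.γ m h a (fun i => e (m i)) = O.γ m' h' a (fun i => e (m' i)) := by
  obtain rfl : m = m' := funext hm
  rfl

end OperadStr

namespace GroupOperad

section FreeAction

variable {B : ℕ → Type v} [∀ n, Group (B n)] {E : ℕ → Type u} [∀ n, MulAction (B n) (E n)]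
  [∀ n, IsCancelSMul (B n) (E n)] [∀ n, Nonempty (E n)]

variable (O : OperadStr E) (π : ∀ n, B n →* (Equiv.Perm (Fin n))ᵐᵒᵖ)
  (γ : ∀ {k n : ℕ} (m : Fin k → ℕ), ∑ i, m i = n → B k → (∀ i, B (m i)) → B n)
  (π_γ : ∀ {k n : ℕ} (m : Fin k → ℕ) (h : ∑ i, m i = n) (a : B k) (b : ∀ i, B (m i)),
    π n (γ m h a b) = symmOperad.γ m h (π k a) (fun i => π (m i) (b i)))
  (γ_smul : ∀ {k n : ℕ} (m : Fin k → ℕ) (h : ∑ i, m i = n) (a : B k) (b : ∀ i, B (m i))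
    (h' : ∑ i, m ((π k a).unop.symm i) = n) (x : E k) (y : ∀ i, E (m i)),
    O.γ m h (a • x) (fun i => b i • y i) =
      γ m h a b • O.γ (fun i => m ((π k a).unop.symm i)) h' x
        (fun i => y ((π k a).unop.symm i)))

include π_γ γ_smul in
theorem assoc_of_γ_smul {k M N : ℕ} (m : Fin k → ℕ) (hm : ∑ i, m i = M) (p : Fin M → ℕ)
    (hp : ∑ l, p l = N) (q : Fin k → ℕ) (hq : ∀ i, ∑ j, p (blockIndex m hm ⟨i, j⟩) = q i)
    (hN : ∑ i, q i = N) (a : B k) (b : ∀ i, B (m i)) (c : ∀ l, B (p l)) :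
    γ p hp (γ m hm a b) c =
      γ q hN a fun i => γ (fun j => p (blockIndex m hm ⟨i, j⟩)) (hq i) (b i) fun j =>
        c (blockIndex m hm ⟨i, j⟩) := by
  let e n : E n := Classical.arbitrary (E n)
  let σ := (π k a).unop
  let ρ := (π M (γ m hm a b)).unop
  have hm' : ∑ i, m (σ.symm i) = M := (Equiv.sum_comp σ.symm m).trans hm
  have hN' : ∑ i, q (σ.symm i) = N := (Equiv.sum_comp σ.symm q).trans hN
  have hp' : ∑ l, p (ρ.symm l) = N := (Equiv.sum_comp ρ.symm p).trans hp
  have hp'' i : ∑ j, p (blockIndex m hm ⟨i, (π (m i) (b i)).unop.symm j⟩) = q i :=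
    (Equiv.sum_comp _ fun j => p (blockIndex m hm ⟨i, j⟩)).trans (hq i)
  have hρ i j : ρ.symm (blockIndex (fun i => m (σ.symm i)) hm' ⟨i, j⟩) =
      blockIndex m hm ⟨σ.symm i, (π _ (b (σ.symm i))).unop.symm j⟩ := by
    have hblock : ρ = blockPerm m hm σ fun i => (π (m i) (b i)).unop :=
      congrArg MulOpposite.unop (π_γ m hm a b)
    rw [hblock, blockPerm_symm_apply m hm σ _ hm']
  have hbase : O.γ (fun l => p (ρ.symm l)) hp' (O.γ (fun i => m (σ.symm i)) hm' (e k)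
        fun i => e (m (σ.symm i))) (fun l => e (p (ρ.symm l))) =
      O.γ (fun i => q (σ.symm i)) hN' (e k) fun i =>
        O.γ (fun j => p (blockIndex m hm ⟨σ.symm i, (π _ (b (σ.symm i))).unop.symm j⟩))
          (hp'' (σ.symm i)) (e (m (σ.symm i))) fun j => e (p _) := by
    have hq' i : ∑ j, p (ρ.symm (blockIndex (fun i => m (σ.symm i)) hm' ⟨i, j⟩)) =
        q (σ.symm i) := by
      simp only [hρ, hp'']
    rw [O.assoc _ hm' _ hp' _ hq' hN']
    exact congrArg _ (funext fun i => O.γ_section_congr e (fun j => congrArg p (hρ i j)) _ _ _)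
  apply IsCancelSMul.right_cancel _ _ (O.γ (fun l => p (ρ.symm l)) hp'
    (O.γ (fun i => m (σ.symm i)) hm' (e k) fun i => e (m (σ.symm i)))
    fun l => e (p (ρ.symm l)))
  rw [← γ_smul p hp (γ m hm a b) c hp' _ fun l => e (p l),
    ← γ_smul m hm a b hm' _ fun i => e (m i), O.assoc m hm p hp q hq hN, hbase,
    ← γ_smul q hN a _ hN' _ fun i => O.γ _ (hp'' i) (e (m i)) fun j => e (p _)]
  exact congrArg _ (funext fun i => γ_smul _ (hq i) (b i) _ (hp'' i) _ fun j => e (p _))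

include γ_smul in
theorem crossed_of_γ_smul {k n : ℕ} (m : Fin k → ℕ) (h : ∑ i, m i = n) (a a' : B k)
    (b b' : ∀ i, B (m i)) (h' : ∑ i, m ((π k a).unop.symm i) = n) :
    γ m h (a * a') (fun i => b i * b' i) =
      γ m h a b * γ (fun i => m ((π k a).unop.symm i)) h' a'
        (fun i => b' ((π k a).unop.symm i)) := by
  let e n : E n := Classical.arbitrary (E n)
  have h'' : ∑ i, m ((π k a).unop.symm ((π k a').unop.symm i)) = n :=
    (Equiv.sum_comp _ fun i => m ((π k a).unop.symm i)).trans h'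
  have hbase := O.γ_section_congr e
    (m' := fun i => m ((π k a).unop.symm ((π k a').unop.symm i)))
    (fun i => congrArg (fun s => m (s.unop.symm i)) (map_mul (π k) a a'))
    ((Equiv.sum_comp _ m).trans h) h'' (e k)
  apply IsCancelSMul.right_cancel _ _ (O.γ _ h'' (e k) fun i => e (m _))
  rw [← hbase, ← γ_smul m h (a * a') _ _ _ fun i => e (m i), hbase, mul_smul, mul_smul,
    ← γ_smul _ h' a' _ h'' _ fun i => e (m _), ← γ_smul m h a b h' _ fun i => b' i • e (m i)]
  simp only [mul_smul]

/-- A sequence of groups which acts freely on an operad is a group operad as soon as it has a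
composition for which the action is equivariant: evaluated at points of the operad, the axioms of
a group operad become consequences of the axioms of the operad. -/
noncomputable def ofFreeAction : GroupOperad B where
  π := π
  π_γ := π_γ
  zero_point :=
    have ⟨_⟩ := O.zero_point
    ⟨⟨⟨1⟩, fun a => IsCancelSMul.right_cancel a 1 (Classical.arbitrary (E 0))
      (Subsingleton.elim _ _)⟩⟩
  one := 1
  γ := γ
  one_eq := rfl
  one_γ {n} h a := by
    have hone := γ_smul (fun _ : Fin 1 => n) h 1 (fun _ => a) (by simp) O.one
      fun _ => Classical.arbitrary (E n)
    rw [one_smul, O.one_γ, O.one_γ] at hone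
    exact (IsCancelSMul.right_cancel _ _ _ hone).symm
  γ_one {n} h a := by
    have hone := γ_smul (fun _ : Fin n => 1) h a (fun _ => 1) (by simp) (Classical.arbitrary (E n))
      fun _ => O.one
    simp only [one_smul, O.γ_one] at hone
    exact (IsCancelSMul.right_cancel _ _ _ hone).symm
  assoc := assoc_of_γ_smul O π γ π_γ γ_smul
  crossed := crossed_of_γ_smul O π γ γ_smul

end FreeAction

end GroupOperad

section Equivariance

variable {G : ℕ → Type v} [∀ n, Group (G n)] {P : GroupOperad G} {E : ℕ → Type u}
  {O : OperadStr E} [∀ n, MulAction (G n) (E n)]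

theorem IsOperadAction.γ_eq_of_smul_eq [∀ n, IsCancelSMul (G n) (E n)] (hact : IsOperadAction P O)
    {k n : ℕ} {m : Fin k → ℕ} {h : ∑ i, m i = n} {a : G k} {b : ∀ i, G (m i)} {c : G n} {x : E k}
    {y : ∀ i, E (m i)}
    (hc : O.γ m h (a • x) (fun i => b i • y i) =
      c • O.γ (fun i => m ((P.perm a).symm i)) (P.sum_perm h a) x
        (fun i => y ((P.perm a).symm i))) :
    P.γ m h a b = c :=
  IsCancelSMul.right_cancel _ _ _ ((hact m h a b x y).symm.trans hc)

/-- Homomorphisms between group operads which act on operads form a morphism of group operads as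
soon as they are compatible with a morphism `t` between the operads, the second of which is acted
on freely. -/
def GroupOperadHom.ofEquivariant {G' : ℕ → Type w} [∀ n, Group (G' n)] {P' : GroupOperad G'}
    {E' : ℕ → Type*} {O' : OperadStr E'} [∀ n, MulAction (G' n) (E' n)]
    [∀ n, IsCancelSMul (G' n) (E' n)] [∀ n, Nonempty (E n)] (hact : IsOperadAction P O)
    (hact' : IsOperadAction P' O') (φ : ∀ n, G n →* G' n)
    (π_comp : ∀ n a, P'.π n (φ n a) = P.π n a) (t : ∀ n, E n → E' n)
    (t_γ : ∀ {k n : ℕ} (m : Fin k → ℕ) (h : ∑ i, m i = n) (x : E k) (y : ∀ i, E (m i)),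
      t n (O.γ m h x y) = O'.γ m h (t k x) (fun i => t (m i) (y i)))
    (t_smul : ∀ n (a : G n) (x : E n), t n (a • x) = φ n a • t n x) :
    GroupOperadHom P P' where
  toHom := φ
  π_comp := π_comp
  map_γ {k n} m h a b := by
    let e n : E n := Classical.arbitrary (E n)
    have hperm : P.perm a = P'.perm (φ k a) := congrArg MulOpposite.unop (π_comp k a).symm
    have ht := congrArg (t n) (hact m h a b (e k) fun i => e (m i))
    simp only [t_smul, t_γ] at ht
    exact (hact'.γ_eq_of_smul_eq (ht.trans (congrArg _ (O'.γ_perm_congr m hperm _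
      (P'.sum_perm h _) (t k (e k)) fun i => t _ (e (m i)))))).symm

variable {F : ℕ → Type w} (r : ∀ n, E n → F n) (hr : ∀ n, Function.Surjective (r n))
  (congr_γ : ∀ {k n : ℕ} (m : Fin k → ℕ) (h : ∑ i, m i = n) {x x' : E k} {y y' : ∀ i, E (m i)},
    r k x = r k x' → (∀ i, r (m i) (y i) = r (m i) (y' i)) →
      r n (O.γ m h x y) = r n (O.γ m h x' y'))

/-- The quotient of an operad by a congruence, given by the surjections `r` onto the classes. -/
noncomputable def OperadStr.ofSurjective : OperadStr F where
  zero_point :=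
    have ⟨_⟩ := O.zero_point
    ⟨⟨⟨r 0 default⟩, (hr 0).forall.2 fun x => congrArg (r 0) (Subsingleton.elim x default)⟩⟩
  one := r 1 O.one
  γ {k n} m h a b :=
    r n (O.γ m h (Function.surjInv (hr k) a) fun i => Function.surjInv (hr (m i)) (b i))
  one_γ {n} h a :=
    ((congr_γ (fun _ => n) h (Function.surjInv_eq _ _) fun _ => rfl).trans
      (congrArg (r n) (O.one_γ h _))).trans (Function.surjInv_eq (hr n) a)
  γ_one {n} h a :=
    ((congr_γ (fun _ => 1) h rfl fun _ => Function.surjInv_eq _ _).trans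
      (congrArg (r n) (O.γ_one h _))).trans (Function.surjInv_eq (hr n) a)
  assoc m hm p hp q hq hN _ _ _ :=
    ((congr_γ p hp (Function.surjInv_eq _ _) fun _ => rfl).trans
      (congrArg (r _) (O.assoc m hm p hp q hq hN _ _ _))).trans
        (congr_γ q hN rfl fun _ => (Function.surjInv_eq _ _).symm)

theorem OperadStr.ofSurjective_γ {k n : ℕ} (m : Fin k → ℕ) (h : ∑ i, m i = n) (x : E k)
    (y : ∀ i, E (m i)) :
    (OperadStr.ofSurjective r hr congr_γ).γ m h (r k x) (fun i => r (m i) (y i)) =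
      r n (O.γ m h x y) :=
  congr_γ m h (Function.surjInv_eq _ _) fun _ => Function.surjInv_eq _ _

theorem IsOperadAction.ofSurjective [∀ n, MulAction (G n) (F n)] (hact : IsOperadAction P O)
    (r_smul : ∀ n (a : G n) (x : E n), r n (a • x) = a • r n x) :
    IsOperadAction P (OperadStr.ofSurjective r hr congr_γ) := by
  intro k n m h σ τ a b
  obtain ⟨x, rfl⟩ := hr k a
  choose y hy using fun i => hr (m i) (b i)
  obtain rfl : (fun i => r (m i) (y i)) = b := funext hy
  simp only [← r_smul]
  rw [OperadStr.ofSurjective_γ, hact]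
  exact (r_smul n _ _).trans (congrArg _ (OperadStr.ofSurjective_γ r hr congr_γ _ _ _ _).symm)

end Equivariance

/-! ## Linear paths -/

namespace IntervalComponent

open LittleIntervals

theorem continuous_linear {k : ℕ} {A : Type u} [TopologicalSpace A]
    {f g : A → IntervalComponent k} {s : A → unitInterval} (hf : Continuous f) (hg : Continuous g)
    (hs : Continuous s) : Continuous fun a => linear (f a) (g a) (s a) := by
  have hlo {f : A → IntervalComponent k} (hf : Continuous f) i :
      Continuous fun a => (f a).1.lo i :=
    (continuous_lo i).comp (continuous_subtype_val.comp hf)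
  have hhi {f : A → IntervalComponent k} (hf : Continuous f) i :
      Continuous fun a => (f a).1.hi i :=
    (continuous_hi i).comp (continuous_subtype_val.comp hf)
  have hs' : Continuous fun a => (s a : ℝ) := continuous_subtype_val.comp hs
  refine Continuous.subtype_mk (Continuous.subtype_mk (Continuous.prodMk ?_ ?_) _) _
  · exact continuous_pi fun i =>
      ((continuous_const.sub hs').mul (hlo hf i)).add (hs'.mul (hlo hg i))
  · exact continuous_pi fun i =>
      ((continuous_const.sub hs').mul (hhi hf i)).add (hs'.mul (hhi hg i))

theorem linear_self {k : ℕ} (c : IntervalComponent k) (t : unitInterval) :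
    linear c c t = c := by
  refine Subtype.ext (ext_lo_hi (fun i => ?_) fun i => ?_)
  · change (1 - (t : ℝ)) * c.1.lo i + t * c.1.lo i = _
    ring
  · change (1 - (t : ℝ)) * c.1.hi i + t * c.1.hi i = _
    ring

theorem hhomotopic_of_eq {k : ℕ} {c d c' d' : IntervalComponent k} (hc : c = c') (hd : d = d')
    (f : Path c d) (g : Path c' d') : HHomotopic f g := by
  subst hc hd
  refine ⟨⟨⟨⟨fun x => linear (f x.2) (g x.2) x.1, continuous_linear
    (f.continuous.comp continuous_snd) (g.continuous.comp continuous_snd) continuous_fst⟩,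
    fun t => (linear (f t) (g t)).source, fun t => (linear (f t) (g t)).target⟩, ?_⟩⟩
  intro s t ht
  have hfg : f t = g t := by
    rcases ht with rfl | rfl <;> simp only [Path.source, Path.target]
  change linear (f t) (g t) s = f t
  rw [← hfg, linear_self]

end IntervalComponent

namespace TopOperadStr

variable {D : ℕ → Type u} [∀ n, TopologicalSpace (D n)] (O : TopOperadStr D)

/-- The operad of continuous maps from a space, composed pointwise. -/
def mapOperad (A : Type w) [TopologicalSpace A] : OperadStr fun n => C(A, D n) where
  zero_point :=
    have ⟨_⟩ := O.zero_point
    ⟨⟨⟨.const A default⟩, fun _ => ContinuousMap.ext fun _ => Subsingleton.elim _ _⟩⟩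
  one := .const A O.one
  γ m h f g := ⟨fun t => O.γ m h (f t) fun i => g i t, (O.continuous_γ m h).comp
    (f.continuous.prodMk (continuous_pi fun i => (g i).continuous))⟩
  one_γ h f := ContinuousMap.ext fun t => O.one_γ h (f t)
  γ_one h f := ContinuousMap.ext fun t => O.γ_one h (f t)
  assoc m hm p hp q hq hN f g c :=
    ContinuousMap.ext fun t => O.assoc m hm p hp q hq hN (f t) (fun i => g i t) fun l => c l t

theorem homotopicRel_mapOperad_γ {A : Type w} [TopologicalSpace A] {S : Set A} {k n : ℕ}
    (m : Fin k → ℕ) (h : ∑ i, m i = n) {f f₁ : C(A, D k)} {g g₁ : ∀ i, C(A, D (m i))}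
    (hf : f.HomotopicRel f₁ S) (hg : ∀ i, (g i).HomotopicRel (g₁ i) S) :
    ((O.mapOperad A).γ m h f g).HomotopicRel ((O.mapOperad A).γ m h f₁ g₁) S := by
  obtain ⟨F⟩ := hf
  let G i := (hg i).some
  refine ⟨⟨⟨(O.mapOperad _).γ m h F.toContinuousMap fun i => (G i).toContinuousMap, ?_, ?_⟩, ?_⟩⟩
  · exact fun t => congrArg₂ (O.γ m h) (F.apply_zero t) (funext fun i => (G i).apply_zero t)
  · exact fun t => congrArg₂ (O.γ m h) (F.apply_one t) (funext fun i => (G i).apply_one t)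
  · exact fun s t ht =>
      congrArg₂ (O.γ m h) (F.eq_fst s ht) (funext fun i => (G i).eq_fst s ht)

theorem pathγ_congr {k n : ℕ} (m : Fin k → ℕ) (h : ∑ i, m i = n) {x y x₁ y₁ : D k}
    {x' y' x₁' y₁' : ∀ i, D (m i)} {f : Path x y} {g : ∀ i, Path (x' i) (y' i)}
    {f₁ : Path x₁ y₁} {g₁ : ∀ i, Path (x₁' i) (y₁' i)} (hf : HHomotopic f f₁)
    (hg : ∀ i, HHomotopic (g i) (g₁ i)) :
    HHomotopic (O.pathγ m h f g) (O.pathγ m h f₁ g₁) :=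
  O.homotopicRel_mapOperad_γ m h hf hg

theorem pathγ_trans {k n : ℕ} (m : Fin k → ℕ) (h : ∑ i, m i = n) {x y z : D k}
    {x' y' z' : ∀ i, D (m i)} (f : Path x y) (f₁ : Path y z) (g : ∀ i, Path (x' i) (y' i))
    (g₁ : ∀ i, Path (y' i) (z' i)) :
    O.pathγ m h (f.trans f₁) (fun i => (g i).trans (g₁ i)) =
      (O.pathγ m h f g).trans (O.pathγ m h f₁ g₁) := by
  ext t
  change O.γ m h (f.trans f₁ t) (fun i => (g i).trans (g₁ i) t) = _
  simp only [Path.trans_apply]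
  split_ifs <;> rfl

end TopOperadStr

namespace GoodBasepoint

variable {D : ℕ → Type u} [∀ n, TopologicalSpace (D n)] {O : TopOperadStr D} (η : GoodBasepoint O)

theorem linear_one_left {n : ℕ} (h : ∑ _i : Fin 1, n = n) :
    HHomotopic (η.linear (fun _ => n) h) (Path.refl (η.pt n)) :=
  (IntervalComponent.hhomotopic_of_eq rfl (IntervalComponent.operad.one_γ h _)
    (IntervalComponent.linear _ _) (Path.refl _)).map (η.toMap n).continuous

theorem linear_one_right {n : ℕ} (h : ∑ _i : Fin n, 1 = n) :
    HHomotopic (η.linear (fun _ => 1) h) (Path.refl (η.pt n)) :=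
  (IntervalComponent.hhomotopic_of_eq rfl (IntervalComponent.operad.γ_one h _)
    (IntervalComponent.linear _ _) (Path.refl _)).map (η.toMap n).continuous

/-- The two linear ways from the basepoint to a twofold composition of basepoints are homotopic,
since they are images of paths in a convex space. -/
theorem linear_assoc {k M N : ℕ} (m : Fin k → ℕ) (hm : ∑ i, m i = M) (p : Fin M → ℕ)
    (hp : ∑ l, p l = N) (q : Fin k → ℕ) (hq : ∀ i, ∑ j, p (blockIndex m hm ⟨i, j⟩) = q i)
    (hN : ∑ i, q i = N) :
    HHomotopic
      ((η.linear p hp).trans (O.pathγ p hp (η.linear m hm) fun l => .refl (η.pt (p l))))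
      ((η.linear q hN).trans (O.pathγ q hN (.refl (η.pt k)) fun i => η.linear _ (hq i))) := by
  let I := IntervalComponent.operad
  let left := (IntervalComponent.linear (.std N) _).trans <|
    I.pathγ p hp (IntervalComponent.linear (.std M) (I.γ m hm (.std k) fun i => .std (m i)))
      fun l => .refl (IntervalComponent.std (p l))
  let right := (IntervalComponent.linear (.std N) _).trans <|
    I.pathγ q hN (.refl (.std k)) fun i =>
      IntervalComponent.linear (.std (q i)) (I.γ _ (hq i) (.std (m i)) fun _ => .std _)
  have map_left : HHomotopic (left.map (η.toMap N).continuous)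
      ((η.linear p hp).trans (O.pathγ p hp (η.linear m hm) fun l => .refl (η.pt (p l)))) := by
    refine .of_eq fun t => ?_
    simp only [left, Path.map_coe, Function.comp_apply, Path.trans_apply]
    split_ifs
    · rfl
    · exact η.map_γ p hp _ _
  have map_right : HHomotopic (right.map (η.toMap N).continuous)
      ((η.linear q hN).trans (O.pathγ q hN (.refl (η.pt k)) fun i => η.linear _ (hq i))) := by
    refine .of_eq fun t => ?_
    simp only [right, Path.map_coe, Function.comp_apply, Path.trans_apply]
    split_ifs
    · rfl
    · exact η.map_γ q hN _ _
  exact map_left.symm.trans <| ((IntervalComponent.hhomotopic_of_eq rfl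
    (I.assoc m hm p hp q hq hN _ _ _) left right).map _).trans map_right

end GoodBasepoint

/-! ## The operad of classes of paths -/

theorem PathClass.exists_mk_family {ι : Type*} {X : ι → Type u} [∀ i, TopologicalSpace (X i)]
    {x : ∀ i, X i} (u : ∀ i, PathClass (x i)) :
    ∃ (y : ∀ i, X i) (f : ∀ i, Path (x i) (y i)), (fun i => mk (f i)) = u :=
  ⟨_, fun i => (u i).rep, funext fun i => (u i).mk_rep⟩

namespace GoodBasepoint

open PathClass

variable {D : ℕ → Type u} [∀ n, TopologicalSpace (D n)] {O : TopOperadStr D} (η : GoodBasepoint O)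

/-- The composition of classes of paths which begin at the basepoints: the pointwise composition,
preceded by the linear path. -/
noncomputable def pathClassγ {k n : ℕ} (m : Fin k → ℕ) (h : ∑ i, m i = n)
    (u : PathClass (η.pt k)) (v : ∀ i, PathClass (η.pt (m i))) : PathClass (η.pt n) :=
  mk ((η.linear m h).trans (O.pathγ m h u.rep fun i => (v i).rep))

theorem pathClassγ_mk {k n : ℕ} (m : Fin k → ℕ) (h : ∑ i, m i = n) {x : D k} {y : ∀ i, D (m i)}
    (f : Path (η.pt k) x) (g : ∀ i, Path (η.pt (m i)) (y i)) :
    η.pathClassγ m h (mk f) (fun i => mk (g i)) =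
      mk ((η.linear m h).trans (O.pathγ m h f g)) :=
  mk_eq_mk.2 <| .hcomp (.refl _) <|
    O.pathγ_congr m h (mk_eq_mk.1 (mk_rep _)) fun _ => mk_eq_mk.1 (mk_rep _)

theorem pathClassγ_assoc {k M N : ℕ} (m : Fin k → ℕ) (hm : ∑ i, m i = M) (p : Fin M → ℕ)
    (hp : ∑ l, p l = N) (q : Fin k → ℕ) (hq : ∀ i, ∑ j, p (blockIndex m hm ⟨i, j⟩) = q i)
    (hN : ∑ i, q i = N) (u : PathClass (η.pt k)) (v : ∀ i, PathClass (η.pt (m i)))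
    (w : ∀ l, PathClass (η.pt (p l))) :
    η.pathClassγ p hp (η.pathClassγ m hm u v) w =
      η.pathClassγ q hN u fun i => η.pathClassγ (fun j => p (blockIndex m hm ⟨i, j⟩)) (hq i) (v i)
        fun j => w (blockIndex m hm ⟨i, j⟩) := by
  obtain ⟨x, f, rfl⟩ := u.mk_surjective
  obtain ⟨y, g, rfl⟩ := exists_mk_family v
  obtain ⟨z, c, rfl⟩ := exists_mk_family w
  simp only [pathClassγ_mk]
  rw [mk_eq_mk]
  have left : HHomotopic (O.pathγ p hp ((η.linear m hm).trans (O.pathγ m hm f g)) c)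
      ((O.pathγ p hp (η.linear m hm) fun l => .refl (η.pt (p l))).trans
        (O.pathγ p hp (O.pathγ m hm f g) c)) := by
    rw [← O.pathγ_trans]
    exact O.pathγ_congr p hp (.refl _) fun l => (HHomotopic.refl_trans (c l)).symm
  have right : HHomotopic
      (O.pathγ q hN f fun i => (η.linear _ (hq i)).trans
        (O.pathγ _ (hq i) (g i) fun j => c (blockIndex m hm ⟨i, j⟩)))
      ((O.pathγ q hN (.refl (η.pt k)) fun i => η.linear _ (hq i)).trans
        (O.pathγ q hN f fun i => O.pathγ _ (hq i) (g i) fun j => c (blockIndex m hm ⟨i, j⟩))) := by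
    rw [← O.pathγ_trans]
    exact O.pathγ_congr q hN (HHomotopic.refl_trans f).symm fun _ => .refl _
  have pointwise : HHomotopic (O.pathγ p hp (O.pathγ m hm f g) c)
      (O.pathγ q hN f fun i => O.pathγ _ (hq i) (g i) fun j => c (blockIndex m hm ⟨i, j⟩)) :=
    .of_eq fun t => O.assoc m hm p hp q hq hN (f t) (fun i => g i t) fun l => c l t
  exact (HHomotopic.hcomp (.refl _) left).trans <| (HHomotopic.assoc _ _ _).symm.trans <|
    (HHomotopic.hcomp (η.linear_assoc m hm p hp q hq hN) pointwise).trans <|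
      (HHomotopic.assoc _ _ _).trans <| .hcomp (.refl _) right.symm

/-- The operad of classes of paths which begin at the basepoints, i.e. of points of the universal
coverings. -/
noncomputable def pathOperad : OperadStr fun n => PathClass (η.pt n) where
  zero_point :=
    have ⟨_⟩ := O.zero_point
    ⟨⟨⟨mk (.refl _)⟩, fun u => by
      obtain ⟨y, f, rfl⟩ := u.mk_surjective
      exact mk_eq_mk.2 (.of_eq fun _ => Subsingleton.elim _ _)⟩⟩
  one := mk (.refl _)
  γ := η.pathClassγ
  one_γ h u := by
    obtain ⟨y, f, rfl⟩ := u.mk_surjective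
    have pointwise : HHomotopic (O.pathγ _ h (.refl (η.pt 1)) fun _ => f) f :=
      .of_eq fun t => (congrArg (O.γ _ h · _) η.map_one).trans (O.one_γ h (f t))
    rw [pathClassγ_mk, mk_eq_mk]
    exact (HHomotopic.hcomp (η.linear_one_left h) pointwise).trans (.refl_trans f)
  γ_one h u := by
    obtain ⟨y, f, rfl⟩ := u.mk_surjective
    have pointwise : HHomotopic (O.pathγ _ h f fun _ => .refl (η.pt 1)) f :=
      .of_eq fun t => (congrArg (O.γ _ h _) (funext fun _ => η.map_one)).trans (O.γ_one h (f t))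
    refine (η.pathClassγ_mk _ h f fun _ => .refl (η.pt 1)).trans (mk_eq_mk.2 ?_)
    exact (HHomotopic.hcomp (η.linear_one_right h) pointwise).trans (.refl_trans f)
  assoc := η.pathClassγ_assoc

theorem pathOperad_γ_mk {k n : ℕ} (m : Fin k → ℕ) (h : ∑ i, m i = n) {x : D k} {y : ∀ i, D (m i)}
    (f : Path (η.pt k) x) (g : ∀ i, Path (η.pt (m i)) (y i)) :
    η.pathOperad.γ m h (mk f) (fun i => mk (g i)) =
      mk ((η.linear m h).trans (O.pathγ m h f g)) :=
  η.pathClassγ_mk m h f g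

theorem endpoint_pathOperad_γ {k n : ℕ} (m : Fin k → ℕ) (h : ∑ i, m i = n)
    (u : PathClass (η.pt k)) (v : ∀ i, PathClass (η.pt (m i))) :
    (η.pathOperad.γ m h u v).endpoint = O.γ m h u.endpoint fun i => (v i).endpoint :=
  rfl

/-! ## The loop operad -/

/-- The composition of loops at the basepoints: the pointwise composition, moved back to the
basepoint along the linear path. -/
noncomputable def loopγ {k n : ℕ} (m : Fin k → ℕ) (h : ∑ i, m i = n)
    (a : LoopGroup (D k) (η.pt k)) (b : ∀ i, LoopGroup (D (m i)) (η.pt (m i))) :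
    LoopGroup (D n) (η.pt n) :=
  .mk (((η.linear m h).trans (O.pathγ m h (Function.surjInv LoopGroup.mk_surjective a)
    fun i => Function.surjInv LoopGroup.mk_surjective (b i))).trans (η.linear m h).symm)

theorem loopγ_mk {k n : ℕ} (m : Fin k → ℕ) (h : ∑ i, m i = n) (f : Path (η.pt k) (η.pt k))
    (g : ∀ i, Path (η.pt (m i)) (η.pt (m i))) :
    η.loopγ m h (.mk f) (fun i => .mk (g i)) =
      .mk (((η.linear m h).trans (O.pathγ m h f g)).trans (η.linear m h).symm) :=
  LoopGroup.mk_eq_mk.2 <| .hcomp (.hcomp (.refl _) <| O.pathγ_congr m h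
    (LoopGroup.mk_eq_mk.1 (Function.surjInv_eq _ _)) fun _ =>
      LoopGroup.mk_eq_mk.1 (Function.surjInv_eq _ _)) (.refl _)

theorem pathOperad_γ_smul {k n : ℕ} (m : Fin k → ℕ) (h : ∑ i, m i = n)
    (a : LoopGroup (D k) (η.pt k)) (b : ∀ i, LoopGroup (D (m i)) (η.pt (m i)))
    (u : PathClass (η.pt k)) (v : ∀ i, PathClass (η.pt (m i))) :
    η.pathOperad.γ m h (a • u) (fun i => b i • v i) = η.loopγ m h a b • η.pathOperad.γ m h u v := by
  obtain ⟨f, rfl⟩ := LoopGroup.mk_surjective a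
  obtain ⟨g, rfl⟩ := LoopGroup.exists_mk_family b
  obtain ⟨x, f', rfl⟩ := u.mk_surjective
  obtain ⟨y, g', rfl⟩ := exists_mk_family v
  simp only [mk_smul_mk, pathOperad_γ_mk, loopγ_mk]
  rw [mk_eq_mk, O.pathγ_trans]
  exact (HHomotopic.assoc _ _ _).symm.trans (HHomotopic.trans_symm_trans _ _ _).symm

/-- The non-crossed group operad of the fundamental groups at the basepoints. -/
noncomputable def loopOperad : GroupOperad fun n => LoopGroup (D n) (η.pt n) :=
  .ofFreeAction η.pathOperad (fun _ => 1) η.loopγ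
    (fun m h _ _ => congrArg MulOpposite.op (blockPerm_one m h).symm)
    fun m h a b _ => η.pathOperad_γ_smul m h a b

theorem isLoopOperad_loopOperad : η.IsLoopOperad η.loopOperad :=
  η.loopγ_mk

theorem nonCrossed_loopOperad : η.loopOperad.NonCrossed :=
  fun _ _ => rfl

theorem isOperadAction_loopOperad : IsOperadAction η.loopOperad η.pathOperad :=
  η.pathOperad_γ_smul

end GoodBasepoint

/-! ## Fundamental groups of quotients by covering actions -/

section Map

variable {X : Type u} [TopologicalSpace X] {Y : Type v} [TopologicalSpace Y] {x : X} {φ : C(X, Y)}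

/-- The homomorphism of fundamental groups induced by a continuous map. -/
noncomputable def LoopGroup.map (φ : C(X, Y)) (x : X) : LoopGroup X x →* LoopGroup Y (φ x) :=
  MonoidHom.op (FundamentalGroup.map φ x)

namespace PathClass

theorem map_smul (a : LoopGroup X x) (u : PathClass x) :
    map φ (a • u) = LoopGroup.map φ x a • map φ u := by
  obtain ⟨f, rfl⟩ := LoopGroup.mk_surjective a
  obtain ⟨y, g, rfl⟩ := u.mk_surjective
  rw [mk_smul_mk, map_mk, map_mk, Path.map_trans]
  exact (mk_smul_mk _ _).symm

theorem map_bijective (hφ : IsCoveringMap φ) :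
    Function.Bijective (map φ : PathClass x → PathClass (φ x)) := by
  constructor
  · intro u v huv
    obtain ⟨y, f, rfl⟩ := u.mk_surjective
    obtain ⟨z, g, rfl⟩ := v.mk_surjective
    exact mk_eq_mk.2 ((hφ.homotopicRel_iff_comp
      ⟨0, by simp, f.source.trans g.source.symm⟩).2 (mk_eq_mk.1 huv))
  · intro w
    obtain ⟨y, g, rfl⟩ := w.mk_surjective
    obtain ⟨f, hf, f_zero⟩ := hφ.exists_path_lifts g.toContinuousMap x g.source
    exact ⟨mk ⟨f, f_zero, rfl⟩, mk_eq_mk.2 (.of_eq fun t => congrFun hf t)⟩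

/-- The end point of the lift to a covering of a class of paths. -/
noncomputable def liftEndpoint (hφ : IsCoveringMap φ) (w : PathClass (φ x)) : X :=
  (Function.surjInv (map_bijective hφ).2 w).endpoint

theorem liftEndpoint_map (hφ : IsCoveringMap φ) (u : PathClass x) :
    liftEndpoint hφ (map φ u) = u.endpoint :=
  congrArg endpoint ((map_bijective hφ).1 (Function.surjInv_eq _ _))

end PathClass

theorem LoopGroup.map_injective (hφ : IsCoveringMap φ) :
    Function.Injective (LoopGroup.map φ x) := fun a b hab =>
  IsCancelSMul.right_cancel a b (PathClass.mk (.refl x)) <| (PathClass.map_bijective hφ).1 <| by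
    rw [PathClass.map_smul, PathClass.map_smul, hab]

end Map

namespace GoodBasepoint

open PathClass

variable {D : ℕ → Type u} [∀ n, TopologicalSpace (D n)] {O : TopOperadStr D} (η : GoodBasepoint O)
  {Q : ℕ → Type u} [∀ n, TopologicalSpace (Q n)] (p : ∀ n, C(D n, Q n))

theorem map_pathOperad_γ_congr (hcov : ∀ n, IsCoveringMap (p n)) {k n : ℕ} (m : Fin k → ℕ)
    (h : ∑ i, m i = n) {u u' : PathClass (η.pt k)} {v v' : ∀ i, PathClass (η.pt (m i))}
    (hu : map (p k) u = map (p k) u') (hv : ∀ i, map (p (m i)) (v i) = map (p (m i)) (v' i)) :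
    map (p n) (η.pathOperad.γ m h u v) = map (p n) (η.pathOperad.γ m h u' v') := by
  obtain rfl := (map_bijective (hcov k)).1 hu
  obtain rfl : v = v' := funext fun i => (map_bijective (hcov (m i))).1 (hv i)
  rfl

/-- The operad of classes of paths in the base spaces of coverings which begin at the images of the
basepoints. -/
noncomputable def quotientPathOperad (hcov : ∀ n, IsCoveringMap (p n)) :
    OperadStr fun n => PathClass (p n (η.pt n)) :=
  .ofSurjective (O := η.pathOperad) (fun n => map (p n)) (fun n => (map_bijective (hcov n)).2)
    (η.map_pathOperad_γ_congr p hcov)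

theorem quotientPathOperad_γ_map (hcov : ∀ n, IsCoveringMap (p n)) {k n : ℕ} (m : Fin k → ℕ)
    (h : ∑ i, m i = n) (u : PathClass (η.pt k)) (v : ∀ i, PathClass (η.pt (m i))) :
    (η.quotientPathOperad p hcov).γ m h (map (p k) u) (fun i => map (p (m i)) (v i)) =
      map (p n) (η.pathOperad.γ m h u v) :=
  OperadStr.ofSurjective_γ _ _ (η.map_pathOperad_γ_congr p hcov) m h u v

theorem exists_map_family (hcov : ∀ n, IsCoveringMap (p n)) {k : ℕ} {m : Fin k → ℕ}
    (w : ∀ i, PathClass (p (m i) (η.pt (m i)))) :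
    ∃ v : ∀ i, PathClass (η.pt (m i)), (fun i => map (p (m i)) (v i)) = w :=
  ⟨fun i => Function.surjInv (map_bijective (hcov (m i))).2 (w i),
    funext fun _ => Function.surjInv_eq _ _⟩

theorem liftEndpoint_quotientPathOperad_γ (hcov : ∀ n, IsCoveringMap (p n)) {k n : ℕ}
    (m : Fin k → ℕ) (h : ∑ i, m i = n) (w : PathClass (p k (η.pt k)))
    (z : ∀ i, PathClass (p (m i) (η.pt (m i)))) :
    liftEndpoint (hcov n) ((η.quotientPathOperad p hcov).γ m h w z) =
      O.γ m h (liftEndpoint (hcov k) w) fun i => liftEndpoint (hcov (m i)) (z i) := by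
  obtain ⟨u, rfl⟩ := (map_bijective (hcov k)).2 w
  obtain ⟨v, rfl⟩ := η.exists_map_family p hcov z
  simp only [quotientPathOperad_γ_map, liftEndpoint_map, endpoint_pathOperad_γ]

variable {K : ℕ → Type v} [∀ n, Group (K n)] {P : GroupOperad K} [∀ n, MulAction (K n) (D n)]
  (hp : ∀ (n : ℕ) (σ : K n) (x : D n), p n (σ • x) = p n x)
  (hq : ∀ n, IsQuotientCoveringMap (p n) (K n))

include hq in
theorem exists_liftClass {n : ℕ} (a : LoopGroup (Q n) (p n (η.pt n))) :
    ∃ (σ : K n) (f : Path (η.pt n) (σ • η.pt n)), η.liftClass p hp σ f = a := by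
  obtain ⟨f, rfl⟩ := LoopGroup.mk_surjective a
  obtain ⟨u, hu⟩ := (map_bijective (hq n).isCoveringMap).2 (mk f)
  obtain ⟨x, f', rfl⟩ := u.mk_surjective
  have hf' : HHomotopic (f'.map (p n).continuous) f := mk_eq_mk.1 hu
  obtain ⟨σ, rfl⟩ := (hq n).apply_eq_iff_mem_orbit.1 hf'.target_eq
  exact ⟨σ, f', LoopGroup.mk_eq_mk.2 hf'⟩

variable [∀ n, ContinuousConstSMul (K n) (D n)]

theorem liftClass_smul_map_mk {n : ℕ} (σ : K n) (f : Path (η.pt n) (σ • η.pt n)) {x : D n}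
    (g : Path (η.pt n) x) :
    η.liftClass p hp σ f • map (p n) (mk g) =
      map (p n) (mk (f.trans (g.map (continuous_const_smul σ)))) := by
  refine (mk_smul_mk _ _).trans (mk_eq_mk.2 (.of_eq fun t => ?_))
  simp only [Path.trans_apply, Path.map_coe, Function.comp_apply]
  split_ifs
  · rfl
  · exact (hp n σ _).symm

include hp in
theorem exists_liftEndpoint_smul {n : ℕ} (a : LoopGroup (Q n) (p n (η.pt n))) :
    ∃ σ : K n, ∀ w : PathClass (p n (η.pt n)), liftEndpoint (hq n).isCoveringMap (a • w) =
      σ • liftEndpoint (hq n).isCoveringMap w := by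
  obtain ⟨σ, f, rfl⟩ := η.exists_liftClass p hp hq a
  refine ⟨σ, (map_bijective (hq n).isCoveringMap).2.forall.2 fun u => ?_⟩
  obtain ⟨x, g, rfl⟩ := u.mk_surjective
  rw [liftClass_smul_map_mk, liftEndpoint_map, liftEndpoint_map, endpoint_mk, endpoint_mk]

/-- The homomorphism which sends a loop to the deck transformation which relates the two end points
of its lift. -/
noncomputable def degree (n : ℕ) : LoopGroup (Q n) (p n (η.pt n)) →* K n :=
  .mk' (fun a => (η.exists_liftEndpoint_smul p hp hq a).choose) fun a b => by
    have := (hq n).isCancelSMul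
    apply IsCancelSMul.right_cancel _ _ (liftEndpoint (hq n).isCoveringMap (Classical.arbitrary _))
    rw [mul_smul, ← (η.exists_liftEndpoint_smul p hp hq (a * b)).choose_spec,
      ← (η.exists_liftEndpoint_smul p hp hq b).choose_spec,
      ← (η.exists_liftEndpoint_smul p hp hq a).choose_spec, mul_smul]

theorem liftEndpoint_smul {n : ℕ} (a : LoopGroup (Q n) (p n (η.pt n)))
    (w : PathClass (p n (η.pt n))) :
    liftEndpoint (hq n).isCoveringMap (a • w) =
      η.degree p hp hq n a • liftEndpoint (hq n).isCoveringMap w :=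
  (η.exists_liftEndpoint_smul p hp hq a).choose_spec w

theorem degree_liftClass {n : ℕ} (σ : K n) (f : Path (η.pt n) (σ • η.pt n)) :
    η.degree p hp hq n (η.liftClass p hp σ f) = σ := by
  have := (hq n).isCancelSMul
  have h := η.liftEndpoint_smul p hp hq (η.liftClass p hp σ f) (map (p n) (mk (.refl _)))
  rw [liftClass_smul_map_mk, liftEndpoint_map, liftEndpoint_map, endpoint_mk, endpoint_mk] at h
  exact (IsCancelSMul.right_cancel _ _ _ h).symm

theorem exists_liftClass_degree {n : ℕ} (a : LoopGroup (Q n) (p n (η.pt n))) :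
    ∃ f, η.liftClass p hp (η.degree p hp hq n a) f = a := by
  obtain ⟨σ, f, rfl⟩ := η.exists_liftClass p hp hq a
  rw [degree_liftClass]
  exact ⟨f, rfl⟩

variable (hact : IsOperadAction P O.toOperadStr)

theorem quotientPathOperad_γ_liftClass_smul {k n : ℕ} (m : Fin k → ℕ) (h : ∑ i, m i = n) (σ : K k)
    (τ : ∀ i, K (m i)) (f : Path (η.pt k) (σ • η.pt k))
    (g : ∀ i, Path (η.pt (m i)) (τ i • η.pt (m i))) (w : PathClass (p k (η.pt k)))
    (z : ∀ i, PathClass (p (m i) (η.pt (m i)))) :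
    (η.quotientPathOperad p fun n => (hq n).isCoveringMap).γ m h (η.liftClass p hp σ f • w)
        (fun i => η.liftClass p hp (τ i) (g i) • z i) =
      η.liftClass p hp (P.γ m h σ τ) (η.liftγ hact m h σ τ f g) •
        (η.quotientPathOperad p fun n => (hq n).isCoveringMap).γ
          (fun i => m ((P.perm σ).symm i)) (P.sum_perm h σ) w
          (fun i => z ((P.perm σ).symm i)) := by
  obtain ⟨u, rfl⟩ := (map_bijective (hq k).isCoveringMap).2 w
  obtain ⟨v, rfl⟩ := η.exists_map_family p (fun n => (hq n).isCoveringMap) z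
  obtain ⟨x, f', rfl⟩ := u.mk_surjective
  obtain ⟨y, g', rfl⟩ := PathClass.exists_mk_family v
  simp only [liftClass_smul_map_mk, quotientPathOperad_γ_map, pathOperad_γ_mk]
  refine congrArg _ (mk_eq_mk.2 ?_)
  rw [O.pathγ_trans, Path.map_trans]
  have middle : HHomotopic
      (O.pathγ m h (f'.map (continuous_const_smul σ)) fun i =>
        (g' i).map (continuous_const_smul (τ i)))
      ((O.pathγ (fun i => m ((P.perm σ).symm i)) (P.sum_perm h σ) f' fun i =>
        g' ((P.perm σ).symm i)).map (continuous_const_smul (P.γ m h σ τ))) :=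
    .of_eq fun t => hact m h σ τ (f' t) fun i => g' i t
  have hcast : HHomotopic (O.pathγ m h f g) ((O.pathγ m h f g).cast rfl
      (hact m h σ τ (η.pt k) (fun i => η.pt (m i))).symm) :=
    .refl _
  exact (HHomotopic.assoc _ _ _).symm.trans <|
    (HHomotopic.hcomp (.hcomp (.refl _) hcast) middle).trans
      (HHomotopic.trans_symm_trans _ _ _).symm

/-- The composition of loops in the base spaces of coverings: the composition of lifts to paths. -/
noncomputable def quotientLoopγ {k n : ℕ} (m : Fin k → ℕ) (h : ∑ i, m i = n)
    (a : LoopGroup (Q k) (p k (η.pt k))) (b : ∀ i, LoopGroup (Q (m i)) (p (m i) (η.pt (m i)))) :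
    LoopGroup (Q n) (p n (η.pt n)) :=
  η.liftClass p hp _ (η.liftγ hact m h _ _ (η.exists_liftClass_degree p hp hq a).choose
    fun i => (η.exists_liftClass_degree p hp hq (b i)).choose)

theorem degree_quotientLoopγ {k n : ℕ} (m : Fin k → ℕ) (h : ∑ i, m i = n)
    (a : LoopGroup (Q k) (p k (η.pt k))) (b : ∀ i, LoopGroup (Q (m i)) (p (m i) (η.pt (m i)))) :
    η.degree p hp hq n (η.quotientLoopγ p hp hq hact m h a b) =
      P.γ m h (η.degree p hp hq k a) fun i => η.degree p hp hq (m i) (b i) :=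
  η.degree_liftClass p hp hq _ _

theorem quotientPathOperad_γ_smul {k n : ℕ} (m : Fin k → ℕ) (h : ∑ i, m i = n)
    (a : LoopGroup (Q k) (p k (η.pt k))) (b : ∀ i, LoopGroup (Q (m i)) (p (m i) (η.pt (m i))))
    (w : PathClass (p k (η.pt k))) (z : ∀ i, PathClass (p (m i) (η.pt (m i)))) :
    (η.quotientPathOperad p fun n => (hq n).isCoveringMap).γ m h (a • w) (fun i => b i • z i) =
      η.quotientLoopγ p hp hq hact m h a b •
        (η.quotientPathOperad p fun n => (hq n).isCoveringMap).γ
          (fun i => m ((P.perm (η.degree p hp hq k a)).symm i)) (P.sum_perm h _) w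
          (fun i => z ((P.perm (η.degree p hp hq k a)).symm i)) := by
  have hγ := η.quotientPathOperad_γ_liftClass_smul p hp hq hact m h _ _
    (η.exists_liftClass_degree p hp hq a).choose
    (fun i => (η.exists_liftClass_degree p hp hq (b i)).choose) w z
  rw [(η.exists_liftClass_degree p hp hq a).choose_spec] at hγ
  simp only [(η.exists_liftClass_degree p hp hq (b _)).choose_spec] at hγ
  exact hγ

/-- The group operad of the fundamental groups of the quotients of a topological operad by covering
actions of a group operad. -/
noncomputable def quotientLoopOperad : GroupOperad fun n => LoopGroup (Q n) (p n (η.pt n)) :=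
  .ofFreeAction (η.quotientPathOperad p fun n => (hq n).isCoveringMap)
    (fun n => (P.π n).comp (η.degree p hp hq n)) (η.quotientLoopγ p hp hq hact)
    (fun m h a b => (congrArg (P.π _) (η.degree_quotientLoopγ p hp hq hact m h a b)).trans
      (P.π_γ m h _ _))
    fun m h a b _ => η.quotientPathOperad_γ_smul p hp hq hact m h a b

theorem isOperadAction_quotientLoopOperad :
    IsOperadAction (η.quotientLoopOperad p hp hq hact)
      (η.quotientPathOperad p fun n => (hq n).isCoveringMap) :=
  η.quotientPathOperad_γ_smul p hp hq hact

theorem nonCrossed_quotientLoopOperad (hP : P.NonCrossed) :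
    (η.quotientLoopOperad p hp hq hact).NonCrossed :=
  fun n _ => hP n _

theorem isQuotientLoopOperad_quotientLoopOperad :
    η.IsQuotientLoopOperad hact p hp (η.quotientLoopOperad p hp hq hact) := by
  intro k n m h σ τ f g
  let e n : PathClass (p n (η.pt n)) := Classical.arbitrary _
  have hperm : P.perm σ = (η.quotientLoopOperad p hp hq hact).perm (η.liftClass p hp σ f) :=
    congrArg P.perm (η.degree_liftClass p hp hq σ f).symm
  refine IsOperadAction.γ_eq_of_smul_eq (η.isOperadAction_quotientLoopOperad p hp hq hact)
    ((η.quotientPathOperad_γ_liftClass_smul p hp hq hact m h σ τ f g (e k)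
      fun i => e (m i)).trans (congrArg _ ?_))
  exact OperadStr.γ_perm_congr (C := fun n => PathClass (p n (η.pt n))) _ m hperm _ _ (e k) fun i =>
    e (m i)

end GoodBasepoint

/-! ## The exact sequence -/

namespace GoodBasepoint

open PathClass

variable {D : ℕ → Type u} [∀ n, TopologicalSpace (D n)] {O : TopOperadStr D} (η : GoodBasepoint O)
  {Q : ℕ → Type u} [∀ n, TopologicalSpace (Q n)] (p : ∀ n, C(D n, Q n))
  {K : ℕ → Type v} [∀ n, Group (K n)] {P : GroupOperad K} [∀ n, MulAction (K n) (D n)]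
  [∀ n, ContinuousConstSMul (K n) (D n)]
  (hp : ∀ (n : ℕ) (σ : K n) (x : D n), p n (σ • x) = p n x)
  (hq : ∀ n, IsQuotientCoveringMap (p n) (K n)) (hact : IsOperadAction P O.toOperadStr)

/-- The morphism of group operads given by the degrees. -/
noncomputable def degreeHom : GroupOperadHom (η.quotientLoopOperad p hp hq hact) P :=
  have (n : ℕ) := (hq n).isCancelSMul
  .ofEquivariant (η.isOperadAction_quotientLoopOperad p hp hq hact) hact (η.degree p hp hq)
    (fun _ _ => rfl) (fun n => liftEndpoint (hq n).isCoveringMap)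
    (η.liftEndpoint_quotientPathOperad_γ p fun n => (hq n).isCoveringMap)
    fun _ => η.liftEndpoint_smul p hp hq

theorem degree_map {n : ℕ} (a : LoopGroup (D n) (η.pt n)) :
    η.degree p hp hq n (LoopGroup.map (p n) (η.pt n) a) = 1 := by
  obtain ⟨f, rfl⟩ := LoopGroup.mk_surjective a
  exact η.degree_liftClass p hp hq 1 (f.cast rfl (one_smul _ _))

/-- The morphism of group operads induced by the projections to the quotients. -/
noncomputable def projHom : GroupOperadHom η.loopOperad (η.quotientLoopOperad p hp hq hact) :=
  .ofEquivariant η.isOperadAction_loopOperad (η.isOperadAction_quotientLoopOperad p hp hq hact)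
    (fun n => LoopGroup.map (p n) (η.pt n))
    (fun n a => (congrArg (P.π n) (η.degree_map p hp hq a)).trans (map_one _))
    (fun n => map (p n))
    (fun m h u v => (η.quotientPathOperad_γ_map p (fun n => (hq n).isCoveringMap) m h u v).symm)
    fun _ => map_smul

theorem range_map_eq_ker_degree (n : ℕ) :
    (LoopGroup.map (p n) (η.pt n)).range = (η.degree p hp hq n).ker := by
  ext a
  constructor
  · rintro ⟨b, rfl⟩
    exact η.degree_map p hp hq b
  · intro ha
    obtain ⟨σ, f, rfl⟩ := η.exists_liftClass p hp hq a
    obtain rfl : σ = 1 := (η.degree_liftClass p hp hq σ f).symm.trans ha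
    exact ⟨.mk (f.cast rfl (one_smul _ _).symm), rfl⟩

theorem degree_surjective (n : ℕ) [PathConnectedSpace (D n)] :
    Function.Surjective (η.degree p hp hq n) := fun σ =>
  ⟨_, η.degree_liftClass p hp hq σ (PathConnectedSpace.somePath _ _)⟩

theorem exact_projHom_degreeHom (n : ℕ) [PathConnectedSpace (D n)] :
    Function.Injective ((η.projHom p hp hq hact).toHom n) ∧
      ((η.projHom p hp hq hact).toHom n).range = ((η.degreeHom p hp hq hact).toHom n).ker ∧
      Function.Surjective ((η.degreeHom p hp hq hact).toHom n) :=
  ⟨LoopGroup.map_injective (hq n).isCoveringMap, η.range_map_eq_ker_degree p hp hq n,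
    η.degree_surjective p hp hq n⟩

variable {Q' : ℕ → Type u} [∀ n, TopologicalSpace (Q' n)] (φ : ∀ n, C(Q n, Q' n))
  (hp' : ∀ (n : ℕ) (σ : K n) (x : D n), (φ n).comp (p n) (σ • x) = (φ n).comp (p n) x)
  (hq' : ∀ n, IsQuotientCoveringMap ((φ n).comp (p n)) (K n))

theorem degree_map_quotient {n : ℕ} (a : LoopGroup (Q n) (p n (η.pt n))) :
    η.degree (fun n => (φ n).comp (p n)) hp' hq' n (LoopGroup.map (φ n) (p n (η.pt n)) a) =
      η.degree p hp hq n a := by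
  obtain ⟨σ, f, rfl⟩ := η.exists_liftClass p hp hq a
  exact (η.degree_liftClass _ hp' hq' σ f).trans (η.degree_liftClass p hp hq σ f).symm

theorem map_quotientPathOperad_γ (hcov : ∀ n, IsCoveringMap (p n))
    (hcov' : ∀ n, IsCoveringMap ((φ n).comp (p n))) {k n : ℕ} (m : Fin k → ℕ) (h : ∑ i, m i = n)
    (w : PathClass (p k (η.pt k))) (z : ∀ i, PathClass (p (m i) (η.pt (m i)))) :
    map (φ n) ((η.quotientPathOperad p hcov).γ m h w z) =
      (η.quotientPathOperad (fun n => (φ n).comp (p n)) hcov').γ m h (map (φ k) w)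
        fun i => map (φ (m i)) (z i) := by
  have map_map (n : ℕ) (u : PathClass (η.pt n)) :
      map (φ n) (map (p n) u) = map ((φ n).comp (p n)) u := by
    obtain ⟨x, f, rfl⟩ := u.mk_surjective
    rfl
  obtain ⟨u, rfl⟩ := (map_bijective (hcov k)).2 w
  obtain ⟨v, rfl⟩ := η.exists_map_family p hcov z
  simp only [quotientPathOperad_γ_map, map_map]

/-- The morphism of group operads induced by maps between two systems of quotients. -/
noncomputable def quotientMapHom :
    GroupOperadHom (η.quotientLoopOperad p hp hq hact)
      (η.quotientLoopOperad (fun n => (φ n).comp (p n)) hp' hq' hact) :=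
  .ofEquivariant (η.isOperadAction_quotientLoopOperad p hp hq hact)
    (η.isOperadAction_quotientLoopOperad _ hp' hq' hact)
    (fun n => LoopGroup.map (φ n) (p n (η.pt n)))
    (fun n a => congrArg (P.π n) (η.degree_map_quotient p hp hq φ hp' hq' a))
    (fun n => map (φ n)) (η.map_quotientPathOperad_γ p φ _ _) fun _ => map_smul

include hp hq hp' hq' in
theorem map_quotient_bijective (n : ℕ) :
    Function.Bijective (LoopGroup.map (φ n) (p n (η.pt n))) := by
  constructor
  · refine (injective_iff_map_eq_one _).2 fun a ha => ?_
    have ha_ker : a ∈ (η.degree p hp hq n).ker :=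
      (η.degree_map_quotient p hp hq φ hp' hq' a).symm.trans
        ((congrArg _ ha).trans (map_one _))
    obtain ⟨b, rfl⟩ := (η.range_map_eq_ker_degree p hp hq n).ge ha_ker
    obtain ⟨f, rfl⟩ := LoopGroup.mk_surjective b
    have hb : LoopGroup.mk f = 1 :=
      LoopGroup.map_injective (hq' n).isCoveringMap (ha.trans (map_one _).symm)
    rw [hb, map_one]
  · intro a
    obtain ⟨σ, f, rfl⟩ := η.exists_liftClass _ hp' hq' a
    exact ⟨η.liftClass p hp σ f, rfl⟩

end GoodBasepoint

/-! ## Quotients by covering actions -/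

namespace OrbitSpace

variable {G : Type v} [Group G] {X : Type u} [MulAction G X] [TopologicalSpace X]

theorem isQuotientCoveringMap_mk [ContinuousConstSMul G X] (h : IsCoveringAction G X) :
    IsQuotientCoveringMap (OrbitSpace.mk G (X := X)) G where
  toIsQuotientMap := isOpenQuotientMap_mk.isQuotientMap
  continuous_const_smul := continuous_const_smul
  apply_eq_iff_mem_orbit := mk_eq_mk
  disjoint := h

theorem isHomeomorph_iterated [ContinuousConstSMul G X] (N : Subgroup G) [N.Normal] :
    IsHomeomorph (OrbitSpace.iterated N (X := X)) where
  continuous := (OrbitSpace.iterated N).continuous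
  isOpenMap := by
    have h : IsOpenMap (OrbitSpace.iterated N (X := X) ∘ OrbitSpace.mk (G ⧸ N) ∘ OrbitSpace.mk N) :=
      (OrbitSpace.isOpenQuotientMap_mk (G := G) (X := X)).isOpenMap
    exact IsOpenMap.of_comp (continuous_mk.comp continuous_mk)
      (mk_surjective.comp mk_surjective) h
  bijective := by
    constructor
    · intro x y h
      obtain ⟨x, rfl⟩ := mk_surjective x
      obtain ⟨x, rfl⟩ := mk_surjective x
      obtain ⟨y, rfl⟩ := mk_surjective y
      obtain ⟨y, rfl⟩ := mk_surjective y
      obtain ⟨g, rfl⟩ := mk_eq_mk.1 (h : OrbitSpace.mk G x = OrbitSpace.mk G y)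
      exact mk_eq_mk.2 ⟨QuotientGroup.mk g, rfl⟩
    · intro x
      obtain ⟨x, rfl⟩ := mk_surjective x
      exact ⟨OrbitSpace.mk _ (OrbitSpace.mk N x), rfl⟩

theorem isQuotientCoveringMap_proj [ContinuousConstSMul G X] (N : Subgroup G) [N.Normal]
    (h : IsCoveringAction (G ⧸ N) (OrbitSpace N X)) :
    IsQuotientCoveringMap (OrbitSpace.proj N (X := X)) (G ⧸ N) :=
  (isQuotientCoveringMap_mk h).homeomorph_comp ((isHomeomorph_iterated N).homeomorph _)

end OrbitSpace

/-! ## The action of a non-crossed group operad on itself by conjugation -/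

/-- The action of a group on itself by conjugation. -/
abbrev conjAction (G : Type u) [Group G] : MulAction G G :=
  .compHom G (MulAut.conj : G →* MulAut G)

namespace GroupOperad

variable {G : ℕ → Type v} [∀ n, Group (G n)] {P : GroupOperad G}

theorem NonCrossed.γ_perm (hP : P.NonCrossed) {k n : ℕ} (m : Fin k → ℕ) (h : ∑ i, m i = n)
    (σ a : G k) (b : ∀ i, G (m i)) :
    P.γ (fun i => m ((P.perm σ).symm i)) (P.sum_perm h σ) a (fun i => b ((P.perm σ).symm i)) =
      P.γ m h a b :=
  P.γ_perm_congr m (congrArg MulOpposite.unop (hP k σ)) (P.sum_perm h σ) h a b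

theorem NonCrossed.γ_mul (hP : P.NonCrossed) {k n : ℕ} (m : Fin k → ℕ) (h : ∑ i, m i = n)
    (a a' : G k) (b b' : ∀ i, G (m i)) :
    P.γ m h (a * a') (fun i => b i * b' i) = P.γ m h a b * P.γ m h a' b' :=
  (P.crossed m h a a' b b' (P.sum_perm h a)).trans
    (congrArg (P.γ m h a b * ·) (hP.γ_perm m h a a' b'))

theorem NonCrossed.quotient (hP : P.NonCrossed) (H : SubGroupOperad P)
    [∀ n, (H.carrier n).Normal] (hH : H.NonCrossed) : (H.quotient hH).NonCrossed :=
  fun n => QuotientGroup.mk_surjective.forall.2 (hP n)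

theorem NonCrossed.isOperadAction_conjAction (hP : P.NonCrossed) :
    IsOperadAction P P.toOperadStr (act := fun n => conjAction (G n)) := by
  intro k n m h σ τ a b
  rw [hP.γ_perm m h]
  refine eq_mul_inv_of_mul_eq ?_
  rw [← hP.γ_mul, ← hP.γ_mul]
  exact congrArg₂ (P.γ m h) (inv_mul_cancel_right _ _) (funext fun i => inv_mul_cancel_right _ _)

end GroupOperad

/-! ## Change of the basepoint of maps of cubes -/

section Cube

variable {l : ℕ}

theorem cubeRadius_le_one (t : Fin l → unitInterval) : cubeRadius t ≤ 1 :=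
  (pi_norm_le_iff_of_nonneg zero_le_one).2 fun j =>
    abs_le.2 ⟨by linarith [(t j).2.1], by linarith [(t j).2.2]⟩

theorem cubeRadius_eq_one {t : Fin l → unitInterval} (ht : t ∈ Cube.boundary (Fin l)) :
    cubeRadius t = 1 := by
  obtain ⟨i, hi⟩ := ht
  refine (cubeRadius_le_one t).antisymm (le_trans ?_ (norm_le_pi_norm _ i))
  rcases hi with hi | hi <;> norm_num [hi]

/-- Dilation of the cube from its centre by the factor `c`, followed by the projection to the
cube. -/
noncomputable def cubeScale (c : ℝ) (t : Fin l → unitInterval) : Fin l → unitInterval :=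
  fun i => Set.projIcc 0 1 zero_le_one (c * ((t i : ℝ) - 1 / 2) + 1 / 2)

theorem cubeScale_one (t : Fin l → unitInterval) : cubeScale 1 t = t :=
  funext fun i => (congrArg (Set.projIcc (0 : ℝ) 1 zero_le_one) (by ring)).trans
    (Set.projIcc_val _ (t i))

theorem cubeScale_mem_boundary {c : ℝ} {t : Fin l → unitInterval} (h : c * cubeRadius t = 1) :
    cubeScale c t ∈ Cube.boundary (Fin l) := by
  have radius_ne_zero : cubeRadius t ≠ 0 := right_ne_zero_of_mul (h.trans_ne one_ne_zero)
  have : Nonempty (Fin l) := by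
    by_contra hempty
    rw [not_nonempty_iff] at hempty
    exact radius_ne_zero ((congrArg norm (Subsingleton.elim _ 0)).trans norm_zero)
  obtain ⟨i, hi⟩ := Finite.exists_max fun i => ‖2 * (t i : ℝ) - 1‖
  have radius_eq : cubeRadius t = |2 * (t i : ℝ) - 1| :=
    le_antisymm ((pi_norm_le_iff_of_nonempty _).2 hi)
      (norm_le_pi_norm (fun i => 2 * (t i : ℝ) - 1) i)
  rw [radius_eq] at h
  refine ⟨i, ?_⟩
  rcases abs_choice (2 * (t i : ℝ) - 1) with habs | habs <;> rw [habs] at h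
  · exact .inr (Set.projIcc_of_right_le _ (by linarith))
  · exact .inl (Set.projIcc_of_le_left _ (by linarith))

/-- A family of maps of cubes, each of which is `G`, rescaled, on a concentric subcube of radius
`1 / c`, and given by `H` on the radial segments outside this subcube. -/
noncomputable def cubeRing {A : Type u} {X : Type v} (c : A → ℝ)
    (G : A × (Fin l → unitInterval) → X) (H : A × ℝ → X) (z : A × (Fin l → unitInterval)) : X :=
  if c z.1 * cubeRadius z.2 ≤ 1 then G (z.1, cubeScale (c z.1) z.2)
  else H (z.1, 2 - c z.1 * cubeRadius z.2)

section CubeRing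

variable {A : Type u} {X : Type v} {c : A → ℝ} {G : A × (Fin l → unitInterval) → X} {H : A × ℝ → X}

theorem continuous_cubeRing [TopologicalSpace A] [TopologicalSpace X] (hc : Continuous c)
    (hG : Continuous G) (hH : Continuous H)
    (hGH : ∀ z, ∀ t ∈ Cube.boundary (Fin l), G (z, t) = H (z, 1)) :
    Continuous (cubeRing c G H) := by
  have continuous_radius : Continuous fun z : A × (Fin l → unitInterval) =>
      c z.1 * cubeRadius z.2 :=
    (hc.comp continuous_fst).mul ((continuous_cubeRadius l).comp continuous_snd)
  have continuous_scale : Continuous fun z : A × (Fin l → unitInterval) => cubeScale (c z.1) z.2 :=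
    continuous_pi fun i => continuous_projIcc.comp (by fun_prop)
  refine .if_le (hG.comp (continuous_fst.prodMk continuous_scale))
    (hH.comp (continuous_fst.prodMk (continuous_const.sub continuous_radius))) continuous_radius
    continuous_const fun z hz => ?_
  rw [hGH _ _ (cubeScale_mem_boundary hz), hz]
  norm_num

theorem cubeRing_of_eq_one {a : A} (ha : c a = 1) (t : Fin l → unitInterval) :
    cubeRing c G H (a, t) = G (a, t) := by
  simp only [cubeRing, ha, one_mul, cubeRadius_le_one, if_true, cubeScale_one]

theorem cubeRing_of_mem_boundary (hGH : ∀ z, ∀ t ∈ Cube.boundary (Fin l), G (z, t) = H (z, 1))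
    {a : A} (ha : 1 ≤ c a) {t : Fin l → unitInterval} (ht : t ∈ Cube.boundary (Fin l)) :
    cubeRing c G H (a, t) = H (a, 2 - c a) := by
  rcases ha.eq_or_lt with ha | ha
  · rw [cubeRing_of_eq_one ha.symm, hGH a t ht, ← ha]
    norm_num
  · simp only [cubeRing, cubeRadius_eq_one ht, mul_one, ha.not_ge, if_false]

variable [TopologicalSpace X] {x y : X}

theorem cubeRing_eq_cubeAlong {a : A} (ha : c a = 2) {f : Path x y} {g : GenLoop (Fin l) X y}
    (hG : ∀ t, G (a, t) = g t) (hH : ∀ r, H (a, r) = f.extend r) (t : Fin l → unitInterval) :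
    cubeRing c G H (a, t) = cubeAlong f g t := by
  change (if _ then _ else _) = if _ then _ else _
  have radius_le : 2 * cubeRadius t ≤ 1 ↔ cubeRadius t ≤ 1 / 2 := by
    constructor <;> intro h <;> linarith
  have scale_eq : cubeScale 2 t =
      fun i => Set.projIcc 0 1 zero_le_one (2 * (t i : ℝ) - 1 / 2) :=
    funext fun i => congrArg (Set.projIcc (0 : ℝ) 1 zero_le_one) (by ring)
  simp only [ha, hG, hH, radius_le, scale_eq]

end CubeRing

variable {X : Type u} [TopologicalSpace X] {Y : Type v} [TopologicalSpace Y]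

/-- A homotopy of maps of cubes during which the boundary moves along the path `a`. -/
def CubeHomotopicAlong {x y : X} (a : Path x y) (f g : C(Fin l → unitInterval, X)) : Prop :=
  ∃ F : f.Homotopy g, ∀ s, ∀ t ∈ Cube.boundary (Fin l), F (s, t) = a s

namespace CubeHomotopicAlong

variable {x y z : X} {a : Path x y} {f g k : C(Fin l → unitInterval, X)}

theorem refl (f : GenLoop (Fin l) X x) : CubeHomotopicAlong (Path.refl x) f.1 f.1 :=
  ⟨.refl f.1, fun _ t ht => f.2 t ht⟩

theorem trans {b : Path y z} (hfg : CubeHomotopicAlong a f g) (hgk : CubeHomotopicAlong b g k) :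
    CubeHomotopicAlong (a.trans b) f k := by
  obtain ⟨F, hF⟩ := hfg
  obtain ⟨F', hF'⟩ := hgk
  refine ⟨F.trans F', fun s t ht => ?_⟩
  rw [ContinuousMap.Homotopy.trans_apply, Path.trans_apply]
  split_ifs
  · exact hF _ t ht
  · exact hF' _ t ht

theorem map (hfg : CubeHomotopicAlong a f g) (φ : C(X, Y)) :
    CubeHomotopicAlong (a.map φ.continuous) (φ.comp f) (φ.comp g) :=
  let ⟨F, hF⟩ := hfg
  ⟨(ContinuousMap.Homotopy.refl φ).comp F, fun s t ht => congrArg φ (hF s t ht)⟩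

theorem cubeAlong (a : Path x y) (g : GenLoop (Fin l) X y) :
    CubeHomotopicAlong a (cubeAlong a g).1 g.1 := by
  let c (s : unitInterval) : ℝ := 2 - s
  let G (z : unitInterval × (Fin l → unitInterval)) : X := g z.2
  let H (z : unitInterval × ℝ) : X := a.extend z.2
  have agree (s : unitInterval) (t : Fin l → unitInterval) (ht : t ∈ Cube.boundary (Fin l)) :
      G (s, t) = H (s, 1) :=
    (g.2 t ht).trans a.extend_one.symm
  have start (t : Fin l → unitInterval) : cubeRing c G H (0, t) = _root_.cubeAlong a g t :=
    cubeRing_eq_cubeAlong (by simp [c]) (fun _ => rfl) (fun _ => rfl) t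
  have finish (t : Fin l → unitInterval) : cubeRing c G H (1, t) = g t :=
    cubeRing_of_eq_one (by norm_num [c]) t
  refine ⟨⟨⟨cubeRing c G H, continuous_cubeRing (by fun_prop) (g.1.continuous.comp continuous_snd)
    (a.continuous_extend.comp continuous_snd) agree⟩, start, finish⟩, fun s t ht => ?_⟩
  refine (cubeRing_of_mem_boundary agree (by linarith [s.2.2]) ht).trans ?_
  simp [H, c]

theorem homotopic_cubeAlong {f : GenLoop (Fin l) X x} {g : GenLoop (Fin l) X y}
    (h : CubeHomotopicAlong a f.1 g.1) : GenLoop.Homotopic f (_root_.cubeAlong a g) := by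
  obtain ⟨F, hF⟩ := h
  let c (s : unitInterval) : ℝ := 1 + s
  let H (z : unitInterval × ℝ) : X := a.extend (z.2 + z.1 - 1)
  have agree (s : unitInterval) (t : Fin l → unitInterval) (ht : t ∈ Cube.boundary (Fin l)) :
      F (s, t) = H (s, 1) := by
    simp [H, hF s t ht]
  have start (t : Fin l → unitInterval) : cubeRing c F H (0, t) = f t :=
    (cubeRing_of_eq_one (by simp [c]) t).trans (F.apply_zero t)
  have finish (t : Fin l → unitInterval) : cubeRing c F H (1, t) = _root_.cubeAlong a g t :=
    cubeRing_eq_cubeAlong (by norm_num [c]) F.apply_one (fun r => by simp [H]) t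
  refine ⟨⟨⟨⟨cubeRing c F H, continuous_cubeRing (by fun_prop) F.continuous
    (a.continuous_extend.comp (by fun_prop)) agree⟩, start, finish⟩, fun s t ht => ?_⟩⟩
  refine (cubeRing_of_mem_boundary agree (by linarith [s.2.1]) ht).trans
    (Eq.trans ?_ (f.2 t ht).symm)
  exact (congrArg a.extend (by ring)).trans a.extend_zero

end CubeHomotopicAlong

theorem cubeAlong_congr {x y : X} {a b : Path x y} (hab : a.Homotopic b)
    {f g : GenLoop (Fin l) X y} (hfg : GenLoop.Homotopic f g) :
    GenLoop.Homotopic (cubeAlong a f) (cubeAlong b g) := by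
  obtain ⟨F'⟩ := hab
  obtain ⟨F⟩ := hfg
  let c (_ : unitInterval) : ℝ := 2
  let H (z : unitInterval × ℝ) : X := F' (z.1, Set.projIcc 0 1 zero_le_one z.2)
  have agree (s : unitInterval) (t : Fin l → unitInterval) (ht : t ∈ Cube.boundary (Fin l)) :
      F (s, t) = H (s, 1) := by
    simp only [F.eq_fst s ht, H, Set.projIcc_right]
    exact (f.2 t ht).trans (F'.target s).symm
  have start (t : Fin l → unitInterval) : cubeRing c F H (0, t) = cubeAlong a f t :=
    cubeRing_eq_cubeAlong (c := c) rfl F.apply_zero (fun _ => F'.apply_zero _) t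
  have finish (t : Fin l → unitInterval) : cubeRing c F H (1, t) = cubeAlong b g t :=
    cubeRing_eq_cubeAlong (c := c) rfl F.apply_one (fun _ => F'.apply_one _) t
  refine ⟨⟨⟨⟨cubeRing c F H, continuous_cubeRing continuous_const F.continuous (by fun_prop)
    agree⟩, start, finish⟩, fun s t ht => ?_⟩⟩
  refine (cubeRing_of_mem_boundary agree one_le_two ht).trans
    (Eq.trans ?_ ((cubeAlong a f).2 t ht).symm)
  simp [H, c]

theorem CubeHomotopicAlong.unique {x y x' y' : X} {a : Path x y} {b : Path x' y'}
    {f : GenLoop (Fin l) X x} {f' : GenLoop (Fin l) X x'} {g : C(Fin l → unitInterval, X)}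
    (h : CubeHomotopicAlong a f.1 g) (h' : CubeHomotopicAlong b f'.1 g) (hab : HHomotopic a b) :
    f.1.HomotopicRel f'.1 (Cube.boundary (Fin l)) := by
  obtain rfl := hab.source_eq
  obtain rfl := hab.target_eq
  obtain ⟨F, hF⟩ := id h
  let g' : GenLoop (Fin l) X y :=
    ⟨g, fun t ht => (F.apply_one t).symm.trans ((hF 1 t ht).trans a.target)⟩
  exact ((h.homotopic_cubeAlong (g := g')).trans (cubeAlong_congr hab (.refl g'))).trans
    (h'.homotopic_cubeAlong (g := g')).symm

theorem cubeClass_eq_cubeClass {x : X} {f g : GenLoop (Fin l) X x} :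
    cubeClass f = cubeClass g ↔ GenLoop.Homotopic f g :=
  Quotient.eq

theorem cubeClass_surjective {x : X} :
    Function.Surjective (cubeClass : GenLoop (Fin l) X x → HomotopyGroup.Pi l X x) :=
  Quotient.mk_surjective

noncomputable instance (l : ℕ) (x : X) : MulAction (LoopGroup X x) (HomotopyGroup.Pi l X x) where
  smul a := Quotient.map₂ (sa := Path.Homotopic.setoid x x) (fun a f => cubeAlong a f)
    (fun _ _ hab _ _ hfg => cubeAlong_congr hab hfg) a.unop
  one_smul := cubeClass_surjective.forall.2 fun f => cubeClass_eq_cubeClass.2 <|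
    (CubeHomotopicAlong.cubeAlong (Path.refl x) f).unique (.refl f) (.refl _)
  mul_smul a b φ := by
    obtain ⟨a, rfl⟩ := LoopGroup.mk_surjective a
    obtain ⟨b, rfl⟩ := LoopGroup.mk_surjective b
    obtain ⟨f, rfl⟩ := cubeClass_surjective φ
    exact cubeClass_eq_cubeClass.2 <| (CubeHomotopicAlong.cubeAlong (a.trans b) f).unique
      ((CubeHomotopicAlong.cubeAlong a _).trans (.cubeAlong b f)) (.refl _)

theorem mk_smul_cubeClass {x : X} (a : Path x x) (f : GenLoop (Fin l) X x) :
    LoopGroup.mk a • cubeClass f = cubeClass (cubeAlong a f) :=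
  rfl

namespace PathClass

variable {x y : X}

/-- The class which results from a map of a cube, the boundary of which is mapped to the end point
of `u`, when the basepoint is moved along `u`. -/
noncomputable def transport (u : PathClass x) (f : C(Fin l → unitInterval, X))
    (hf : ∀ t ∈ Cube.boundary (Fin l), f t = u.endpoint) : HomotopyGroup.Pi l X x :=
  cubeClass (cubeAlong u.rep ⟨f, hf⟩)

theorem transport_eq {u : PathClass x} {a : Path x y} (hu : u = mk a)
    {f : C(Fin l → unitInterval, X)} (hf : ∀ t ∈ Cube.boundary (Fin l), f t = u.endpoint)
    {g : GenLoop (Fin l) X x} (h : CubeHomotopicAlong a g.1 f) :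
    u.transport f hf = cubeClass g :=
  cubeClass_eq_cubeClass.2 <|
    (CubeHomotopicAlong.cubeAlong _ ⟨f, hf⟩).unique h (mk_eq_mk.1 ((mk_rep u).trans hu))

theorem transport_smul (a : LoopGroup X x) (u : PathClass x) {f : C(Fin l → unitInterval, X)}
    (hf : ∀ t ∈ Cube.boundary (Fin l), f t = u.endpoint) :
    (a • u).transport f (fun t ht => (hf t ht).trans (endpoint_smul a u).symm) =
      a • u.transport f hf := by
  obtain ⟨a, rfl⟩ := LoopGroup.mk_surjective a
  obtain ⟨y, b, rfl⟩ := u.mk_surjective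
  have along_b := CubeHomotopicAlong.cubeAlong b ⟨f, hf⟩
  rw [transport_eq rfl hf along_b, mk_smul_cubeClass]
  exact transport_eq (mk_smul_mk a b) _ ((CubeHomotopicAlong.cubeAlong a _).trans along_b)

end PathClass

end Cube

/-! ## Lifts of maps of cubes to covering spaces -/

section CubeLift

variable {X : Type u} [TopologicalSpace X] {Y : Type v} [TopologicalSpace Y] {l : ℕ}

theorem zero_mem_boundary (hl : 0 < l) : (0 : Fin l → unitInterval) ∈ Cube.boundary (Fin l) :=
  ⟨⟨0, hl⟩, .inl rfl⟩

theorem isPreconnected_face (i : Fin l) (c : unitInterval) :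
    IsPreconnected {t : Fin l → unitInterval | t i = c} := by
  have face_eq : {t : Fin l → unitInterval | t i = c} =
      Set.univ.pi (Function.update (fun _ => Set.univ) i ({c} : Set unitInterval)) := by
    ext t
    refine ⟨fun ht j _ => ?_, fun ht => by simpa using ht i trivial⟩
    obtain rfl | hj := eq_or_ne j i
    · simpa using ht
    · simp [hj]
  rw [face_eq]
  refine isPreconnected_univ_pi fun j => ?_
  obtain rfl | hj := eq_or_ne j i
  · simpa using isPreconnected_singleton
  · simpa [hj] using isPreconnected_univ

/-- A cube of dimension greater than `1` has a connected boundary: each face meets a face through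
the vertex `0`. -/
theorem eq_apply_zero_of_mem_boundary {Z : Type w} (hl : 1 < l) {g : (Fin l → unitInterval) → Z}
    (hg : ∀ i, ∀ c : unitInterval, c = 0 ∨ c = 1 → ∀ t t', t i = c → t' i = c → g t = g t')
    {t : Fin l → unitInterval} (ht : t ∈ Cube.boundary (Fin l)) : g t = g 0 := by
  obtain ⟨i, hi⟩ := ht
  have : Nontrivial (Fin l) := Fin.nontrivial_iff_two_le.2 hl
  obtain ⟨j, hj⟩ := exists_ne i
  calc
    g t = g (Function.update t j 0) :=
      hg i _ hi t _ rfl (Function.update_of_ne hj.symm _ _)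
    _ = g 0 := hg j 0 (.inl rfl) _ _ (Function.update_self _ _ _) rfl

theorem exists_lift_cube {p : C(X, Y)} (hp : IsCoveringMap p) {x : X}
    {f : C(Fin l → unitInterval, Y)} (hf : f 0 = p x) :
    ∃ g : C(Fin l → unitInterval, X), g 0 = x ∧ ∀ t, p (g t) = f t := by
  let H : C(unitInterval × (Fin l → unitInterval), Y) :=
    f.comp ⟨fun z i => z.1 * z.2 i, by fun_prop⟩
  have H_zero (t : Fin l → unitInterval) : H (0, t) = p x :=
    (congrArg f (funext fun _ => zero_mul _)).trans hf
  let F := hp.liftHomotopy H (.const _ x) H_zero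
  have p_F (s : unitInterval) (t : Fin l → unitInterval) : p (F (s, t)) = H (s, t) :=
    congrFun (hp.liftHomotopy_lifts H _ H_zero) _
  have F_vertex : F (1, 0) = F (0, 0) :=
    hp.const_of_comp (g := fun s => F (s, 0)) (by fun_prop) (fun s s' => by
      simp only [p_F, H, ContinuousMap.comp_apply, ContinuousMap.coe_mk, Pi.zero_apply,
        mul_zero]) 1 0
  exact ⟨F.comp ⟨fun t => (1, t), by fun_prop⟩,
    F_vertex.trans (hp.liftHomotopy_zero H _ H_zero 0),
    fun t => (p_F 1 t).trans (congrArg f (funext fun _ => one_mul _))⟩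

theorem exists_cubeMap_eq {p : C(X, Y)} (hp : IsCoveringMap p) (hl : 1 < l) {x : X}
    (f : GenLoop (Fin l) Y (p x)) : ∃ g : GenLoop (Fin l) X x, cubeMap p g = f := by
  obtain ⟨g, g_zero, p_g⟩ :=
    exists_lift_cube hp (f := f.1) (f.2 0 (zero_mem_boundary (zero_lt_one.trans hl)))
  have p_g_face {i : Fin l} {c : unitInterval} (hc : c = 0 ∨ c = 1) {t : Fin l → unitInterval}
      (ht : t i = c) : p (g t) = p x :=
    (p_g t).trans (f.2 t ⟨i, ht.symm ▸ hc⟩)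
  have g_face (i : Fin l) (c : unitInterval) (hc : c = 0 ∨ c = 1) (t t' : Fin l → unitInterval)
      (ht : t i = c) (ht' : t' i = c) : g t = g t' :=
    hp.constOn_of_comp (isPreconnected_face i c) g.continuous.continuousOn
      (fun a ha b hb => (p_g_face hc ha).trans (p_g_face hc hb).symm) ht ht'
  exact ⟨⟨g, fun t ht => (eq_apply_zero_of_mem_boundary hl g_face ht).trans g_zero⟩,
    GenLoop.ext _ _ p_g⟩

theorem cubeClass_cubeMap_eq_iff {p : C(X, Y)} (hp : IsCoveringMap p) (hl : 0 < l) {x : X}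
    {f g : GenLoop (Fin l) X x} : cubeClass (cubeMap p f) = cubeClass (cubeMap p g) ↔
      GenLoop.Homotopic f g :=
  cubeClass_eq_cubeClass.trans (hp.homotopicRel_iff_comp ⟨0, zero_mem_boundary hl,
    (f.2 0 (zero_mem_boundary hl)).trans (g.2 0 (zero_mem_boundary hl)).symm⟩).symm

end CubeLift

/-! ## Higher homotopy groups -/

namespace TopOperadStr

variable {D : ℕ → Type u} [∀ n, TopologicalSpace (D n)] (O : TopOperadStr D)

theorem isOperadAction_mapOperad {K : ℕ → Type v} [∀ n, Group (K n)] {P : GroupOperad K}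
    [∀ n, MulAction (K n) (D n)] [∀ n, ContinuousConstSMul (K n) (D n)]
    (hact : IsOperadAction P O.toOperadStr) (A : Type w) [TopologicalSpace A] :
    IsOperadAction P (O.mapOperad A) (act := fun _ => inferInstance) :=
  fun m h σ τ f g => ContinuousMap.ext fun t => hact m h σ τ (f t) fun i => g i t

theorem cubeHomotopicAlong_mapOperad_γ {k n l : ℕ} (m : Fin k → ℕ) (h : ∑ i, m i = n) {x y : D k}
    {x' y' : ∀ i, D (m i)} {a : Path x y} {b : ∀ i, Path (x' i) (y' i)}
    {f f₁ : C(Fin l → unitInterval, D k)} {g g₁ : ∀ i, C(Fin l → unitInterval, D (m i))}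
    (hf : CubeHomotopicAlong a f f₁) (hg : ∀ i, CubeHomotopicAlong (b i) (g i) (g₁ i)) :
    CubeHomotopicAlong (O.pathγ m h a b) ((O.mapOperad _).γ m h f g)
      ((O.mapOperad _).γ m h f₁ g₁) := by
  obtain ⟨F, hF⟩ := hf
  choose G hG using hg
  refine ⟨⟨(O.mapOperad _).γ m h F.toContinuousMap fun i => (G i).toContinuousMap, ?_, ?_⟩, ?_⟩
  · exact fun t => congrArg₂ (O.γ m h) (F.apply_zero t) (funext fun i => (G i).apply_zero t)
  · exact fun t => congrArg₂ (O.γ m h) (F.apply_one t) (funext fun i => (G i).apply_one t)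
  · exact fun s t ht => congrArg₂ (O.γ m h) (hF s t ht) (funext fun i => hG i s t ht)

end TopOperadStr

namespace GoodBasepoint

open PathClass

variable {D : ℕ → Type u} [∀ n, TopologicalSpace (D n)] {O : TopOperadStr D} (η : GoodBasepoint O)
  {Q : ℕ → Type u} [∀ n, TopologicalSpace (Q n)] (p : ∀ n, C(D n, Q n))
  (hcov : ∀ n, IsCoveringMap (p n))

/-- A map of a cube to a covering which is constant on the boundary, with a class of paths in the
base, the lift of which connects the basepoint with the image of the boundary. The paths are taken
in the base in order that its fundamental group acts on them. -/
@[ext]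
structure TetheredCube (l n : ℕ) where
  tether : PathClass (p n (η.pt n))
  cube : C(Fin l → unitInterval, D n)
  cube_boundary : ∀ t ∈ Cube.boundary (Fin l), cube t = liftEndpoint (hcov n) tether

/-- The operad of tethered cubes, composed componentwise. -/
noncomputable def tetheredOperad (l : ℕ) : OperadStr (η.TetheredCube p hcov l) where
  zero_point :=
    have ⟨_⟩ := O.zero_point
    have ⟨_⟩ := (η.quotientPathOperad p hcov).zero_point
    have ⟨_⟩ := (O.mapOperad (Fin l → unitInterval)).zero_point
    ⟨⟨⟨default, default, fun _ _ => Subsingleton.elim _ _⟩,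
      fun _ => TetheredCube.ext (Subsingleton.elim _ _) (Subsingleton.elim _ _)⟩⟩
  one := ⟨(η.quotientPathOperad p hcov).one, (O.mapOperad _).one, fun _ _ =>
    η.map_one.symm.trans (liftEndpoint_map (hcov 1) (mk (.refl (η.pt 1)))).symm⟩
  γ m h T S := ⟨(η.quotientPathOperad p hcov).γ m h T.tether fun i => (S i).tether,
    (O.mapOperad _).γ m h T.cube fun i => (S i).cube, fun t ht => by
      rw [liftEndpoint_quotientPathOperad_γ]
      exact congrArg₂ (O.γ m h) (T.cube_boundary t ht)
        (funext fun i => (S i).cube_boundary t ht)⟩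
  one_γ h T := TetheredCube.ext ((η.quotientPathOperad p hcov).one_γ h T.tether)
    ((O.mapOperad _).one_γ h T.cube)
  γ_one h T := TetheredCube.ext ((η.quotientPathOperad p hcov).γ_one h T.tether)
    ((O.mapOperad _).γ_one h T.cube)
  assoc m hm r hr q hq hN T S R := TetheredCube.ext
    ((η.quotientPathOperad p hcov).assoc m hm r hr q hq hN T.tether (fun i => (S i).tether)
      fun j => (R j).tether)
    ((O.mapOperad _).assoc m hm r hr q hq hN T.cube (fun i => (S i).cube) fun j => (R j).cube)

variable {p hcov} {l : ℕ}

namespace TetheredCube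

variable {η} {n : ℕ}

theorem map_cube_boundary (T : η.TetheredCube p hcov l n) (t : Fin l → unitInterval)
    (ht : t ∈ Cube.boundary (Fin l)) : (p n).comp T.cube t = T.tether.endpoint := by
  obtain ⟨w, f, hf⟩ := T
  obtain ⟨u, rfl⟩ := (map_bijective (hcov n)).2 w
  obtain ⟨x, a, rfl⟩ := u.mk_surjective
  exact congrArg (p n) ((hf t ht).trans (liftEndpoint_map (hcov n) (PathClass.mk a)))

/-- The homotopy class in the base of a tethered cube, moved to the basepoint along its tether. -/
noncomputable def homotopyClass (T : η.TetheredCube p hcov l n) :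
    HomotopyGroup.Pi l (Q n) (p n (η.pt n)) :=
  T.tether.transport ((p n).comp T.cube) T.map_cube_boundary

/-- The relation between a tethered cube and the loops at the basepoint of the covering which result
when the boundary of the cube is moved along the lift of the tether. -/
def ReducesTo (T : η.TetheredCube p hcov l n) (f : GenLoop (Fin l) (D n) (η.pt n)) : Prop :=
  ∃ (x : D n) (a : Path (η.pt n) x),
    T.tether = map (p n) (PathClass.mk a) ∧ CubeHomotopicAlong a f.1 T.cube

theorem exists_reducesTo (T : η.TetheredCube p hcov l n) : ∃ f, T.ReducesTo f := by
  obtain ⟨w, f, hf⟩ := T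
  obtain ⟨u, rfl⟩ := (map_bijective (hcov n)).2 w
  obtain ⟨x, a, rfl⟩ := u.mk_surjective
  exact ⟨_, x, a, rfl,
    .cubeAlong a ⟨f, fun t ht => (hf t ht).trans (liftEndpoint_map (hcov n) (PathClass.mk a))⟩⟩

/-- A loop at the basepoint of the covering, tethered by the constant path. -/
noncomputable def ofGenLoop (f : GenLoop (Fin l) (D n) (η.pt n)) : η.TetheredCube p hcov l n :=
  ⟨map (p n) (PathClass.mk (.refl _)), f.1, fun t ht =>
    (f.2 t ht).trans (liftEndpoint_map (hcov n) (PathClass.mk (.refl _))).symm⟩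

theorem ofGenLoop_reducesTo (f : GenLoop (Fin l) (D n) (η.pt n)) :
    (ofGenLoop f : η.TetheredCube p hcov l n).ReducesTo f :=
  ⟨_, .refl _, rfl, .refl f⟩

theorem ReducesTo.homotopyClass_eq {T : η.TetheredCube p hcov l n}
    {f : GenLoop (Fin l) (D n) (η.pt n)} (hT : T.ReducesTo f) :
    T.homotopyClass = cubeClass (cubeMap (p n) f) :=
  let ⟨_, _, tether_eq, along⟩ := hT
  transport_eq tether_eq _ (along.map (p n))

theorem homotopyClass_surjective (hl : 1 < l) :
    Function.Surjective (TetheredCube.homotopyClass : η.TetheredCube p hcov l n → _) :=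
  cubeClass_surjective.forall.2 fun f =>
    let ⟨g, hg⟩ := exists_cubeMap_eq (hcov n) hl f
    ⟨ofGenLoop g, (ofGenLoop_reducesTo g).homotopyClass_eq.trans (congrArg cubeClass hg)⟩

theorem ReducesTo.γ {k : ℕ} {m : Fin k → ℕ} (h : ∑ i, m i = n) {T : η.TetheredCube p hcov l k}
    {S : ∀ i, η.TetheredCube p hcov l (m i)} {f : GenLoop (Fin l) (D k) (η.pt k)}
    {g : ∀ i, GenLoop (Fin l) (D (m i)) (η.pt (m i))} (hT : T.ReducesTo f)
    (hS : ∀ i, (S i).ReducesTo (g i)) :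
    ((η.tetheredOperad p hcov l).γ m h T S).ReducesTo
      (cubeAlong (η.linear m h) (O.cubeγ m h f g)) := by
  obtain ⟨x, a, tether_eq, along⟩ := hT
  choose y b tether_eq' along' using hS
  refine ⟨_, (η.linear m h).trans (O.pathγ m h a b), ?_,
    (CubeHomotopicAlong.cubeAlong _ _).trans (O.cubeHomotopicAlong_mapOperad_γ m h along along')⟩
  rw [← pathOperad_γ_mk, ← quotientPathOperad_γ_map]
  exact congrArg₂ ((η.quotientPathOperad p hcov).γ m h) tether_eq (funext tether_eq')

theorem homotopyClass_γ_congr (hl : 0 < l) {k : ℕ} (m : Fin k → ℕ) (h : ∑ i, m i = n)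
    {T T' : η.TetheredCube p hcov l k} {S S' : ∀ i, η.TetheredCube p hcov l (m i)}
    (hT : T.homotopyClass = T'.homotopyClass)
    (hS : ∀ i, (S i).homotopyClass = (S' i).homotopyClass) :
    ((η.tetheredOperad p hcov l).γ m h T S).homotopyClass =
      ((η.tetheredOperad p hcov l).γ m h T' S').homotopyClass := by
  obtain ⟨f, hf⟩ := T.exists_reducesTo
  obtain ⟨f', hf'⟩ := T'.exists_reducesTo
  choose g hg using fun i => (S i).exists_reducesTo
  choose g' hg' using fun i => (S' i).exists_reducesTo
  rw [hf.homotopyClass_eq, hf'.homotopyClass_eq, cubeClass_cubeMap_eq_iff (hcov k) hl] at hT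
  have hgg' (i : Fin k) : GenLoop.Homotopic (g i) (g' i) := by
    rw [← cubeClass_cubeMap_eq_iff (hcov (m i)) hl, ← (hg i).homotopyClass_eq,
      ← (hg' i).homotopyClass_eq, hS]
  rw [(hf.γ h hg).homotopyClass_eq, (hf'.γ h hg').homotopyClass_eq,
    cubeClass_cubeMap_eq_iff (hcov n) hl]
  exact cubeAlong_congr (.refl _) (O.homotopicRel_mapOperad_γ m h hT hgg')

end TetheredCube

variable (p hcov)

/-- The operad of the higher homotopy groups of the base spaces of coverings. -/
noncomputable def higherOperad (hl : 1 < l) :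
    OperadStr fun n => HomotopyGroup.Pi l (Q n) (p n (η.pt n)) :=
  .ofSurjective (O := η.tetheredOperad p hcov l) (fun _ => TetheredCube.homotopyClass)
    (fun _ => TetheredCube.homotopyClass_surjective hl)
    (TetheredCube.homotopyClass_γ_congr (zero_lt_one.trans hl))

theorem higherOperad_γ_homotopyClass (hl : 1 < l) {k n : ℕ} (m : Fin k → ℕ) (h : ∑ i, m i = n)
    (T : η.TetheredCube p hcov l k) (S : ∀ i, η.TetheredCube p hcov l (m i)) :
    (η.higherOperad p hcov hl).γ m h T.homotopyClass (fun i => (S i).homotopyClass) =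
      ((η.tetheredOperad p hcov l).γ m h T S).homotopyClass :=
  OperadStr.ofSurjective_γ _ _ (TetheredCube.homotopyClass_γ_congr (zero_lt_one.trans hl)) m h T S

theorem isHigherOperad_higherOperad (hl : 1 < l) :
    η.IsHigherOperad p l (η.higherOperad p hcov hl) := by
  constructor
  · have one_eq : (η.tetheredOperad p hcov l).one = .ofGenLoop GenLoop.const :=
      TetheredCube.ext rfl (ContinuousMap.ext fun _ => η.map_one.symm)
    exact (congrArg _ one_eq).trans (TetheredCube.ofGenLoop_reducesTo _).homotopyClass_eq
  · intro k n m h f g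
    have hf := TetheredCube.ofGenLoop_reducesTo (hcov := hcov) f
    have hg i := TetheredCube.ofGenLoop_reducesTo (hcov := hcov) (g i)
    exact (congrArg₂ ((η.higherOperad p hcov hl).γ m h) hf.homotopyClass_eq
      (funext fun i => (hg i).homotopyClass_eq)).symm.trans
        ((η.higherOperad_γ_homotopyClass p hcov hl m h _ _).trans (hf.γ h hg).homotopyClass_eq)

variable {K : ℕ → Type v} [∀ n, Group (K n)] {P : GroupOperad K} [∀ n, MulAction (K n) (D n)]
  [∀ n, ContinuousConstSMul (K n) (D n)]
  (hp : ∀ (n : ℕ) (σ : K n) (x : D n), p n (σ • x) = p n x)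
  (hq : ∀ n, IsQuotientCoveringMap (p n) (K n)) (hact : IsOperadAction P O.toOperadStr)

/-- The action of the fundamental group of the base on tethered cubes: a loop is put in front of the
tether, and its degree moves the cube. -/
noncomputable abbrev tetheredAction (l n : ℕ) :
    MulAction (LoopGroup (Q n) (p n (η.pt n)))
      (η.TetheredCube p (fun n => (hq n).isCoveringMap) l n) where
  smul a T := ⟨a • T.tether, η.degree p hp hq n a • T.cube, fun t ht => by
    rw [η.liftEndpoint_smul p hp hq, ← T.cube_boundary t ht]
    rfl⟩
  one_smul T := TetheredCube.ext (one_smul _ _)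
    ((congrArg (· • T.cube) (map_one (η.degree p hp hq n))).trans (one_smul _ _))
  mul_smul a b T := TetheredCube.ext (mul_smul _ _ _)
    ((congrArg (· • T.cube) (map_mul (η.degree p hp hq n) a b)).trans (mul_smul _ _ _))

theorem isOperadAction_tetheredOperad (l : ℕ) :
    IsOperadAction (η.quotientLoopOperad p hp hq hact)
      (η.tetheredOperad p (fun n => (hq n).isCoveringMap) l)
      (act := η.tetheredAction p hp hq l) :=
  fun m h a b T S => TetheredCube.ext
    (η.isOperadAction_quotientLoopOperad p hp hq hact m h a b T.tether fun i => (S i).tether)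
    ((O.isOperadAction_mapOperad hact _ m h (η.degree p hp hq _ a)
      (fun i => η.degree p hp hq _ (b i)) T.cube fun i => (S i).cube).trans
        (congrArg (· • _) (η.degree_quotientLoopγ p hp hq hact m h a b).symm))

theorem homotopyClass_tetheredAction_smul {n : ℕ} (a : LoopGroup (Q n) (p n (η.pt n)))
    (T : η.TetheredCube p (fun n => (hq n).isCoveringMap) l n) :
    ((η.tetheredAction p hp hq l n).smul a T).homotopyClass = a • T.homotopyClass := by
  have cube_eq : (p n).comp (η.degree p hp hq n a • T.cube) = (p n).comp T.cube :=
    ContinuousMap.ext fun t => hp n _ _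
  have transport_congr {f f' : C(Fin l → unitInterval, Q n)} {u : PathClass (p n (η.pt n))}
      (e : f = f') (hf : ∀ t ∈ Cube.boundary (Fin l), f t = u.endpoint) :
      u.transport f hf = u.transport f' (e ▸ hf) := by
    subst e
    rfl
  exact (transport_congr cube_eq _).trans (transport_smul a T.tether T.map_cube_boundary)

theorem isOperadAction_higherOperad (hl : 1 < l) :
    IsOperadAction (η.quotientLoopOperad p hp hq hact)
      (η.higherOperad p (fun n => (hq n).isCoveringMap) hl) :=
  letI := η.tetheredAction p hp hq l
  IsOperadAction.ofSurjective _ _ (TetheredCube.homotopyClass_γ_congr (zero_lt_one.trans hl))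
    (η.isOperadAction_tetheredOperad p hp hq hact l) fun _ =>
      η.homotopyClass_tetheredAction_smul p hp hq

end GoodBasepoint

theorem mainTheorem9 {G : ℕ → Type v} [∀ n, Group (G n)] (P : GroupOperad G)
    (H : SubGroupOperad P) [∀ n, (H.carrier n).Normal] (hH : H.NonCrossed)
    {C : ℕ → Type u} [∀ n, TopologicalSpace (C n)] (O : TopOperadStr C)
    [∀ n, MulAction (G n) (C n)] [∀ n, ContinuousConstSMul (G n) (C n)]
    (hact : IsOperadAction P O.toOperadStr)
    (hpath : ∀ n, PathConnectedSpace (OrbitSpace (H.carrier n) (C n)))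
    (hcov : ∀ n, IsCoveringAction (G n ⧸ H.carrier n) (OrbitSpace (H.carrier n) (C n)))
    (η : GoodBasepoint (H.quotientOperad hH hact)) :
    ∃ (A : GroupOperad fun n => LoopGroup (OrbitSpace (H.carrier n) (C n)) (η.pt n))
      (B : GroupOperad fun n =>
        LoopGroup (OrbitSpace (G n) (C n)) (OrbitSpace.proj (H.carrier n) (η.pt n))),
      -- `π₁ (C / H)` is a non-crossed group operad
      (η.IsLoopOperad A ∧ A.NonCrossed) ∧
      -- `π₁ (C / G)` is a group operad
      η.IsQuotientLoopOperad (H.isOperadAction_quotient hH hact)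
        (fun n => OrbitSpace.proj (H.carrier n)) (fun n => OrbitSpace.proj_smul (H.carrier n)) B ∧
      -- `π₁ (C / G) = π₁ ((C / H) / (G / H))`
      (∃ (B' : GroupOperad fun n =>
          LoopGroup (OrbitSpace (G n ⧸ H.carrier n) (OrbitSpace (H.carrier n) (C n)))
            (OrbitSpace.mk (G n ⧸ H.carrier n) (η.pt n)))
          (Φ : GroupOperadHom B' B),
        η.IsQuotientLoopOperad (H.isOperadAction_quotient hH hact)
          (fun n => ⟨OrbitSpace.mk (G n ⧸ H.carrier n), OrbitSpace.continuous_mk⟩)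
          (fun n σ x => OrbitSpace.mk_eq_mk.2 ⟨σ, rfl⟩) B' ∧
        ∀ n, IsHomeomorph (OrbitSpace.iterated (H.carrier n) (X := C n)) ∧
          (∀ f : Path (OrbitSpace.mk (G n ⧸ H.carrier n) (η.pt n))
              (OrbitSpace.mk (G n ⧸ H.carrier n) (η.pt n)),
            Φ.toHom n (LoopGroup.mk f) =
              LoopGroup.mk (f.map (OrbitSpace.iterated (H.carrier n)).continuous)) ∧
          Function.Bijective (Φ.toHom n)) ∧
      -- the short exact sequence `1 → π₁ (C / H) → π₁ (C / G) → G / H → 1`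
      (∃ (ι : GroupOperadHom A B) (bd : GroupOperadHom B (H.quotient hH)),
        (∀ n (f : Path (η.pt n) (η.pt n)),
          ι.toHom n (LoopGroup.mk f) =
            LoopGroup.mk (f.map (OrbitSpace.proj (H.carrier n)).continuous)) ∧
        (∀ n (σ : G n ⧸ H.carrier n) (f : Path (η.pt n) (σ • η.pt n)),
          bd.toHom n (η.liftClass (fun n => OrbitSpace.proj (H.carrier n))
            (fun n => OrbitSpace.proj_smul (H.carrier n)) σ f) = σ) ∧
        ∀ n, Function.Injective (ι.toHom n) ∧ (ι.toHom n).range = (bd.toHom n).ker ∧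
          Function.Surjective (bd.toHom n)) ∧
      -- `π_l (C / G)` is a `π₁ (C / G)`-operad for `l > 1`
      (∀ l : ℕ, 1 < l →
        ∃ (Ol : OperadStr fun n => HomotopyGroup.Pi l (OrbitSpace (G n) (C n))
            (OrbitSpace.proj (H.carrier n) (η.pt n)))
          (act : ∀ n, MulAction
            (LoopGroup (OrbitSpace (G n) (C n)) (OrbitSpace.proj (H.carrier n) (η.pt n)))
            (HomotopyGroup.Pi l (OrbitSpace (G n) (C n))
              (OrbitSpace.proj (H.carrier n) (η.pt n)))),
          η.IsHigherOperad (fun n => OrbitSpace.proj (H.carrier n)) l Ol ∧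
          (∀ n (a : Path (OrbitSpace.proj (G := G n) (H.carrier n) (η.pt n))
              (OrbitSpace.proj (H.carrier n) (η.pt n)))
            (f : GenLoop (Fin l) (OrbitSpace (G n) (C n))
              (OrbitSpace.proj (H.carrier n) (η.pt n))),
            (act n).smul (LoopGroup.mk a) (cubeClass f) = cubeClass (cubeAlong a f)) ∧
          IsOperadAction B Ol (act := act)) ∧
      -- for `l = 1` the same holds if `G` is non-crossed
      (P.NonCrossed →
        ∃ act : ∀ n, MulAction
            (LoopGroup (OrbitSpace (G n) (C n)) (OrbitSpace.proj (H.carrier n) (η.pt n)))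
            (LoopGroup (OrbitSpace (G n) (C n)) (OrbitSpace.proj (H.carrier n) (η.pt n))),
          (∀ n (a b : LoopGroup (OrbitSpace (G n) (C n))
            (OrbitSpace.proj (H.carrier n) (η.pt n))), (act n).smul a b = a * b * a⁻¹) ∧
          IsOperadAction B B.toOperadStr (act := act)) := by
  let p n := OrbitSpace.proj (H.carrier n) (X := C n)
  let p' n : C(OrbitSpace (H.carrier n) (C n), _) :=
    ⟨OrbitSpace.mk (G n ⧸ H.carrier n), OrbitSpace.continuous_mk⟩
  have hact' : IsOperadAction (H.quotient hH) (H.quotientOperad hH hact).toOperadStr :=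
    H.isOperadAction_quotient hH hact
  have hp n := OrbitSpace.proj_smul (H.carrier n) (X := C n)
  have hp' n (σ : G n ⧸ H.carrier n) (x) : p' n (σ • x) = p' n x := OrbitSpace.mk_eq_mk.2 ⟨σ, rfl⟩
  have hq n := OrbitSpace.isQuotientCoveringMap_proj (H.carrier n) (hcov n)
  have hq' n : IsQuotientCoveringMap (p' n) (G n ⧸ H.carrier n) :=
    OrbitSpace.isQuotientCoveringMap_mk (hcov n)
  refine ⟨η.loopOperad, η.quotientLoopOperad p hp hq hact',
    ⟨η.isLoopOperad_loopOperad, η.nonCrossed_loopOperad⟩,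
    η.isQuotientLoopOperad_quotientLoopOperad p hp hq hact',
    ⟨η.quotientLoopOperad p' hp' hq' hact',
      η.quotientMapHom p' hp' hq' hact' (fun n => OrbitSpace.iterated (H.carrier n)) hp hq,
      η.isQuotientLoopOperad_quotientLoopOperad p' hp' hq' hact', fun n =>
      ⟨OrbitSpace.isHomeomorph_iterated _, fun _ => rfl,
        η.map_quotient_bijective p' hp' hq' (fun n => OrbitSpace.iterated (H.carrier n)) hp hq n⟩⟩,
    ⟨η.projHom p hp hq hact', η.degreeHom p hp hq hact', fun _ _ => rfl,
      fun _ => η.degree_liftClass p hp hq, fun n => η.exact_projHom_degreeHom p hp hq hact' n⟩,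
    fun l hl => ⟨η.higherOperad p _ hl, fun _ => inferInstance,
      η.isHigherOperad_higherOperad p _ hl, fun _ => mk_smul_cubeClass,
      η.isOperadAction_higherOperad p hp hq hact' hl⟩,
    fun hP => ⟨fun _ => conjAction _, fun _ _ _ => rfl, ?_⟩⟩
  exact (η.nonCrossed_quotientLoopOperad p hp hq hact' (hP.quotient H hH)).isOperadAction_conjAction
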